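/- A link diagram $D$ in the plane (or sphere) has $n(D)$ crossings. A crossing is nugatory if some simple closed curve meets $D$ only at this crossing and passes through it from one corner to the opposite one; $D$ is reduced if it has no nugatory crossing, and alternating if over- and undercrossings alternate along each of its strands. For a state $s$, i.e. a choice of a marker $s(c)=\pm1$ at every crossing $c$, let $|sD|$ be the number of circles obtained by smoothing every crossing according to its marker ($+1$ being the smoothing that joins the two regions swept by the overpass when it is rotated counterclockwise). The Kauffman bracket is $$\langle D\rangle=\sum_s A^{\sum_c s(c)}(-A^2-A^{-2})^{|sD|-1},$$ and for an orientation of $D$ with writhe (sum of crossing signs) $w$ the Jones polynomial of the oriented link is $V_L(t)=\big((-A^3)^{-w}\langle D\rangle\big)\big|_{A=t^{-1/4}}$. For an unoriented link $L$, statements about $V_L$ are meant for every orientation of $L$. The span of a Laurent polynomial (with possibly fractional exponents) is its maximal minus its minimal exponent. The diagram $D$ is $+$-adequate (resp. $-$-adequate) if, when all crossings are smoothed with marker $+1$ (resp. $-1$), the two new arcs at each crossing lie on different circles. A link is non-split if all of its diagrams are connected; it is prime if, whenever it is a connected sum of two links, one of them is the trivial knot (the trivial knot itself is allowed). The crossing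 number of $L$ is the minimal number of crossings of a diagram of $L$. Let $L$ be a link (nonempty, up to isotopy). Then: 1. If the coefficient of the monomial of minimal (resp. maximal) degree in $V_L(t)$ is not $\pm1$, then $L$ cannot be represented by a $+$-adequate (resp. $-$-adequate) diagram. 2. If $D$ is a connected reduced alternating diagram of $L$ with $n$ crossings, then $\operatorname{span}\langle D\rangle=4\operatorname{span}V_L(t)=4n$. 3. If $L$ is prime and non-split, then $\operatorname{span}V_L(t)<n(D)$ for every nonalternating diagram $D$ of $L$. 4. (First Tait conjecture.) (i) Every reduced alternating diagram of $L$, connected or not, has the minimal number of crossings among all diagrams of $L$. (ii) If moreover $L$ is prime and non-split and has a reduced alternating diagram, then every nonalternating diagram of $L$ has more crossings than the crossing number of $L$. -/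

import Mathlib

/-- An (unoriented) link diagram on the sphere, as a planar diagram code.

`X` is the set of crossings, `E` the set of arcs (edges) of the underlying 4-valent plane graph,
a crossingless circle of the diagram being an arc that meets no crossing.  The four ends of arcs
at a crossing `c` are `(c, 0), (c, 1), (c, 2), (c, 3)`, listed counterclockwise; `(c, 0)` and
`(c, 2)` belong to the strand passing under, `(c, 1)` and `(c, 3)` to the strand passing over.
`arc (c, i)` is the arc that ends there.

* `mate`: every arc meeting a crossing has exactly two ends.
* `planar`: every connected component of the underlying 4-valent graph with rotation system has
  Euler characteristic `V - E + F = 2` (there are `V = |X|` vertices and `2|X|` edges; the faces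
  are the orbits of the face permutation on the ends of arcs).  All components have Euler
  characteristic at most `2`, so it is enough to require this of the sum.
* `nonempty`: the diagram is not empty.

The relative position of the connected components of a disconnected diagram is not recorded: it
does not influence the link. -/
structure LinkDiagram where
  X : Type
  E : Type
  [fintypeX : Fintype X]
  [decEqX : DecidableEq X]
  [fintypeE : Fintype E]
  [decEqE : DecidableEq E]
  arc : X × ZMod 4 → E
  nonempty : Nonempty E
  mate : ∀ d : X × ZMod 4, ∃! d' : X × ZMod 4, d' ≠ d ∧ arc d' = arc d
  planar :
    Nat.card (Quot fun d d' : X × ZMod 4 =>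
        ∃ m : X × ZMod 4, m ≠ d ∧ arc m = arc d ∧ d' = (m.1, m.2 + 1))
      = Fintype.card X
        + 2 * Nat.card (Quot fun c c' : X => ∃ i j : ZMod 4, arc (c, i) = arc (c', j))

namespace LinkDiagram

attribute [instance] fintypeX decEqX fintypeE decEqE

/-- The number `n(D)` of crossings. -/
def crossings (D : LinkDiagram) : ℕ := Fintype.card D.X

/-- The ends belonging to the overpassing strand. -/
def IsOver (i : ZMod 4) : Prop := i = 1 ∨ i = 3

/-- The face permutation (as a relation): go along the arc that starts at the end `d`, arrive at
the end `m`, and continue with the end next to `m` in the counterclockwise order.  The end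
`(c, i)` thereby stands for the corner at `c` between `(c, i - 1)` and `(c, i)`. -/
def FaceStep (D : LinkDiagram) (d d' : D.X × ZMod 4) : Prop :=
  ∃ m : D.X × ZMod 4, m ≠ d ∧ D.arc m = D.arc d ∧ d' = (m.1, m.2 + 1)

/-- Two corners lie in the same face (region of the complement). -/
def SameFace (D : LinkDiagram) : D.X × ZMod 4 → D.X × ZMod 4 → Prop :=
  Relation.EqvGen D.FaceStep

/-- The underlying plane curve is connected. -/
def Connected (D : LinkDiagram) : Prop :=
  ∀ x y : D.E,
    Relation.EqvGen (fun x y => ∃ c i j, x = D.arc (c, i) ∧ y = D.arc (c, j)) x y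

/-- Over- and undercrossings alternate: every arc has one end on an overpassing strand and one end
on an underpassing strand (or is a crossingless circle). -/
def Alternating (D : LinkDiagram) : Prop :=
  ∀ d d' : D.X × ZMod 4, d ≠ d' → D.arc d = D.arc d' → (IsOver d.2 ↔ ¬ IsOver d'.2)

/-- A crossing is nugatory if two opposite corners at it lie in the same face, that is, if there is
a simple closed curve that meets the diagram only at this crossing, passing through it from one
corner to the opposite one. -/
def Nugatory (D : LinkDiagram) (c : D.X) : Prop :=
  ∃ i : ZMod 4, D.SameFace (c, i) (c, i + 2)

/-- A diagram is reduced if it has no nugatory crossing. -/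
def Reduced (D : LinkDiagram) : Prop := ∀ c, ¬ D.Nugatory c

/-! ### Reidemeister moves -/

/-- An isomorphism of diagrams (an orientation preserving homeomorphism of the sphere): a bijection
of crossings and of arcs which at each crossing preserves the cyclic order and the height of the
strands; so it may rotate the labels of the ends by a half turn. -/
def Iso (D D' : LinkDiagram) : Prop :=
  ∃ (f : D.X ≃ D'.X) (g : D.E ≃ D'.E) (r : D.X → ZMod 4),
    (∀ c, r c = 0 ∨ r c = 2) ∧ ∀ c i, D'.arc (f c, i + r c) = g (D.arc (c, i))

/-- `D` arises from `D'` by erasing the crossings in `R` from the code: opposite ends at such a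
crossing are joined, the strands running through. -/
def IsErasure (D' D : LinkDiagram) (R : Set D'.X) : Prop :=
  ∃ (f : D.X ≃ {c : D'.X // c ∉ R}) (q : D'.E → D.E),
    Function.Surjective q ∧
    (∀ x y, q x = q y ↔
      Relation.EqvGen
        (fun x y => ∃ c ∈ R, ∃ i, x = D'.arc (c, i) ∧ y = D'.arc (c, i + 2)) x y) ∧
    ∀ c i, D.arc (c, i) = q (D'.arc ((f c).1, i))

/-- First Reidemeister move: `D'` has a kink (a face with one corner), which is removed in `D`. -/
def ReidemeisterOne (D' D : LinkDiagram) : Prop :=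
  ∃ (c : D'.X) (i : ZMod 4),
    D'.arc (c, i) = D'.arc (c, i + 1) ∧ D'.IsErasure D {c}

/-- Second Reidemeister move: `D'` has a face with two corners, at the crossings `c ≠ c'`, one side
of which lies over the other; the two strands are pulled apart in `D`. -/
def ReidemeisterTwo (D' D : LinkDiagram) : Prop :=
  ∃ (c c' : D'.X) (i j : ZMod 4), c ≠ c' ∧
    D'.arc (c, i) = D'.arc (c', j + 1) ∧ D'.arc (c, i + 1) = D'.arc (c', j) ∧
    (IsOver (i + 1) ↔ IsOver j) ∧ D'.IsErasure D {c, c'}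

/-- Third Reidemeister move: `D` has a triangular face with three different corners `c 0, c 1, c 2`,
whose sides are the arcs from the end `(c k, p k + 1)` to the end `(c (k + 1), p (k + 1))`; the side
from `c 0` to `c 1` belongs to a strand passing over at both crossings.  In `D'` each of the three
strands is moved across the crossing of the two others: it meets its two crossings in the opposite
order, so the sides of the new triangle are at the ends opposite to the ones of the old. -/
def ReidemeisterThree (D D' : LinkDiagram) : Prop :=
  ∃ (c : Fin 3 → D.X) (p : Fin 3 → ZMod 4) (f : D.X ≃ D'.X) (g : D.E ≃ D'.E),
    Function.Injective c ∧
    (∀ k, D.arc (c k, p k + 1) = D.arc (c (k + 1), p (k + 1))) ∧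
    IsOver (p 0 + 1) ∧ IsOver (p 1) ∧
    (∀ k, D'.arc (f (c k), p k + 2) = g (D.arc (c k, p k))) ∧
    (∀ k, D'.arc (f (c k), p k + 3) = g (D.arc (c k, p k + 1))) ∧
    (∀ k, D'.arc (f (c k), p k + 1) = g (D.arc (c (k + 1), p (k + 1) + 2))) ∧
    (∀ k, D'.arc (f (c (k + 1)), p (k + 1)) = g (D.arc (c k, p k + 3))) ∧
    ∀ x i, x ∉ Set.range c → D'.arc (f x, i) = g (D.arc (x, i))

/-- One move between diagrams. -/
def Step (D D' : LinkDiagram) : Prop :=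
  Iso D D' ∨ ReidemeisterOne D D' ∨ ReidemeisterTwo D D' ∨ ReidemeisterThree D D'

/-! ### Kauffman bracket and Jones polynomial -/

/-- At the crossing `c`, a state smooths with the marker `+1` by joining the ends `0, 1` and the
ends `2, 3` (this opens the two regions swept by the overpass when it is rotated
counterclockwise), and with the marker `-1` by joining `1, 2` and `3, 0`. -/
def StateStep (D : LinkDiagram) (s : D.X → ℤˣ) (x y : D.E) : Prop :=
  ∃ c i, ((s c = 1 ∧ (i = 0 ∨ i = 2)) ∨ (s c = -1 ∧ (i = 1 ∨ i = 3))) ∧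
    x = D.arc (c, i) ∧ y = D.arc (c, i + 1)

/-- The number `|sD|` of circles of the diagram smoothed according to the state `s`. -/
noncomputable def stateCircles (D : LinkDiagram) (s : D.X → ℤˣ) : ℕ :=
  Nat.card (Quot (D.StateStep s))

open LaurentPolynomial in
/-- The Kauffman bracket `⟨D⟩ = ∑ₛ A ^ (∑ᵢ s(i)) (-A² - A⁻²) ^ (|sD| - 1)`, a Laurent polynomial in
the variable `A = T 1`. -/
noncomputable def bracket (D : LinkDiagram) : LaurentPolynomial ℤ :=
  ∑ s : D.X → ℤˣ, T (∑ c, (s c : ℤ)) * (-T 2 - T (-2)) ^ (D.stateCircles s - 1)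

/-- An orientation of the diagram: `out d` says that the arc ending at `d` is directed away from
the crossing.  Strands run through the crossings, and an arc directed away from the crossing at
one of its ends is directed towards the crossing at the other.  (The direction of crossingless
circles plays no role for the Jones polynomial and is not recorded.) -/
structure Orientation (D : LinkDiagram) where
  out : D.X × ZMod 4 → Bool
  through : ∀ c i, out (c, i + 2) = !out (c, i)
  along : ∀ d d', d ≠ d' → D.arc d = D.arc d' → out d' = !out d

/-- The Tait (writhe) number, the sum of the signs of the crossings.  A crossing is positive if
turning the overpass counterclockwise by less than a half turn past the corner between the two
outgoing ends brings it to the underpass with the right direction, that is, if the outgoing ends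
are `1, 2` or `3, 0`. -/
def writhe (D : LinkDiagram) (o : D.Orientation) : ℤ :=
  ∑ c, if o.out (c, 1) = o.out (c, 2) then 1 else -1

open LaurentPolynomial in
/-- The polynomial `f_D(A) = (-A³) ^ (-Tait(D)) ⟨D⟩`. -/
noncomputable def normalizedBracket (D : LinkDiagram) (o : D.Orientation) : LaurentPolynomial ℤ :=
  C ((D.writhe o).negOnePow : ℤ) * T (-3 * D.writhe o) * D.bracket

/-- The Jones polynomial `V(t) = f_D(t ^ (-1/4))` of an oriented diagram, as an element of the ring
of polynomials in `t` with rational exponents. -/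
noncomputable def jones (D : LinkDiagram) (o : D.Orientation) : AddMonoidAlgebra ℤ ℚ :=
  AddMonoidAlgebra.mapDomain (fun k : ℤ => -(k : ℚ) / 4) (D.normalizedBracket o)

/-- `+`-adequate: in `s₊D` (all markers `+1`) the two new arcs at each crossing lie on different
circles. -/
def PlusAdequate (D : LinkDiagram) : Prop :=
  ∀ c, ¬ Relation.EqvGen (D.StateStep fun _ => 1) (D.arc (c, 0)) (D.arc (c, 2))

/-- `-`-adequate: in `s₋D` (all markers `-1`) the two new arcs at each crossing lie on different
circles. -/
def MinusAdequate (D : LinkDiagram) : Prop :=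
  ∀ c, ¬ Relation.EqvGen (D.StateStep fun _ => -1) (D.arc (c, 1)) (D.arc (c, 3))

/-! ### Connected sums -/

/-- `D` is a connected sum of the diagrams `D₁` and `D₂`: an arc `e₁` of `D₁` and an arc `e₂` of
`D₂` are cut open and the ends joined crosswise by the arcs `a` and `b`, each of which has one end
in `D₁` and one in `D₂`.  If `e₁` or `e₂` is a crossingless circle, this leaves a single arc
`a = b`. -/
def IsConnectedSum (D D₁ D₂ : LinkDiagram) : Prop :=
  ∃ (e₁ : D₁.E) (e₂ : D₂.E) (f : D₁.X ⊕ D₂.X ≃ D.X)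
    (g : {x : D₁.E // x ≠ e₁} ⊕ {x : D₂.E // x ≠ e₂} → D.E) (a b : D.E),
    Function.Injective g ∧ (∀ z, z ∈ Set.range g ↔ ¬ (z = a ∨ z = b)) ∧
    (∀ c i (h : D₁.arc (c, i) ≠ e₁), D.arc (f (.inl c), i) = g (.inl ⟨D₁.arc (c, i), h⟩)) ∧
    (∀ c i (h : D₂.arc (c, i) ≠ e₂), D.arc (f (.inr c), i) = g (.inr ⟨D₂.arc (c, i), h⟩)) ∧
    (∀ c i, D₁.arc (c, i) = e₁ → D.arc (f (.inl c), i) = a ∨ D.arc (f (.inl c), i) = b) ∧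
    (∀ c i, D₂.arc (c, i) = e₂ → D.arc (f (.inr c), i) = a ∨ D.arc (f (.inr c), i) = b) ∧
    (a ≠ b → ∀ z, z = a ∨ z = b →
      (∃ c i, D.arc (f (.inl c), i) = z) ∧ ∃ c i, D.arc (f (.inr c), i) = z)

/-- The crossingless diagram of the trivial knot. -/
def circle : LinkDiagram where
  X := Empty
  E := Unit
  arc := fun _ => ()
  nonempty := ⟨()⟩
  mate := fun d => d.1.elim
  planar := by
    have h1 : IsEmpty (Empty × ZMod 4) := ⟨fun d => d.1.elim⟩
    simp

end LinkDiagram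

/-- A (tame, unoriented) link, up to isotopy: a class of diagrams up to Reidemeister moves. -/
def Link : Type 1 := Quot LinkDiagram.Step

/-- The link represented by a diagram. -/
def LinkDiagram.toLink (D : LinkDiagram) : Link := Quot.mk _ D

namespace Link

/-- The trivial knot. -/
def unknot : Link := LinkDiagram.circle.toLink

/-- `V` is the Jones polynomial of `L` for some choice of orientation of `L`. -/
def IsJones (L : Link) (V : AddMonoidAlgebra ℤ ℚ) : Prop :=
  ∃ (D : LinkDiagram) (o : D.Orientation), D.toLink = L ∧ V = D.jones o

/-- `L` is not a split link: it has no disconnected diagram. -/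
def NonSplit (L : Link) : Prop := ∀ D : LinkDiagram, D.toLink = L → D.Connected

/-- `L` is prime: it is not a connected sum of two links both different from the trivial knot.
(The trivial knot itself is not excluded.) -/
def IsPrime (L : Link) : Prop :=
  ∀ D D₁ D₂ : LinkDiagram, D.toLink = L → D.IsConnectedSum D₁ D₂ →
    D₁.toLink = unknot ∨ D₂.toLink = unknot

/-- The crossing number: the least number of crossings of a diagram of `L`. -/
noncomputable def crossingNumber (L : Link) : ℕ :=
  sInf {n | ∃ D : LinkDiagram, D.toLink = L ∧ D.crossings = n}

end Link

/-- The span of a (generalized) Laurent polynomial: the difference between its largest and its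
smallest exponent. -/
def polySpan {Γ : Type*} [LinearOrder Γ] [AddGroup Γ] (p : AddMonoidAlgebra ℤ Γ) : Γ :=
  if h : p.coeff.support.Nonempty then p.coeff.support.max' h - p.coeff.support.min' h else 0

/-! Write δ = -A² - A⁻². Reidemeister moves change the bracket only by a factor ±A^k
(`bracket_unitEquiv`), so its span, its extreme coefficients up to sign and its divisibility by
powers of δ depend on the link alone. A Jones polynomial is the bracket up to a unit with exponents
divided by -4, so every claim reduces to the bracket, and invariance of the writhe is never needed.

Changing a marker moves the marker sum by 2 and the number of circles by at most 1. Hence the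
exponents lie between the extreme ones of the two constant states, and the span is at most 2n +
2(|s₊D| + |s₋D|) - 4. Adequacy says that the first change loses a circle; then the extreme term has
no competitor and its coefficient is ±1.

Circles are counted by linear algebra over 𝔽₂. The functions on arcs constant on the circles of s₊,
resp. s₋, form two subspaces of the cycle space, which has dimension n + k for k components. They
meet in the functions constant on components, so |s₊D| + |s₋D| ≤ n + 2k, with equality exactly when
they span all cycles. Planarity enters as the statement that every cycle is a sum of face boundaries
(`planar_iff`). For alternating diagrams a face function splits into a + part and a - part, which
gives equality, and reducedness gives adequacy; so the span is 4n + 4k - 4. In this case the bracket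
is divisible by δ^(k-1) but not by δ^k (`not_pow_comps_dvd`), so no diagram of the link has more
components, and minimality of n follows even for disconnected diagrams.

For a connected nonalternating diagram, strict inequality of circle numbers makes the span less than
4n at once. Otherwise a parity argument (`exists_common_arc`) yields two arcs sharing both their +
and their - circle; all cycles agree on them, so they form a two-edge cut. The diagram is then a
connected sum with multiplicative bracket. Primeness makes one factor a unit, and the other factor
has fewer crossings, so again the span is less than 4n. -/

/-! ### Functions respecting a relation and the number of classes -/

/-- `h` is constant along the relation `r`. -/
def Resp {α β : Type*} (r : α → α → Prop) (h : α → β) : Prop := ∀ x y, r x y → h x = h y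

/-- The number of classes of the equivalence relation generated by `r`. -/
noncomputable def ncomp {α : Type*} (r : α → α → Prop) : ℕ := Nat.card (Quot r)

/-- The relation `r` together with the pair `(x, y)`. -/
def link {α : Type*} (r : α → α → Prop) (x y : α) : α → α → Prop :=
  fun a b => r a b ∨ (a = x ∧ b = y)

/-- The relation `r` does not involve `a`. -/
def Fresh {α : Type*} (r : α → α → Prop) (a : α) : Prop := ∀ x y, r x y → x ≠ a ∧ y ≠ a

section Components

variable {α β : Type*} {r r' : α → α → Prop}

theorem Resp.eqvGen {h : α → β} (hr : Resp r h) {x y : α} (hxy : Relation.EqvGen r x y) :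
    h x = h y := by
  induction hxy with
  | rel _ _ h' => exact hr _ _ h'
  | refl => rfl
  | symm _ _ _ ih => exact ih.symm
  | trans _ _ _ _ _ ih1 ih2 => exact ih1.trans ih2

theorem resp_eqvGen (r : α → α → Prop) (x : α) : Resp r (Relation.EqvGen r x) := by
  intro y z hyz
  exact propext ⟨fun h => h.trans _ _ _ (.rel _ _ hyz),
    fun h => h.trans _ _ _ (.symm _ _ (.rel _ _ hyz))⟩

/-- Equivalence is tested on predicates; the predicate "equivalent to `x`" already suffices. This
turns questions about generated equivalences into propositional logic. -/
theorem eqvGen_iff_resp {x y : α} :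
    Relation.EqvGen r x y ↔ ∀ h : α → Prop, Resp r h → h x = h y := by
  refine ⟨fun h g hg => hg.eqvGen h, fun h => ?_⟩
  have := h _ (resp_eqvGen r x)
  rw [← this]
  exact .refl x

theorem eqvGen_mono_resp (H : ∀ h : α → Prop, Resp r' h → Resp r h) {x y : α}
    (h : Relation.EqvGen r x y) : Relation.EqvGen r' x y :=
  eqvGen_iff_resp.2 fun g hg => (H g hg).eqvGen h

theorem ncomp_of_surjective {γ : Type*} {t : γ → γ → Prop} (q : α → γ)
    (hq : Function.Surjective q) (H1 : ∀ x y, q x = q y → Relation.EqvGen r x y)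
    (H2 : ∀ x y, r x y → Relation.EqvGen t (q x) (q y))
    (H3 : ∀ u v, t u v → ∃ x y, q x = u ∧ q y = v ∧ Relation.EqvGen r x y) :
    ncomp r = ncomp t := by
  refine Nat.card_congr (Equiv.ofBijective
    (Quot.lift (fun x => Quot.mk t (q x)) fun x y h => Quot.eqvGen_sound (H2 x y h)) ⟨?_, ?_⟩)
  · intro a b
    induction a using Quot.ind with | _ x
    induction b using Quot.ind with | _ y
    intro h
    have h' := Quot.eqvGen_exact h
    clear h
    have key : ∀ u v, Relation.EqvGen t u v → ∀ x y, q x = u → q y = v →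
        Relation.EqvGen r x y := by
      intro u v huv
      induction huv with
      | rel u v h =>
        intro x y hx hy
        obtain ⟨x', y', hx', hy', h'⟩ := H3 u v h
        exact (H1 _ _ (hx.trans hx'.symm)).trans _ _ _ (h'.trans _ _ _ (H1 _ _ (hy'.trans hy.symm)))
      | refl u => intro x y hx hy; exact H1 _ _ (hx.trans hy.symm)
      | symm u v _ ih => intro x y hx hy; exact (ih y x hy hx).symm
      | trans u v w _ _ ih1 ih2 =>
        intro x y hx hy
        obtain ⟨z, hz⟩ := hq v
        exact (ih1 x z hx hz).trans _ _ _ (ih2 z y hz hy)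
    exact Quot.eqvGen_sound (key _ _ h' _ _ rfl rfl)
  · intro b
    induction b using Quot.ind with | _ y
    obtain ⟨x, rfl⟩ := hq y
    exact ⟨Quot.mk _ x, rfl⟩

/-- A relation matters only through the predicates that respect it. Smoothings are therefore
compared by comparing the equations they impose on values at arcs. -/
theorem ncomp_congr (H : ∀ h : α → Prop, Resp r h ↔ Resp r' h) : ncomp r = ncomp r' :=
  ncomp_of_surjective id Function.surjective_id (fun x y h => by cases h; exact .refl _)
    (fun x y h => eqvGen_mono_resp (fun h => (H h).2) (.rel _ _ h))
    (fun x y h => ⟨x, y, rfl, rfl, eqvGen_mono_resp (fun h => (H h).1) (.rel _ _ h)⟩)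

theorem ncomp_pos [Finite α] [Nonempty α] (r : α → α → Prop) : 0 < ncomp r :=
  have : Nonempty (Quot r) := .map (Quot.mk r) inferInstance
  Nat.card_pos

theorem resp_link {h : α → β} {x y : α} : Resp (link r x y) h ↔ Resp r h ∧ h x = h y :=
  ⟨fun H => ⟨fun a b hab => H a b (.inl hab), H x y (.inr ⟨rfl, rfl⟩)⟩, fun H a b hab => by
    rcases hab with hab | ⟨rfl, rfl⟩
    · exact H.1 a b hab
    · exact H.2⟩

theorem ncomp_link_of_eqvGen {x y : α} (h : Relation.EqvGen r x y) :
    ncomp (link r x y) = ncomp r :=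
  ncomp_congr fun _ => ⟨fun hg => (resp_link.1 hg).1, fun hg => resp_link.2 ⟨hg, hg.eqvGen h⟩⟩

theorem ncomp_link_of_not_eqvGen [Finite α] {x y : α} (h : ¬ Relation.EqvGen r x y) :
    ncomp (link r x y) + 1 = ncomp r := by
  classical
  have hxy : Quot.mk r x ≠ Quot.mk r y := fun e => h (Quot.eqvGen_exact e)
  -- The merged classes are modelled by deleting the class of `y` and sending its elements to the
  -- class of `x`.
  let F : α → {q : Quot r // q ≠ Quot.mk r y} := fun a =>
    if ha : Quot.mk r a = Quot.mk r y then ⟨Quot.mk r x, hxy⟩ else ⟨Quot.mk r a, ha⟩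
  have hF : Resp (link r x y) F := by
    refine resp_link.2 ⟨fun a b hab => ?_, ?_⟩
    · have : Quot.mk r a = Quot.mk r b := Quot.sound hab
      simp only [F, this]
    · simp only [F, dif_neg hxy, dif_pos]
  have e : Quot (link r x y) ≃ {q : Quot r // q ≠ Quot.mk r y} := by
    refine ⟨Quot.lift F hF, fun q => Quot.map id (fun a b hab => Or.inl hab) q.1, ?_, ?_⟩
    · intro a
      induction a using Quot.ind with | _ a
      by_cases ha : Quot.mk r a = Quot.mk r y
      · simp only [F, dif_pos ha]
        change Quot.mk (link r x y) x = Quot.mk (link r x y) a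
        have h1 : Quot.mk (link r x y) x = Quot.mk (link r x y) y := Quot.sound (.inr ⟨rfl, rfl⟩)
        rw [h1]
        refine (Quot.eqvGen_sound ?_).symm
        exact (Quot.eqvGen_exact ha).mono fun a b hab => Or.inl hab
      · simp only [F, dif_neg ha]
        rfl
    · rintro ⟨q, hq⟩
      induction q using Quot.ind with | _ a
      exact dif_neg hq
  unfold ncomp
  rw [Nat.card_congr e]
  have : Fintype (Quot r) := Fintype.ofFinite _
  rw [Nat.card_eq_fintype_card, Nat.card_eq_fintype_card]
  have := Fintype.card_subtype_compl (fun q : Quot r => q = Quot.mk r y)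
  rw [Fintype.card_subtype_eq] at this
  have h2 : 0 < Fintype.card (Quot r) := Fintype.card_pos_iff.2 ⟨Quot.mk r y⟩
  simp only [ne_eq]
  omega

theorem ncomp_le_link [Finite α] (r : α → α → Prop) (x y : α) :
    ncomp r ≤ ncomp (link r x y) + 1 := by
  by_cases h : Relation.EqvGen r x y
  · rw [ncomp_link_of_eqvGen h]; omega
  · rw [ncomp_link_of_not_eqvGen h]

theorem ncomp_anti [Finite α] (H : ∀ h : α → Prop, Resp r' h → Resp r h) : ncomp r' ≤ ncomp r := by
  refine Nat.card_le_card_of_surjective (Quot.lift (fun x => Quot.mk r' x) fun x y h =>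
    Quot.eqvGen_sound (eqvGen_mono_resp H (.rel _ _ h))) ?_
  intro b
  induction b using Quot.ind with | _ y
  exact ⟨Quot.mk _ y, rfl⟩

theorem Fresh.resp {a : α} (h : Fresh r a) : Resp r (· = a) := fun x y hxy =>
  propext ⟨fun e => absurd e (h x y hxy).1, fun e => absurd e (h x y hxy).2⟩

theorem Fresh.link {a x y : α} (h : Fresh r a) (hx : x ≠ a) (hy : y ≠ a) :
    Fresh (link r x y) a := by
  rintro u v (huv | ⟨rfl, rfl⟩)
  exacts [h u v huv, ⟨hx, hy⟩]

/-- An untouched point is a class by itself, so attaching it elsewhere absorbs exactly one class. In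
the Reidemeister moves the sides of the vanishing face are such points. -/
theorem Fresh.ncomp_link [Finite α] {a x : α} (h : Fresh r a) (hx : x ≠ a) :
    ncomp (_root_.link r a x) + 1 = ncomp r :=
  ncomp_link_of_not_eqvGen fun e => hx (by have := h.resp.eqvGen e; simpa using this)

/-- The functions respecting `r`, as a subspace. -/
def inv (F : Type*) [Field F] (r : α → α → Prop) : Submodule F (α → F) where
  carrier := {h | Resp r h}
  add_mem' := fun ha hb x y h => by simp [ha x y h, hb x y h]
  zero_mem' := fun _ _ _ => rfl
  smul_mem' := fun c f hf x y h => by simp [hf x y h]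

@[simp] theorem mem_inv {F : Type*} [Field F] {h : α → F} : h ∈ inv F r ↔ Resp r h := Iff.rfl

/-- A respecting function is a free choice of one scalar per class, so circle counts become
dimensions. -/
theorem finrank_inv (F : Type*) [Field F] [Finite α] (r : α → α → Prop) :
    Module.finrank F (inv F r) = ncomp r := by
  have : Fintype (Quot r) := Fintype.ofFinite _
  have e : inv F r ≃ₗ[F] (Quot r → F) :=
    { toFun := fun h => Quot.lift h.1 h.2
      invFun := fun g => ⟨fun x => g (Quot.mk r x), fun x y h => congrArg g (Quot.sound h)⟩
      map_add' := fun f g => by ext q; induction q using Quot.ind; rfl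
      map_smul' := fun c f => by ext q; induction q using Quot.ind; rfl
      left_inv := fun f => rfl
      right_inv := fun g => by ext q; induction q using Quot.ind; rfl }
  rw [e.finrank_eq, Module.finrank_fintype_fun_eq_card, ncomp, Nat.card_eq_fintype_card]

end Components

namespace LinkDiagram

/-! ### Smoothings -/

/-- The first of the two ends that are joined when smoothing with a given marker. -/
def marker (ε : ℤˣ) : ZMod 4 := if ε = 1 then 0 else 1

/-- The marker that joins the ends `i` and `i + 1`. -/
def joiningMarker (i : ZMod 4) : ℤˣ := if i = 0 ∨ i = 2 then 1 else -1

/-- `h` takes the same value on the ends `i`, `i + 1` and on the ends `i + 2`, `i + 3` at `c`. -/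
def Joins (D : LinkDiagram) {β : Type*} (c : D.X) (i : ZMod 4) (h : D.E → β) : Prop :=
  h (D.arc (c, i)) = h (D.arc (c, i + 1)) ∧ h (D.arc (c, i + 2)) = h (D.arc (c, i + 3))

/-- The relation between arcs given by smoothing the crossings in `R` only. -/
def SmoothStep (D : LinkDiagram) (R : Set D.X) (s : D.X → ℤˣ) (x y : D.E) : Prop :=
  ∃ c ∈ R, ∃ i, (i = marker (s c) ∨ i = marker (s c) + 2) ∧ x = D.arc (c, i) ∧
    y = D.arc (c, i + 1)

theorem joiningMarker_add_one (i : ZMod 4) : joiningMarker (i + 1) = -joiningMarker i := by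
  revert i; decide

theorem marker_joiningMarker (i : ZMod 4) :
    i = marker (joiningMarker i) ∨ i = marker (joiningMarker i) + 2 := by
  revert i; decide

theorem isOver_iff (i : ZMod 4) : IsOver i ↔ joiningMarker i = -1 := by
  unfold IsOver; revert i; decide

theorem zmod4_cases (i j : ZMod 4) : j = i ∨ j = i + 1 ∨ j = i + 2 ∨ j = i + 3 := by
  revert i j; decide

theorem zmod4_arith (i : ZMod 4) : i + 1 ≠ i ∧ i + 2 ≠ i ∧ i + 3 ≠ i ∧ i + 2 ≠ i + 1 ∧
    i + 3 ≠ i + 1 ∧ i + 3 ≠ i + 2 ∧ i + 1 + 1 = i + 2 ∧ i + 1 + 2 = i + 3 ∧ i + 1 + 3 = i ∧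
    i + 2 + 1 = i + 3 ∧ i + 2 + 2 = i ∧ i + 2 + 3 = i + 1 ∧ i + 3 + 1 = i ∧ i + 3 + 2 = i + 1 ∧
    i + 3 + 3 = i + 2 := by
  revert i; decide

section

variable (D : LinkDiagram) {β : Type*}

theorem joins_add_two {c : D.X} {i : ZMod 4} {h : D.E → β} :
    D.Joins c (i + 2) h ↔ D.Joins c i h := by
  obtain ⟨-, -, -, -, -, -, -, -, -, h1, h2, h3, -, -, -⟩ := zmod4_arith i
  unfold Joins
  rw [h1, h2, h3]
  exact And.comm

theorem joins_marker_joiningMarker {c : D.X} (i : ZMod 4) {h : D.E → β} :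
    D.Joins c (marker (joiningMarker i)) h ↔ D.Joins c i h := by
  rcases marker_joiningMarker i with hi | hi
  · rw [← hi]
  · conv_rhs => rw [hi]
    rw [joins_add_two]

theorem joins_marker_neg_joiningMarker {c : D.X} (i : ZMod 4) {h : D.E → β} :
    D.Joins c (marker (-joiningMarker i)) h ↔ D.Joins c (i + 1) h := by
  rw [← joiningMarker_add_one, joins_marker_joiningMarker]

theorem resp_smoothStep {R : Set D.X} {s : D.X → ℤˣ} {h : D.E → β} :
    Resp (D.SmoothStep R s) h ↔ ∀ c ∈ R, D.Joins c (marker (s c)) h := by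
  constructor
  · intro H c hc
    refine ⟨H _ _ ⟨c, hc, _, .inl rfl, rfl, rfl⟩, H _ _ ⟨c, hc, _, .inr rfl, rfl, ?_⟩⟩
    rw [(zmod4_arith _).2.2.2.2.2.2.2.2.2.1]
  · rintro H x y ⟨c, hc, i, hi | hi, rfl, rfl⟩
    · rw [hi]; exact (H c hc).1
    · rw [hi, (zmod4_arith _).2.2.2.2.2.2.2.2.2.1]; exact (H c hc).2

theorem stateStep_eq (s : D.X → ℤˣ) : D.StateStep s = D.SmoothStep Set.univ s := by
  ext x y
  refine exists_congr fun c => ?_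
  simp only [Set.mem_univ, true_and]
  refine exists_congr fun i => ?_
  refine and_congr_left fun _ => ?_
  rcases Int.units_eq_one_or (s c) with h | h
  · simp [h, marker]
  · have key : ∀ i : ZMod 4, ((-1 : ℤˣ) = 1 ∧ (i = 0 ∨ i = 2) ∨ (-1 : ℤˣ) = -1 ∧ (i = 1 ∨ i = 3)) ↔
        (i = marker (-1) ∨ i = marker (-1) + 2) := by decide
    rw [h, key]

theorem resp_stateStep {s : D.X → ℤˣ} {h : D.E → β} :
    Resp (D.StateStep s) h ↔ ∀ c, D.Joins c (marker (s c)) h := by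
  rw [stateStep_eq, resp_smoothStep]; simp

theorem resp_stateStep_split (R : Set D.X) {s : D.X → ℤˣ} {h : D.E → β} :
    Resp (D.StateStep s) h ↔ Resp (D.SmoothStep Rᶜ s) h ∧ ∀ c ∈ R, D.Joins c (marker (s c)) h := by
  rw [resp_stateStep, resp_smoothStep]
  exact ⟨fun H => ⟨fun c _ => H c, fun c _ => H c⟩, fun H c => by
    by_cases hc : c ∈ R
    exacts [H.2 c hc, H.1 c hc]⟩

theorem stateCircles_eq (s : D.X → ℤˣ) : D.stateCircles s = ncomp (D.StateStep s) := rfl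

theorem stateCircles_pos (s : D.X → ℤˣ) : 0 < D.stateCircles s :=
  have := D.nonempty
  ncomp_pos _

variable {D}

theorem arc_ne {d d' e : D.X × ZMod 4} (h : D.arc d = D.arc d') (hd : d ≠ d') (h1 : e ≠ d)
    (h2 : e ≠ d') : D.arc e ≠ D.arc d := fun he =>
  h2 ((D.mate d).unique ⟨h1, he⟩ ⟨hd.symm, h.symm⟩)

theorem smoothStep_congr {R : Set D.X} {s s' : D.X → ℤˣ} (h : ∀ c ∈ R, s c = s' c) :
    D.SmoothStep R s = D.SmoothStep R s' := by
  ext x y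
  refine exists_congr fun c => ?_
  constructor
  · rintro ⟨hc, H⟩; exact ⟨hc, by rwa [← h c hc]⟩
  · rintro ⟨hc, H⟩; exact ⟨hc, by rwa [h c hc]⟩

theorem smoothStep_fresh {R : Set D.X} {s : D.X → ℤˣ} {d d' : D.X × ZMod 4}
    (h : D.arc d = D.arc d') (hd : d ≠ d') (h1 : d.1 ∉ R) (h2 : d'.1 ∉ R) :
    Fresh (D.SmoothStep R s) (D.arc d) := by
  rintro x y ⟨c, hc, i, -, rfl, rfl⟩
  have key : ∀ j, D.arc (c, j) ≠ D.arc d := fun j =>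
    arc_ne h hd (fun e => h1 (e ▸ hc)) (fun e => h2 (e ▸ hc))
  exact ⟨key _, key _⟩

theorem erase_iff {c : D.X} (i : ZMod 4) {h : D.E → β} :
    (∀ j, h (D.arc (c, j)) = h (D.arc (c, j + 2))) ↔
      h (D.arc (c, i)) = h (D.arc (c, i + 2)) ∧ h (D.arc (c, i + 1)) = h (D.arc (c, i + 3)) := by
  obtain ⟨-, -, -, -, -, -, h0, h1, h2, h3, h4, h5, h6, h7, h8⟩ := zmod4_arith i
  constructor
  · intro H
    refine ⟨H i, ?_⟩
    have := H (i + 1)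
    rwa [h1] at this
  · rintro ⟨H1, H2⟩ j
    rcases zmod4_cases i j with rfl | rfl | rfl | rfl
    · exact H1
    · rw [h1]; exact H2
    · rw [h4]; exact H1.symm
    · rw [h7]; exact H2.symm

/-- The hypothesis `hr` says that `r` smooths the crossings outside `R` and lets the strands run
through those in `R`; passing to the quotient by `q` performs the second operation first. -/
theorem stateCircles_erasure {D' : LinkDiagram} {R : Set D.X} (f : D'.X ≃ {c : D.X // c ∉ R})
    {q : D.E → D'.E} (hq : Function.Surjective q)
    (hq' : ∀ x y, q x = q y ↔ Relation.EqvGen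
        (fun x y => ∃ c ∈ R, ∃ i, x = D.arc (c, i) ∧ y = D.arc (c, i + 2)) x y)
    (hf : ∀ c i, D'.arc (c, i) = q (D.arc ((f c).1, i)))
    {s : D.X → ℤˣ} {t : D'.X → ℤˣ} (hst : ∀ y, s (f y).1 = t y) {r : D.E → D.E → Prop}
    (hr : ∀ h : D.E → Prop, Resp r h ↔ Resp (D.SmoothStep Rᶜ s) h ∧
      ∀ c ∈ R, ∀ i, h (D.arc (c, i)) = h (D.arc (c, i + 2))) :
    D'.stateCircles t = ncomp r := by
  symm
  refine ncomp_of_surjective q hq ?_ ?_ ?_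
  · intro x y hxy
    refine eqvGen_mono_resp ?_ ((hq' x y).1 hxy)
    rintro h hh x y ⟨c, hc, i, rfl, rfl⟩
    exact ((hr h).1 hh).2 c hc i
  · intro x y hxy
    refine eqvGen_iff_resp.2 fun h hh => ?_
    refine (hr (h ∘ q)).2 ⟨?_, ?_⟩ x y hxy
    · rw [resp_stateStep] at hh
      rw [resp_smoothStep]
      intro c hc
      obtain ⟨c, rfl⟩ : ∃ y, (f y).1 = c := ⟨f.symm ⟨c, hc⟩, by simp⟩
      have := hh c
      unfold Joins at this ⊢
      simpa only [hf, hst, Function.comp_apply] using this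
    · intro c hc i
      exact congrArg h ((hq' _ _).2 (.rel _ _ ⟨c, hc, i, rfl, rfl⟩))
  · intro u v huv
    rw [stateStep_eq] at huv
    obtain ⟨c, -, i, hi, rfl, rfl⟩ := huv
    refine ⟨_, _, (hf _ _).symm, (hf _ _).symm, eqvGen_iff_resp.2 fun h hh => ?_⟩
    refine ((hr h).1 hh).1 _ _ ⟨f c, (f c).2, i, ?_, rfl, rfl⟩
    rwa [hst]

end

/-! ### Sums over states -/

/-- A state is a choice of markers at the distinguished crossings together with one at the rest, so
a local move can be checked with the outer markers fixed. -/
theorem exists_sum_glue {ι X Y M : Type*} [Fintype ι] [DecidableEq ι] [Fintype X] [DecidableEq X]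
    [Fintype Y] [DecidableEq Y] [AddCommMonoid M] (c : ι → X) (hc : Function.Injective c)
    (f : Y ≃ {x : X // x ∉ Set.range c}) :
    ∃ glue : (ι → ℤˣ) → (Y → ℤˣ) → X → ℤˣ,
      (∀ u t i, glue u t (c i) = u i) ∧ (∀ u t y, glue u t (f y).1 = t y) ∧
      (∀ u t, ∑ x, (glue u t x : ℤ) = ∑ i, (u i : ℤ) + ∑ y, (t y : ℤ)) ∧
      ∀ F : (X → ℤˣ) → M, ∑ s, F s = ∑ t, ∑ u, F (glue u t) := by
  classical
  let e : ι ⊕ Y ≃ X :=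
    ((Equiv.ofInjective c hc).sumCongr f).trans (Equiv.sumCompl (fun x => x ∈ Set.range c))
  have h1 : ∀ i, e (.inl i) = c i := fun i => rfl
  have h2 : ∀ y, e (.inr y) = (f y).1 := fun y => rfl
  refine ⟨fun u t => Sum.elim u t ∘ e.symm, fun u t i => ?_, fun u t y => ?_, fun u t => ?_,
    fun F => ?_⟩
  · simp [← h1]
  · simp [← h2]
  · rw [← Equiv.sum_comp e, Fintype.sum_sum_type]
    simp
  · rw [← Fintype.sum_prod_type']
    symm
    refine Fintype.sum_equiv ((Equiv.prodComm _ _).trans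
      ((Equiv.sumArrowEquivProdArrow ι Y ℤˣ).symm.trans (e.arrowCongr (Equiv.refl _)))) _ _ ?_
    rintro ⟨t, u⟩
    rfl

/-- The base marker `ε` is free, so that expansions can start from the smoothing that cuts off a
given corner, whatever its sign. -/
theorem sum_units {M : Type*} [AddCommMonoid M] (ε : ℤˣ) (F : ℤˣ → M) :
    ∑ a, F a = F ε + F (-ε) := by
  rw [UnitsInt.univ]
  rcases Int.units_eq_one_or ε with rfl | rfl
  · simp
  · simp [add_comm]

theorem sum_fin_cons {n : ℕ} {M : Type*} [AddCommMonoid M] (ε : ℤˣ)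
    (F : (Fin (n + 1) → ℤˣ) → M) :
    ∑ u, F u = ∑ v : Fin n → ℤˣ, F (Matrix.vecCons ε v) +
      ∑ v : Fin n → ℤˣ, F (Matrix.vecCons (-ε) v) := by
  rw [← sum_units ε fun a => ∑ v : Fin n → ℤˣ, F (Matrix.vecCons a v), ← Fintype.sum_prod_type']
  symm
  exact Fintype.sum_equiv (Fin.consEquiv fun _ => ℤˣ) _ _ fun _ => rfl

theorem sum_fin_one {M : Type*} [AddCommMonoid M] (ε : ℤˣ) (F : (Fin 1 → ℤˣ) → M) :
    ∑ u, F u = F ![ε] + F ![-ε] := by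
  rw [sum_fin_cons ε, Fintype.sum_unique, Fintype.sum_unique]
  rfl

theorem sum_fin_two {M : Type*} [AddCommMonoid M] (ε₀ ε₁ : ℤˣ) (F : (Fin 2 → ℤˣ) → M) :
    ∑ u, F u = F ![ε₀, ε₁] + F ![ε₀, -ε₁] + (F ![-ε₀, ε₁] + F ![-ε₀, -ε₁]) := by
  rw [sum_fin_cons ε₀, sum_fin_one ε₁, sum_fin_one ε₁]

theorem sum_fin_three {M : Type*} [AddCommMonoid M] (ε₀ ε₁ ε₂ : ℤˣ) (F : (Fin 3 → ℤˣ) → M) :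
    ∑ u, F u = F ![ε₀, ε₁, ε₂] + F ![ε₀, ε₁, -ε₂] + (F ![ε₀, -ε₁, ε₂] + F ![ε₀, -ε₁, -ε₂]) +
      (F ![-ε₀, ε₁, ε₂] + F ![-ε₀, ε₁, -ε₂] + (F ![-ε₀, -ε₁, ε₂] + F ![-ε₀, -ε₁, -ε₂])) := by
  rw [sum_fin_cons ε₀, sum_fin_two ε₁ ε₂, sum_fin_two ε₁ ε₂]

/-! ### The contribution of a state -/

open LaurentPolynomial in
/-- The contribution to the Kauffman bracket of a state with marker sum `k` and `N` circles. -/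
noncomputable def weight (k : ℤ) (N : ℕ) : LaurentPolynomial ℤ := T k * (-T 2 - T (-2)) ^ (N - 1)

theorem bracket_eq (D : LinkDiagram) :
    D.bracket = ∑ s : D.X → ℤˣ, weight (∑ c, (s c : ℤ)) (D.stateCircles s) := rfl

-- One extra circle contributes δ = -(A² + A⁻²), exactly cancelling the two terms whose marker sums
-- are shifted by ±2.
open LaurentPolynomial in
theorem weight_cancel {k l m : ℤ} {N : ℕ} (hN : 0 < N) (hl : l = k + 2) (hm : m = k - 2) :
    weight k (N + 1) + weight l N + weight m N = 0 := by
  obtain ⟨N, rfl⟩ := Nat.exists_eq_add_of_lt hN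
  simp only [weight, zero_add, Nat.add_sub_cancel, pow_succ, hl, hm, T_add, sub_eq_add_neg]
  ring

-- This is A^ε δ + A^(-ε) = -A^(3ε).
open LaurentPolynomial in
theorem weight_kink {k l : ℤ} {N : ℕ} (hN : 0 < N) (ε : ℤˣ) (hk : k = ε + l) :
    weight k (N + 1) + weight (-ε + l) N = -T (3 * ε) * weight l N := by
  obtain ⟨N, rfl⟩ := Nat.exists_eq_add_of_lt hN
  subst hk
  simp only [weight, zero_add, Nat.add_sub_cancel, pow_succ, T_add]
  rcases Int.units_eq_one_or ε with rfl | rfl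
  · have h1 : (T (-2) : LaurentPolynomial ℤ) = T (-1) * T (-1) := by rw [← T_add]; rfl
    have h2 : (T 1 * T (-1) : LaurentPolynomial ℤ) = 1 := by rw [← T_add]; exact T_zero
    have h3 : (T (3 * ((1 : ℤˣ) : ℤ)) : LaurentPolynomial ℤ) = T 1 * T 2 := by rw [← T_add]; rfl
    rw [h1, h3]
    simp only [Units.val_one]
    linear_combination (-T (-1) * T l * (-T 2 - T (-1) * T (-1)) ^ N) * h2
  · have h1 : (T 2 : LaurentPolynomial ℤ) = T 1 * T 1 := by rw [← T_add]; rfl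
    have h2 : (T 1 * T (-1) : LaurentPolynomial ℤ) = 1 := by rw [← T_add]; exact T_zero
    have h3 : (T (3 * ((-1 : ℤˣ) : ℤ)) : LaurentPolynomial ℤ) = T (-1) * T (-2) := by
      rw [← T_add]; rfl
    rw [h1, h3]
    simp only [Units.val_neg, Units.val_one, neg_neg]
    linear_combination (-T 1 * T l * (-(T 1 * T 1) - T (-2)) ^ N) * h2

theorem weight_bigon (ε : ℤˣ) (k : ℤ) {N : ℕ} (N' : ℕ) (hN : 0 < N) :
    weight (ε + ε + k) N + weight (ε + -ε + k) (N + 1) +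
      (weight (-ε + ε + k) N' + weight (-ε + -ε + k) N) = weight k N' := by
  have e1 : (ε : ℤ) + -ε + k = k := by ring
  have e2 : -(ε : ℤ) + ε + k = k := by ring
  rw [e1, e2]
  rcases Int.units_eq_one_or ε with rfl | rfl
  · have := weight_cancel (k := k) (l := 1 + 1 + k) (m := -1 + -1 + k) hN (by ring) (by ring)
    simp only [Units.val_one]
    linear_combination this
  · have := weight_cancel (k := k) (l := 1 + 1 + k) (m := -1 + -1 + k) hN (by ring) (by ring)
    simp only [Units.val_one, Units.val_neg, neg_neg]
    linear_combination this

end LinkDiagram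

namespace LinkDiagram

/-! ### Invariance of the Kauffman bracket -/

theorem bracket_of_iso {D D' : LinkDiagram} (H : D.Iso D') : D'.bracket = D.bracket := by
  obtain ⟨f, g, r, hr, hg⟩ := H
  rw [bracket_eq, bracket_eq]
  symm
  refine Fintype.sum_equiv (f.arrowCongr (Equiv.refl _)) _ _ fun s => ?_
  congr 1
  · exact Fintype.sum_equiv f _ _ fun c => by simp
  · rw [stateCircles_eq, stateCircles_eq]
    have key : ∀ h : D'.E → Prop, Resp (D.StateStep s) (h ∘ g) ↔
        Resp (D'.StateStep (f.arrowCongr (Equiv.refl _) s)) h := by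
      intro h
      rw [resp_stateStep, resp_stateStep, ← f.forall_congr_right]
      refine forall_congr' fun c => ?_
      have h1 : (f.arrowCongr (Equiv.refl _) s) (f c) = s c := by simp
      rw [h1]
      have h2 : D'.Joins (f c) (marker (s c)) h ↔ D'.Joins (f c) (marker (s c) + r c) h := by
        rcases hr c with h | h
        · rw [h, add_zero]
        · rw [h, joins_add_two]
      rw [h2]
      unfold Joins
      simp only [Function.comp_apply, ← hg, add_right_comm _ (r c)]
    refine ncomp_of_surjective g g.surjective (fun x y h => g.injective h ▸ .refl _) ?_ ?_
    · exact fun x y hxy => eqvGen_iff_resp.2 fun h hh => (key h).2 hh x y hxy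
    · refine fun u v huv => ⟨g.symm u, g.symm v, by simp, by simp, eqvGen_iff_resp.2 fun h hh => ?_⟩
      have := (key (h ∘ g.symm)).1 (by convert hh; ext x; simp)
      exact this u v huv

-- One marker splits the kink off as a separate circle, the other one absorbs it into the strand;
-- both terms are expressed through the diagram without the kink.
open LaurentPolynomial in
theorem bracket_of_reidemeisterOne {D D' : LinkDiagram} (H : D.ReidemeisterOne D') :
    ∃ ε : ℤˣ, D.bracket = -T (3 * ε) * D'.bracket := by
  obtain ⟨c, i, hc, f, q, hq, hq', hf⟩ := H
  refine ⟨joiningMarker i, ?_⟩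
  obtain ⟨a1, a2, a3, a4, a5, a6, b0, b1, b2, b3, b4, b5, b6, b7, b8⟩ := zmod4_arith i
  have hd : ((c, i) : D.X × ZMod 4) ≠ (c, i + 1) := fun e => a1 (Prod.ext_iff.1 e).2.symm
  have hp : D.arc (c, i + 2) ≠ D.arc (c, i) := arc_ne hc hd
    (fun e => a2 (Prod.ext_iff.1 e).2) fun e => a4 (Prod.ext_iff.1 e).2
  have hq1 : D.arc (c, i + 3) ≠ D.arc (c, i) := arc_ne hc hd
    (fun e => a3 (Prod.ext_iff.1 e).2) fun e => a5 (Prod.ext_iff.1 e).2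
  have hR : Set.range (fun _ : Fin 1 => c) = {c} := by simp
  have f' : {g : D'.X ≃ {x // x ∉ Set.range fun _ : Fin 1 => c} // ∀ y, (g y).1 = (f y).1} :=
    ⟨f.trans (Equiv.subtypeEquivRight fun x => by rw [hR]), fun y => rfl⟩
  obtain ⟨glue, g1, g2, g3, g4⟩ := exists_sum_glue (M := LaurentPolynomial ℤ)
    (fun _ : Fin 1 => c) (fun _ _ _ => Subsingleton.elim _ _) f'.1
  simp only [f'.2] at g2
  rw [bracket_eq, bracket_eq, g4, Finset.mul_sum]
  refine Finset.sum_congr rfl fun t _ => ?_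
  rw [sum_fin_one (joiningMarker i), g3, g3]
  set s := glue ![joiningMarker i] t with hs
  set s' := glue ![-joiningMarker i] t with hs'
  have hsc : s c = joiningMarker i := g1 _ t 0
  have hsc' : s' c = -joiningMarker i := g1 _ t 0
  have hss : D.SmoothStep {c}ᶜ s' = D.SmoothStep {c}ᶜ s := smoothStep_congr fun x hx => by
    obtain ⟨y, hy⟩ := f.surjective ⟨x, hx⟩
    have : (f y).1 = x := by rw [hy]
    rw [← this, hs, hs', g2, g2]
  set O := D.SmoothStep {c}ᶜ s
  -- Both ends of the kink are at `c`, so smoothing the other crossings does not touch it.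
  have hO : Fresh O (D.arc (c, i)) := smoothStep_fresh hc hd (by simp) (by simp)
  set r := link O (D.arc (c, i + 2)) (D.arc (c, i + 3))
  have hr : Fresh r (D.arc (c, i)) := hO.link hp hq1
  have n0 := hr.ncomp_link hp
  have n1 : D.stateCircles s = ncomp r := ncomp_congr fun h => by
    rw [resp_stateStep_split D {c}, resp_link]
    simp only [Set.mem_singleton_iff, forall_eq, hsc, joins_marker_joiningMarker]
    simp only [Joins, ← hc, true_and]
    rfl
  have n2 : D.stateCircles s' = ncomp (link r (D.arc (c, i)) (D.arc (c, i + 2))) :=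
    ncomp_congr fun h => by
    rw [resp_stateStep_split D {c}, resp_link, resp_link]
    simp only [Set.mem_singleton_iff, forall_eq, hsc', joins_marker_neg_joiningMarker, hss]
    simp only [Joins, ← hc, b0, b1, b2]
    clear * -
    grind
  have n3 : D'.stateCircles t = ncomp (link r (D.arc (c, i)) (D.arc (c, i + 2))) := by
    refine stateCircles_erasure (s := s) f hq hq' hf (fun y => g2 _ _ _) fun h => ?_
    simp only [Set.mem_singleton_iff, forall_eq, resp_link, erase_iff i, r, O, ← hc]
    clear * -
    grind
  rw [n1, n2, n3, ← n0]
  have := weight_kink (k := joiningMarker i + ∑ y, (t y : ℤ)) (l := ∑ y, (t y : ℤ))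
    (N := ncomp (link r (D.arc (c, i)) (D.arc (c, i + 2)))) (by rw [← n3]; exact stateCircles_pos _ _)
    (joiningMarker i) rfl
  simpa using this

/-- Of the four smoothings of the bigon three cancel, one of them carrying an extra circle; the
fourth is the diagram with the strands pulled apart. -/
theorem bracket_of_reidemeisterTwo {D D' : LinkDiagram} (H : D.ReidemeisterTwo D') :
    D.bracket = D'.bracket := by
  obtain ⟨c, c', i, j, hcc, ha, hb, hij, f, q, hq, hq', hf⟩ := H
  have hij' : joiningMarker j = -joiningMarker i := by
    rw [isOver_iff, isOver_iff, joiningMarker_add_one] at hij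
    rcases Int.units_eq_one_or (joiningMarker i) with h | h <;>
      rcases Int.units_eq_one_or (joiningMarker j) with h' | h' <;> simp [h, h'] at hij ⊢
  obtain ⟨a1, a2, a3, a4, a5, a6, b0, b1, b2, b3, b4, b5, b6, b7, b8⟩ := zmod4_arith i
  obtain ⟨a1', a2', a3', a4', a5', a6', b0', b1', b2', b3', b4', b5', b6', b7', b8'⟩ :=
    zmod4_arith j
  have hda : ((c, i) : D.X × ZMod 4) ≠ (c', j + 1) := fun e => hcc (Prod.ext_iff.1 e).1
  have hdb : ((c, i + 1) : D.X × ZMod 4) ≠ (c', j) := fun e => hcc (Prod.ext_iff.1 e).1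
  have hR : Set.range ![c, c'] = {c, c'} := by simp [Set.pair_comm]
  have hinj : Function.Injective ![c, c'] := by
    intro x y; fin_cases x <;> fin_cases y <;> simp [hcc, hcc.symm]
  have f' : {g : D'.X ≃ {x // x ∉ Set.range ![c, c']} // ∀ y, (g y).1 = (f y).1} :=
    ⟨f.trans (Equiv.subtypeEquivRight fun x => by rw [hR]), fun y => rfl⟩
  obtain ⟨glue, g1, g2, g3, g4⟩ := exists_sum_glue (M := LaurentPolynomial ℤ)
    ![c, c'] hinj f'.1
  simp only [f'.2] at g2
  rw [bracket_eq, bracket_eq, g4]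
  refine Finset.sum_congr rfl fun t _ => ?_
  rw [sum_fin_two (joiningMarker i) (joiningMarker i)]
  simp only [g3, Fin.sum_univ_two, Matrix.cons_val_zero, Matrix.cons_val_one]
  set ε := joiningMarker i with hε
  set u := fun a b : ℤˣ => glue ![a, b] t with hu
  have uc : ∀ a b, u a b c = a := fun a b => g1 _ t 0
  have uc' : ∀ a b, u a b c' = b := fun a b => g1 _ t 1
  set O := D.SmoothStep {c, c'}ᶜ (u 1 1) with hO0
  have hO : ∀ a b, D.SmoothStep {c, c'}ᶜ (u a b) = O := fun a b => smoothStep_congr fun x hx => by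
    obtain ⟨y, hy⟩ := f.surjective ⟨x, hx⟩
    have : (f y).1 = x := by rw [hy]
    rw [← this]
    exact (g2 _ _ _).trans (g2 _ _ _).symm
  have fa : Fresh O (D.arc (c, i)) := smoothStep_fresh ha hda (by simp) (by simp)
  have fb : Fresh O (D.arc (c, i + 1)) := smoothStep_fresh hb hdb (by simp) (by simp)
  have pa : D.arc (c, i + 2) ≠ D.arc (c, i) := arc_ne ha hda (by simp [a2]) (by simp [hcc])
  have qa : D.arc (c, i + 3) ≠ D.arc (c, i) := arc_ne ha hda (by simp [a3]) (by simp [hcc])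
  have pb : D.arc (c, i + 2) ≠ D.arc (c, i + 1) := arc_ne hb hdb (by simp [a4]) (by simp [hcc])
  have qb : D.arc (c, i + 3) ≠ D.arc (c, i + 1) := arc_ne hb hdb (by simp [a5]) (by simp [hcc])
  have ba : D.arc (c, i + 1) ≠ D.arc (c, i) := arc_ne ha hda (by simp [show (1 : ZMod 4) ≠ 0 by decide]) (by simp [hcc])
  have pa' : D.arc (c', j + 2) ≠ D.arc (c, i) :=
    arc_ne ha hda (by simp [hcc.symm]) (by simp [a4'])
  have qa' : D.arc (c', j + 3) ≠ D.arc (c, i) :=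
    arc_ne ha hda (by simp [hcc.symm]) (by simp [a5'])
  have pb' : D.arc (c', j + 2) ≠ D.arc (c, i + 1) :=
    arc_ne hb hdb (by simp [hcc.symm]) (by simp [a2'])
  have qb' : D.arc (c', j + 3) ≠ D.arc (c, i + 1) :=
    arc_ne hb hdb (by simp [hcc.symm]) (by simp [a3'])
  set a := D.arc (c, i)
  set b := D.arc (c, i + 1)
  set p := D.arc (c, i + 2) with hp
  set p' := D.arc (c', j + 2) with hp'
  set w := D.arc (c, i + 3) with hw
  set w' := D.arc (c', j + 3) with hw'
  have resp_split : ∀ (h : D.E → Prop) (x y : ℤˣ), Resp (D.StateStep (u x y)) h ↔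
      Resp O h ∧ D.Joins c (marker x) h ∧ D.Joins c' (marker y) h := by
    intro h x y
    rw [resp_stateStep_split D {c, c'}, hO]
    simp [uc, uc']
  -- Only two connections of the outer ends occur: turning back at each crossing (`r1`), or running
  -- through as after the move (`r2`). The sides `a` and `b` are then attached as fresh points.
  set r1 := link (link O p w) p' w'
  set r2 := link (link O p w') w p'
  have fa1 : Fresh r1 a := (fa.link pa qa).link pa' qa'
  have fb1 : Fresh r1 b := (fb.link pb qb).link pb' qb'
  have fa2 : Fresh r2 a := (fa.link pa qa').link qa pa'
  have fb2 : Fresh r2 b := (fb.link pb qb').link qb pb'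
  have n1 : D.stateCircles (u ε (-ε)) + 1 = ncomp r1 := by
    rw [← fa1.ncomp_link ba, add_left_inj]
    refine ncomp_congr fun h => ?_
    rw [resp_split, hε, joins_marker_joiningMarker, ← hij', joins_marker_joiningMarker]
    simp only [Joins, resp_link, r1, ← ha, ← hb, ← hp, ← hw, ← hp', ← hw']
    clear * -
    grind
  have n2 : D.stateCircles (u ε ε) + 2 = ncomp r1 := by
    rw [← fa1.ncomp_link pa', ← (fb1.link ba.symm pb').ncomp_link pb']
    refine congrArg (· + 2) (ncomp_congr fun h => ?_)
    have : ε = -joiningMarker j := by rw [hij', neg_neg]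
    rw [resp_split]
    conv_lhs => rw [hε, joins_marker_joiningMarker, ← hε, this, joins_marker_neg_joiningMarker]
    simp only [Joins, resp_link, r1, ← ha, ← hb, ← hp, ← hw, ← hp', ← hw', b0', b1', b2']
    clear * -
    grind
  have n3 : D.stateCircles (u (-ε) (-ε)) + 2 = ncomp r1 := by
    rw [← fa1.ncomp_link pa, ← (fb1.link ba.symm pb).ncomp_link pb]
    refine congrArg (· + 2) (ncomp_congr fun h => ?_)
    rw [resp_split]
    conv_lhs => rw [hε, joins_marker_neg_joiningMarker, ← hij', joins_marker_joiningMarker]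
    simp only [Joins, resp_link, r1, ← ha, ← hb, ← hp, ← hw, ← hp', ← hw', b0, b1, b2]
    clear * -
    grind
  have n4 : D.stateCircles (u (-ε) ε) + 2 = ncomp r2 := by
    rw [← fa2.ncomp_link qa, ← (fb2.link ba.symm qb).ncomp_link pb]
    refine congrArg (· + 2) (ncomp_congr fun h => ?_)
    have : ε = -joiningMarker j := by rw [hij', neg_neg]
    rw [resp_split]
    conv_lhs => rw [hε, joins_marker_neg_joiningMarker, ← hε, this,
      joins_marker_neg_joiningMarker]
    simp only [Joins, resp_link, r2, ← ha, ← hb, ← hp, ← hw, ← hp', ← hw', b0, b1, b2, b0', b1',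
      b2']
    clear * -
    grind
  have n5 : D'.stateCircles t + 2 = ncomp r2 := by
    rw [← fa2.ncomp_link pa, ← (fb2.link ba.symm pb).ncomp_link qb]
    refine congrArg (· + 2) ?_
    refine stateCircles_erasure (s := u 1 1) f hq hq' hf (fun y => g2 _ _ _) fun h => ?_
    simp only [Set.mem_insert_iff, Set.mem_singleton_iff, forall_eq_or_imp, forall_eq, resp_link,
      erase_iff (c := c) i, erase_iff (c := c') j, r2, ← ha, ← hb, ← hp, ← hw, ← hp', ← hw', ← hO0]
    clear * -
    grind
  have e1 : D.stateCircles (u ε (-ε)) = D.stateCircles (u ε ε) + 1 := by omega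
  have e2 : D.stateCircles (u (-ε) (-ε)) = D.stateCircles (u ε ε) := by omega
  have e3 : D.stateCircles (u (-ε) ε) = D'.stateCircles t := by omega
  change weight _ (D.stateCircles (u ε ε)) + weight _ (D.stateCircles (u ε (-ε))) +
    (weight _ (D.stateCircles (u (-ε) ε)) + weight _ (D.stateCircles (u (-ε) (-ε)))) = _
  rw [e1, e2, e3]
  simp only [Units.val_neg]
  exact weight_bigon ε _ _ (stateCircles_pos _ _)

end LinkDiagram

/-! ### The third Reidemeister move. -/

theorem ncomp_attach_three {α : Type*} [Finite α] {r A : α → α → Prop} {s₀ s₁ s₂ a₀ a₁ a₂ : α}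
    (hr : Fresh r s₀ ∧ Fresh r s₁ ∧ Fresh r s₂) (hs : s₀ ≠ s₁ ∧ s₁ ≠ s₂ ∧ s₂ ≠ s₀)
    (h₀ : a₀ ≠ s₀ ∧ a₀ ≠ s₁ ∧ a₀ ≠ s₂) (h₁ : a₁ ≠ s₀ ∧ a₁ ≠ s₁ ∧ a₁ ≠ s₂)
    (h₂ : a₂ ≠ s₀ ∧ a₂ ≠ s₁ ∧ a₂ ≠ s₂)
    (H : ∀ h : α → Prop, Resp A h ↔ Resp r h ∧ h s₀ = h a₀ ∧ h s₁ = h a₁ ∧ h s₂ = h a₂) :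
    ncomp A + 3 = ncomp r := by
  have f0 := hr.1
  have f1 := hr.2.1.link hs.1 h₀.2.1
  have f2 := (hr.2.2.link hs.2.2.symm h₀.2.2).link hs.2.1 h₁.2.2
  rw [← f0.ncomp_link h₀.1, ← f1.ncomp_link h₁.2.1, ← f2.ncomp_link h₂.2.2]
  refine congrArg (· + 3) (ncomp_congr fun h => ?_)
  simp only [H, resp_link, and_assoc]

/-- Here the three sides close up to a circle of their own, so only two of their three classes
disappear. -/
theorem ncomp_attach_loop {α : Type*} [Finite α] {r A : α → α → Prop} {s₀ s₁ s₂ : α}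
    (hr : Fresh r s₀ ∧ Fresh r s₁ ∧ Fresh r s₂) (hs : s₀ ≠ s₁ ∧ s₁ ≠ s₂ ∧ s₂ ≠ s₀)
    (H : ∀ h : α → Prop, Resp A h ↔ Resp r h ∧ h s₀ = h s₁ ∧ h s₂ = h s₀) :
    ncomp A + 2 = ncomp r := by
  have f2 := hr.2.2.link hs.2.2.symm hs.2.1
  rw [← hr.1.ncomp_link hs.1.symm, ← f2.ncomp_link hs.2.2.symm]
  refine congrArg (· + 2) (ncomp_congr fun h => ?_)
  simp only [H, resp_link, and_assoc]

namespace LinkDiagram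

/-- On either side the circle state of the triangle cancels against two others. The remaining states
with counts `N` and `N'` have the same marker sum, so exchanging `N` and `N'` changes nothing. -/
theorem weight_triangle (ε : ℤˣ) (k : ℤ) {N N' : ℕ} (hN : 0 < N) (hN' : 0 < N') (M₁ M₂ M₃ : ℕ) :
    weight (1 + -1 + ε + k) (N + 1) + weight (1 + -1 + -ε + k) N +
      (weight (1 + 1 + ε + k) N + weight (1 + 1 + -ε + k) M₁) +
      (weight (-1 + -1 + ε + k) N + weight (-1 + -1 + -ε + k) M₂ +
        (weight (-1 + 1 + ε + k) M₃ + weight (-1 + 1 + -ε + k) N')) =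
    weight (1 + -1 + ε + k) (N' + 1) + weight (1 + -1 + -ε + k) N' +
      (weight (1 + 1 + ε + k) N' + weight (1 + 1 + -ε + k) M₁) +
      (weight (-1 + -1 + ε + k) N' + weight (-1 + -1 + -ε + k) M₂ +
        (weight (-1 + 1 + ε + k) M₃ + weight (-1 + 1 + -ε + k) N)) := by
  have h1 := weight_cancel (k := 1 + -1 + ε + k) (l := 1 + 1 + ε + k) (m := -1 + -1 + ε + k) hN
    (by ring) (by ring)
  have h2 := weight_cancel (k := 1 + -1 + ε + k) (l := 1 + 1 + ε + k) (m := -1 + -1 + ε + k) hN'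
    (by ring) (by ring)
  have e : (-1 : ℤ) + 1 + -ε + k = 1 + -1 + -ε + k := by ring
  rw [e]
  linear_combination h1 - h2

/-- The state relation of `D'` transported along a bijection of arcs. -/
def StatePullback (D' : LinkDiagram) {E : Type} (g : E ≃ D'.E) (s : D'.X → ℤˣ) (x y : E) : Prop :=
  D'.StateStep s (g x) (g y)

theorem resp_statePullback {D' : LinkDiagram} {E : Type} {g : E ≃ D'.E} {s : D'.X → ℤˣ}
    {h : E → Prop} : Resp (D'.StatePullback g s) h ↔ Resp (D'.StateStep s) (h ∘ g.symm) := by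
  refine ⟨fun H x y hxy => H _ _ (by simpa [StatePullback] using hxy), fun H x y hxy => ?_⟩
  simpa using H _ _ hxy

theorem ncomp_statePullback {D' : LinkDiagram} {E : Type} (g : E ≃ D'.E) (s : D'.X → ℤˣ) :
    ncomp (D'.StatePullback g s) = D'.stateCircles s :=
  ncomp_of_surjective g g.surjective (fun _ _ h => g.injective h ▸ .refl _)
    (fun _ _ h => .rel _ _ h)
    fun u v h => ⟨g.symm u, g.symm v, by simp, by simp, .rel _ _ (by simpa [StatePullback] using h)⟩

/-- All states are compared on the arcs of `D`. The move exchanges two connections of the six outer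
ends, the one around the old triangle and the one around the new; the other connections are
unchanged. -/
theorem bracket_of_reidemeisterThree {D D' : LinkDiagram} (H : D.ReidemeisterThree D') :
    D.bracket = D'.bracket := by
  obtain ⟨c, p, f, g, hc, hs, ho0, ho1, d2, d3, d1, d0, hrest⟩ := H
  -- The side running over at both its crossings forces opposite markers to cut off the corners at
  -- `c 0` and `c 1`; the third marker `ε` is arbitrary.
  have e0 : joiningMarker (p 0) = 1 := by
    rw [isOver_iff, joiningMarker_add_one, neg_inj] at ho0; exact ho0
  have e1 : joiningMarker (p 1) = -1 := (isOver_iff _).1 ho1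
  set ε := joiningMarker (p 2) with hε
  have dne : ∀ k, ((c k, p k + 1) : D.X × ZMod 4) ≠ (c (k + 1), p (k + 1)) := fun k e => by
    have := hc (Prod.ext_iff.1 e).1
    exact absurd this (by clear * -; revert k; decide)
  have hext : ∀ k l j, j = p l + 2 ∨ j = p l + 3 → D.arc (c l, j) ≠ D.arc (c k, p k + 1) := by
    intro k l j hj
    refine arc_ne (hs k) (dne k) (fun e => ?_) fun e => ?_
    · obtain rfl := hc (Prod.ext_iff.1 e).1
      have h2 := (Prod.ext_iff.1 e).2
      have := zmod4_arith (p l)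
      simp only at h2
      rcases hj with rfl | rfl
      exacts [this.2.2.2.1 h2, this.2.2.2.2.1 h2]
    · obtain rfl := hc (Prod.ext_iff.1 e).1
      have h2 := (Prod.ext_iff.1 e).2
      have := zmod4_arith (p (k + 1))
      simp only at h2
      rcases hj with rfl | rfl
      exacts [this.2.1 h2, this.2.2.1 h2]
  have hsne : ∀ k l, k ≠ l → D.arc (c k, p k + 1) ≠ D.arc (c l, p l + 1) := by
    intro k l hkl
    refine arc_ne (hs l) (dne l) (fun e => hkl (hc (Prod.ext_iff.1 e).1)) fun e => ?_
    obtain rfl := hc (Prod.ext_iff.1 e).1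
    exact (zmod4_arith (p (l + 1))).1 (Prod.ext_iff.1 e).2
  obtain ⟨glue, g1, g2, g3, g4⟩ := exists_sum_glue (M := LaurentPolynomial ℤ) c hc
    (Equiv.refl _)
  have hD' : D'.bracket = ∑ s : D.X → ℤˣ, weight (∑ x, (s x : ℤ)) (D'.stateCircles (s ∘ f.symm)) := by
    rw [bracket_eq]
    symm
    refine Fintype.sum_equiv (f.arrowCongr (Equiv.refl _)) _ _ fun s => ?_
    congr 1
    exact Fintype.sum_equiv f _ _ fun c => by simp
  rw [hD', bracket_eq, g4, g4]
  refine Finset.sum_congr rfl fun t _ => ?_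
  rw [sum_fin_three 1 (-1) ε, sum_fin_three 1 (-1) ε]
  simp only [g3, Fin.sum_univ_three, Matrix.cons_val_zero, Matrix.cons_val_one, Matrix.cons_val,
    Units.val_neg, Units.val_one, neg_neg]
  set O := D.SmoothStep (Set.range c)ᶜ (glue 1 t) with hO0
  have hO : ∀ u, D.SmoothStep (Set.range c)ᶜ (glue u t) = O := fun u =>
    smoothStep_congr fun x hx => (g2 _ _ ⟨x, hx⟩).trans (g2 _ _ ⟨x, hx⟩).symm
  have hfr : ∀ k, Fresh O (D.arc (c k, p k + 1)) := fun k =>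
    smoothStep_fresh (hs k) (dne k) (by simp) (by simp)
  have resp₁ : ∀ (h : D.E → Prop) u, Resp (D.StateStep (glue u t)) h ↔
      Resp O h ∧ D.Joins (c 0) (marker (u 0)) h ∧ D.Joins (c 1) (marker (u 1)) h ∧
        D.Joins (c 2) (marker (u 2)) h := by
    intro h u
    rw [resp_stateStep_split D (Set.range c), hO]
    simp only [Set.forall_mem_range, g1, Fin.forall_fin_succ]
    simp
  have resp₂ : ∀ (h : D.E → Prop) u,
      Resp (D'.StatePullback g (glue u t ∘ f.symm)) h ↔
        Resp O h ∧ D'.Joins (f (c 0)) (marker (u 0)) (h ∘ g.symm) ∧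
        D'.Joins (f (c 1)) (marker (u 1)) (h ∘ g.symm) ∧
        D'.Joins (f (c 2)) (marker (u 2)) (h ∘ g.symm) := by
    intro h u
    rw [resp_statePullback, hO0, resp_stateStep_split D' (Set.range (f ∘ c)), resp_smoothStep,
      resp_smoothStep, Set.forall_mem_range, ← f.forall_congr_right]
    refine and_congr (forall_congr' fun x => ?_) ?_
    · have h1 : f x ∈ (Set.range (f ∘ c))ᶜ ↔ x ∈ (Set.range c)ᶜ := by simp
      rw [h1]
      refine forall_congr' fun hx => ?_
      have h2 : (glue u t ∘ f.symm) (f x) = glue 1 t x := by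
        simp only [Function.comp_apply, Equiv.symm_apply_apply]
        exact (g2 _ _ ⟨x, hx⟩).trans (g2 _ _ ⟨x, hx⟩).symm
      rw [h2]
      simp only [Joins, Function.comp_apply, hrest x _ hx, Equiv.symm_apply_apply]
    · simp only [Fin.forall_fin_succ, Function.comp_apply, Equiv.symm_apply_apply, g1]
      simp
  have t0 := zmod4_arith (p 0)
  have t1 := zmod4_arith (p 1)
  have t2 := zmod4_arith (p 2)
  have hs0 : D.arc (c 1, p 1) = D.arc (c 0, p 0 + 1) := (hs 0).symm
  have hs1 : D.arc (c 2, p 2) = D.arc (c 1, p 1 + 1) := (hs 1).symm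
  have hs2 : D.arc (c 0, p 0) = D.arc (c 2, p 2 + 1) := (hs 2).symm
  have d20 := d2 0
  have d21 := d2 1
  have d22 := d2 2
  have d30 := d3 0
  have d31 := d3 1
  have d32 := d3 2
  have d10 : D'.arc (f (c 0), p 0 + 1) = g (D.arc (c 1, p 1 + 2)) := d1 0
  have d11 : D'.arc (f (c 1), p 1 + 1) = g (D.arc (c 2, p 2 + 2)) := d1 1
  have d12 : D'.arc (f (c 2), p 2 + 1) = g (D.arc (c 0, p 0 + 2)) := d1 2
  have d00 : D'.arc (f (c 0), p 0) = g (D.arc (c 2, p 2 + 3)) := d0 2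
  have d01 : D'.arc (f (c 1), p 1) = g (D.arc (c 0, p 0 + 3)) := d0 0
  have d02 : D'.arc (f (c 2), p 2) = g (D.arc (c 1, p 1 + 3)) := d0 1
  rw [hs2] at d20
  rw [hs0] at d21
  rw [hs1] at d22
  have hS : D.arc (c 0, p 0 + 1) ≠ D.arc (c 1, p 1 + 1) ∧
      D.arc (c 1, p 1 + 1) ≠ D.arc (c 2, p 2 + 1) ∧ D.arc (c 2, p 2 + 1) ≠ D.arc (c 0, p 0 + 1) :=
    ⟨hsne 0 1 (by decide), hsne 1 2 (by decide), hsne 2 0 (by decide)⟩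
  have hx : ∀ l, D.arc (c l, p l + 2) ≠ D.arc (c 0, p 0 + 1) ∧
      D.arc (c l, p l + 2) ≠ D.arc (c 1, p 1 + 1) ∧
      D.arc (c l, p l + 2) ≠ D.arc (c 2, p 2 + 1) := fun l =>
    ⟨hext 0 l _ (.inl rfl), hext 1 l _ (.inl rfl), hext 2 l _ (.inl rfl)⟩
  have hy : ∀ l, D.arc (c l, p l + 3) ≠ D.arc (c 0, p 0 + 1) ∧
      D.arc (c l, p l + 3) ≠ D.arc (c 1, p 1 + 1) ∧
      D.arc (c l, p l + 3) ≠ D.arc (c 2, p 2 + 1) := fun l =>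
    ⟨hext 0 l _ (.inr rfl), hext 1 l _ (.inr rfl), hext 2 l _ (.inr rfl)⟩
  have a0 : ∀ h : D.E → Prop, D.Joins (c 0) (marker 1) h ↔
      h (D.arc (c 2, p 2 + 1)) = h (D.arc (c 0, p 0 + 1)) ∧ h (D.arc (c 0, p 0 + 2)) = h (D.arc (c 0, p 0 + 3)) := fun h => by
    rw [← e0, joins_marker_joiningMarker]
    simp only [Joins, hs2]
  have b0 : ∀ h : D.E → Prop, D.Joins (c 0) (marker (-1)) h ↔
      h (D.arc (c 0, p 0 + 1)) = h (D.arc (c 0, p 0 + 2)) ∧ h (D.arc (c 0, p 0 + 3)) = h (D.arc (c 2, p 2 + 1)) := fun h => by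
    rw [← e0, joins_marker_neg_joiningMarker]
    simp only [Joins, hs2, t0]
  have a0' : ∀ h : D.E → Prop, D'.Joins (f (c 0)) (marker 1) (h ∘ g.symm) ↔
      h (D.arc (c 2, p 2 + 3)) = h (D.arc (c 1, p 1 + 2)) ∧ h (D.arc (c 2, p 2 + 1)) = h (D.arc (c 0, p 0 + 1)) := fun h => by
    rw [← e0, joins_marker_joiningMarker]
    simp only [Joins, Function.comp_apply, d00, d10, d20, d30, Equiv.symm_apply_apply]
  have b0' : ∀ h : D.E → Prop, D'.Joins (f (c 0)) (marker (-1)) (h ∘ g.symm) ↔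
      h (D.arc (c 1, p 1 + 2)) = h (D.arc (c 2, p 2 + 1)) ∧ h (D.arc (c 0, p 0 + 1)) = h (D.arc (c 2, p 2 + 3)) := fun h => by
    rw [← e0, joins_marker_neg_joiningMarker]
    simp only [Joins, Function.comp_apply, t0, d00, d10, d20, d30, Equiv.symm_apply_apply]
  have a1 : ∀ h : D.E → Prop, D.Joins (c 1) (marker (-1)) h ↔
      h (D.arc (c 0, p 0 + 1)) = h (D.arc (c 1, p 1 + 1)) ∧ h (D.arc (c 1, p 1 + 2)) = h (D.arc (c 1, p 1 + 3)) := fun h => by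
    rw [← e1, joins_marker_joiningMarker]
    simp only [Joins, hs0]
  have b1 : ∀ h : D.E → Prop, D.Joins (c 1) (marker 1) h ↔
      h (D.arc (c 1, p 1 + 1)) = h (D.arc (c 1, p 1 + 2)) ∧ h (D.arc (c 1, p 1 + 3)) = h (D.arc (c 0, p 0 + 1)) := fun h => by
    rw [← neg_neg (1 : ℤˣ), ← e1, joins_marker_neg_joiningMarker]
    simp only [Joins, hs0, t1]
  have a1' : ∀ h : D.E → Prop, D'.Joins (f (c 1)) (marker (-1)) (h ∘ g.symm) ↔
      h (D.arc (c 0, p 0 + 3)) = h (D.arc (c 2, p 2 + 2)) ∧ h (D.arc (c 0, p 0 + 1)) = h (D.arc (c 1, p 1 + 1)) := fun h => by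
    rw [← e1, joins_marker_joiningMarker]
    simp only [Joins, Function.comp_apply, d01, d11, d21, d31, Equiv.symm_apply_apply]
  have b1' : ∀ h : D.E → Prop, D'.Joins (f (c 1)) (marker 1) (h ∘ g.symm) ↔
      h (D.arc (c 2, p 2 + 2)) = h (D.arc (c 0, p 0 + 1)) ∧ h (D.arc (c 1, p 1 + 1)) = h (D.arc (c 0, p 0 + 3)) := fun h => by
    rw [← neg_neg (1 : ℤˣ), ← e1, joins_marker_neg_joiningMarker]
    simp only [Joins, Function.comp_apply, t1, d01, d11, d21, d31, Equiv.symm_apply_apply]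
  have a2 : ∀ h : D.E → Prop, D.Joins (c 2) (marker ε) h ↔
      h (D.arc (c 1, p 1 + 1)) = h (D.arc (c 2, p 2 + 1)) ∧ h (D.arc (c 2, p 2 + 2)) = h (D.arc (c 2, p 2 + 3)) := fun h => by
    rw [hε, joins_marker_joiningMarker]
    simp only [Joins, hs1]
  have b2 : ∀ h : D.E → Prop, D.Joins (c 2) (marker (-ε)) h ↔
      h (D.arc (c 2, p 2 + 1)) = h (D.arc (c 2, p 2 + 2)) ∧ h (D.arc (c 2, p 2 + 3)) = h (D.arc (c 1, p 1 + 1)) := fun h => by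
    rw [hε, joins_marker_neg_joiningMarker]
    simp only [Joins, hs1, t2]
  have a2' : ∀ h : D.E → Prop, D'.Joins (f (c 2)) (marker ε) (h ∘ g.symm) ↔
      h (D.arc (c 1, p 1 + 3)) = h (D.arc (c 0, p 0 + 2)) ∧ h (D.arc (c 1, p 1 + 1)) = h (D.arc (c 2, p 2 + 1)) := fun h => by
    rw [hε, joins_marker_joiningMarker]
    simp only [Joins, Function.comp_apply, d02, d12, d22, d32, Equiv.symm_apply_apply]
  have b2' : ∀ h : D.E → Prop, D'.Joins (f (c 2)) (marker (-ε)) (h ∘ g.symm) ↔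
      h (D.arc (c 0, p 0 + 2)) = h (D.arc (c 1, p 1 + 1)) ∧ h (D.arc (c 2, p 2 + 1)) = h (D.arc (c 1, p 1 + 3)) := fun h => by
    rw [hε, joins_marker_neg_joiningMarker]
    simp only [Joins, Function.comp_apply, t2, d02, d12, d22, d32, Equiv.symm_apply_apply]
  have hF := And.intro (hfr 0) (And.intro (hfr 1) (hfr 2))
  generalize D.arc (c 0, p 0 + 1) = s₀ at *
  generalize D.arc (c 1, p 1 + 1) = s₁ at *
  generalize D.arc (c 2, p 2 + 1) = s₂ at *
  have hx0 := hx 0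
  have hx1 := hx 1
  have hx2 := hx 2
  have hy0 := hy 0
  have hy1 := hy 1
  have hy2 := hy 2
  generalize D.arc (c 0, p 0 + 2) = x₀ at *
  generalize D.arc (c 1, p 1 + 2) = x₁ at *
  generalize D.arc (c 2, p 2 + 2) = x₂ at *
  generalize D.arc (c 0, p 0 + 3) = y₀ at *
  generalize D.arc (c 1, p 1 + 3) = y₁ at *
  generalize D.arc (c 2, p 2 + 3) = y₂ at *
  have fresh_links : ∀ {a₀ a₁ a₂ b₀ b₁ b₂ : D.E}, (a₀ ≠ s₀ ∧ a₀ ≠ s₁ ∧ a₀ ≠ s₂) →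
      (a₁ ≠ s₀ ∧ a₁ ≠ s₁ ∧ a₁ ≠ s₂) → (a₂ ≠ s₀ ∧ a₂ ≠ s₁ ∧ a₂ ≠ s₂) →
      (b₀ ≠ s₀ ∧ b₀ ≠ s₁ ∧ b₀ ≠ s₂) → (b₁ ≠ s₀ ∧ b₁ ≠ s₁ ∧ b₁ ≠ s₂) →
      (b₂ ≠ s₀ ∧ b₂ ≠ s₁ ∧ b₂ ≠ s₂) → let r := link (link (link O a₀ b₀) a₁ b₁) a₂ b₂
      Fresh r s₀ ∧ Fresh r s₁ ∧ Fresh r s₂ := fun i0 i1 i2 j0 j1 j2 =>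
    ⟨((hF.1.link i0.1 j0.1).link i1.1 j1.1).link i2.1 j2.1,
      ((hF.2.1.link i0.2.1 j0.2.1).link i1.2.1 j1.2.1).link i2.2.1 j2.2.1,
      ((hF.2.2.link i0.2.2 j0.2.2).link i1.2.2 j1.2.2).link i2.2.2 j2.2.2⟩
  have f0 := fresh_links hx0 hx1 hx2 hy0 hy1 hy2
  have f1 := fresh_links hx0 hx1 hx2 hy1 hy2 hy0
  have f2 := fresh_links hx0 hx1 hx2 hy1 hy0 hy2
  have f3 := fresh_links hx0 hx1 hx2 hy2 hy1 hy0
  have f4 := fresh_links hx0 hx1 hx2 hy0 hy2 hy1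
  -- The k-th letter is `a` if the marker at `c k` joins the two sides of the old triangle there,
  -- and `b` otherwise; primes refer to `D'`.
  have aaa := ncomp_attach_loop (A := D.StateStep (glue ![1, -1, ε] t)) f0 hS fun h => by
    rw [resp₁]; simp only [Matrix.cons_val, a0, a1, a2, resp_link]; clear * -; grind
  have aab := ncomp_attach_three (A := D.StateStep (glue ![1, -1, -ε] t)) f0 hS hx2 hx2 hx2 fun h => by
    rw [resp₁]; simp only [Matrix.cons_val, a0, a1, b2, resp_link]; clear * -; grind
  have aba := ncomp_attach_three (A := D.StateStep (glue ![1, 1, ε] t)) f0 hS hx1 hx1 hx1 fun h => by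
    rw [resp₁]; simp only [Matrix.cons_val, a0, b1, a2, resp_link]; clear * -; grind
  have abb := ncomp_attach_three (A := D.StateStep (glue ![1, 1, -ε] t)) f4 hS hx2 hx1 hx2 fun h => by
    rw [resp₁]; simp only [Matrix.cons_val, a0, b1, b2, resp_link]; clear * -; grind
  have baa := ncomp_attach_three (A := D.StateStep (glue ![-1, -1, ε] t)) f0 hS hx0 hx0 hx0 fun h => by
    rw [resp₁]; simp only [Matrix.cons_val, b0, a1, a2, resp_link]; clear * -; grind
  have bab := ncomp_attach_three (A := D.StateStep (glue ![-1, -1, -ε] t)) f3 hS hx0 hx0 hx2 fun h => by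
    rw [resp₁]; simp only [Matrix.cons_val, b0, a1, b2, resp_link]; clear * -; grind
  have bba := ncomp_attach_three (A := D.StateStep (glue ![-1, 1, ε] t)) f2 hS hx0 hx1 hx1 fun h => by
    rw [resp₁]; simp only [Matrix.cons_val, b0, b1, a2, resp_link]; clear * -; grind
  have bbb := ncomp_attach_three (A := D.StateStep (glue ![-1, 1, -ε] t)) f1 hS hx0 hx1 hx2 fun h => by
    rw [resp₁]; simp only [Matrix.cons_val, b0, b1, b2, resp_link]; clear * -; grind
  have aaa' := ncomp_attach_loop (A := D'.StatePullback g (glue ![1, -1, ε] t ∘ f.symm)) f1 hS fun h => by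
    rw [resp₂]; simp only [Matrix.cons_val, a0', a1', a2', resp_link]; clear * -; grind
  have aab' := ncomp_attach_three (A := D'.StatePullback g (glue ![1, -1, -ε] t ∘ f.symm)) f1 hS hx0 hx0 hx0 fun h => by
    rw [resp₂]; simp only [Matrix.cons_val, a0', a1', b2', resp_link]; clear * -; grind
  have aba' := ncomp_attach_three (A := D'.StatePullback g (glue ![1, 1, ε] t ∘ f.symm)) f1 hS hx2 hx2 hx2 fun h => by
    rw [resp₂]; simp only [Matrix.cons_val, a0', b1', a2', resp_link]; clear * -; grind
  have baa' := ncomp_attach_three (A := D'.StatePullback g (glue ![-1, -1, ε] t ∘ f.symm)) f1 hS hx1 hx1 hx1 fun h => by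
    rw [resp₂]; simp only [Matrix.cons_val, b0', a1', a2', resp_link]; clear * -; grind
  have bba' := ncomp_attach_three (A := D'.StatePullback g (glue ![-1, 1, ε] t ∘ f.symm)) f2 hS hx2 hx1 hx1 fun h => by
    rw [resp₂]; simp only [Matrix.cons_val, b0', b1', a2', resp_link]; clear * -; grind
  have bab' := ncomp_attach_three (A := D'.StatePullback g (glue ![-1, -1, -ε] t ∘ f.symm)) f3 hS hx0 hx0 hx1 fun h => by
    rw [resp₂]; simp only [Matrix.cons_val, b0', a1', b2', resp_link]; clear * -; grind
  have abb' := ncomp_attach_three (A := D'.StatePullback g (glue ![1, 1, -ε] t ∘ f.symm)) f4 hS hx2 hx0 hx2 fun h => by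
    rw [resp₂]; simp only [Matrix.cons_val, a0', b1', b2', resp_link]; clear * -; grind
  have bbb' := ncomp_attach_three (A := D'.StatePullback g (glue ![-1, 1, -ε] t ∘ f.symm)) f0 hS hx2 hx0 hx1 fun h => by
    rw [resp₂]; simp only [Matrix.cons_val, b0', b1', b2', resp_link]; clear * -; grind
  rw [← stateCircles_eq] at aaa aab aba abb baa bab bba bbb
  rw [ncomp_statePullback] at aaa' aab' aba' abb' baa' bab' bba' bbb'
  have q_aba : D.stateCircles (glue ![1, 1, ε] t) = D.stateCircles (glue ![1, -1, -ε] t) := by omega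
  have q_baa : D.stateCircles (glue ![-1, -1, ε] t) = D.stateCircles (glue ![1, -1, -ε] t) := by omega
  have q_aaa : D.stateCircles (glue ![1, -1, ε] t) = D.stateCircles (glue ![1, -1, -ε] t) + 1 := by omega
  have q_bbb' : D'.stateCircles (glue ![-1, 1, -ε] t ∘ f.symm) = D.stateCircles (glue ![1, -1, -ε] t) := by omega
  have q_aab' : D'.stateCircles (glue ![1, -1, -ε] t ∘ f.symm) = D.stateCircles (glue ![-1, 1, -ε] t) := by omega
  have q_aba' : D'.stateCircles (glue ![1, 1, ε] t ∘ f.symm) = D.stateCircles (glue ![-1, 1, -ε] t) := by omega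
  have q_baa' : D'.stateCircles (glue ![-1, -1, ε] t ∘ f.symm) = D.stateCircles (glue ![-1, 1, -ε] t) := by omega
  have q_aaa' : D'.stateCircles (glue ![1, -1, ε] t ∘ f.symm) = D.stateCircles (glue ![-1, 1, -ε] t) + 1 := by omega
  have q_abb' : D'.stateCircles (glue ![1, 1, -ε] t ∘ f.symm) = D.stateCircles (glue ![1, 1, -ε] t) := by omega
  have q_bab' : D'.stateCircles (glue ![-1, -1, -ε] t ∘ f.symm) = D.stateCircles (glue ![-1, -1, -ε] t) := by omega
  have q_bba' : D'.stateCircles (glue ![-1, 1, ε] t ∘ f.symm) = D.stateCircles (glue ![-1, 1, ε] t) := by omega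
  rw [q_aba, q_baa, q_aaa, q_bbb', q_aab', q_aba', q_baa', q_aaa', q_abb', q_bab', q_bba']
  exact weight_triangle ε _ (stateCircles_pos _ _) (stateCircles_pos _ _) _ _ _

end LinkDiagram

/-! ### Ends of arcs -/

section Ends

variable {X E : Type*} {arc : X × ZMod 4 → E}

/-- The other end of the arc ending at `d`. -/
noncomputable def oppEnd (hm : ∀ d, ∃! d', d' ≠ d ∧ arc d' = arc d) (d : X × ZMod 4) :
    X × ZMod 4 := (hm d).choose

variable (hm : ∀ d, ∃! d', d' ≠ d ∧ arc d' = arc d)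

theorem oppEnd_ne (d : X × ZMod 4) : oppEnd hm d ≠ d := (hm d).choose_spec.1.1

@[simp] theorem arc_oppEnd (d : X × ZMod 4) : arc (oppEnd hm d) = arc d := (hm d).choose_spec.1.2

theorem eq_oppEnd {d d' : X × ZMod 4} (h : d' ≠ d) (h' : arc d' = arc d) : d' = oppEnd hm d :=
  (hm d).choose_spec.2 d' ⟨h, h'⟩

@[simp] theorem oppEnd_oppEnd (d : X × ZMod 4) : oppEnd hm (oppEnd hm d) = d :=
  (eq_oppEnd hm (oppEnd_ne hm d).symm (arc_oppEnd hm d).symm).symm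

theorem arc_eq_arc_iff {d d' : X × ZMod 4} : arc d' = arc d ↔ d' = d ∨ d' = oppEnd hm d := by
  constructor
  · intro h
    by_cases hd : d' = d
    exacts [.inl hd, .inr (eq_oppEnd hm hd h)]
  · rintro (rfl | rfl) <;> simp

/-- Double counting: the two ends of each arc cancel. This underlies the parity and flow arguments
below. -/
theorem sum_ends_eq_zero [Fintype X] {M : Type*} [AddCommGroup M] (F : X × ZMod 4 → M)
    (hF : ∀ d, F d + F (oppEnd hm d) = 0) : ∑ d, F d = 0 :=
  Finset.sum_involution (fun d _ => oppEnd hm d) (fun d _ => hF d) (fun d _ _ => oppEnd_ne hm d)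
    (fun _ _ => Finset.mem_univ _) fun d _ => oppEnd_oppEnd hm d

theorem sum_zmod4 {M : Type*} [AddCommMonoid M] (F : ZMod 4 → M) (i : ZMod 4) :
    ∑ j, F j = F i + F (i + 1) + (F (i + 2) + F (i + 3)) := by
  rw [← Equiv.sum_comp (Equiv.addLeft i) F]
  have h : (Finset.univ : Finset (ZMod 4)) = {0, 1, 2, 3} := by decide
  simp only [h, Equiv.coe_addLeft]
  rw [Finset.sum_insert (by decide), Finset.sum_insert (by decide), Finset.sum_insert (by decide),
    Finset.sum_singleton, add_zero, ← add_assoc]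

end Ends

namespace LinkDiagram

open LaurentPolynomial

/-! ### The bracket as a link invariant up to units -/

/-- Equality of Laurent polynomials up to a factor `± A ^ k`. -/
def UnitEquiv (p q : LaurentPolynomial ℤ) : Prop := ∃ (u : ℤˣ) (k : ℤ), p = C (u : ℤ) * T k * q

theorem UnitEquiv.refl (p : LaurentPolynomial ℤ) : UnitEquiv p p := ⟨1, 0, by simp⟩

theorem UnitEquiv.symm {p q : LaurentPolynomial ℤ} (h : UnitEquiv p q) : UnitEquiv q p := by
  obtain ⟨u, k, rfl⟩ := h
  refine ⟨u, -k, ?_⟩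
  have h1 : (C (u : ℤ) * C (u : ℤ) : LaurentPolynomial ℤ) = 1 := by
    rw [← map_mul, ← Units.val_mul, Int.units_mul_self]; simp
  have h2 : (T (-k) * T k : LaurentPolynomial ℤ) = 1 := by rw [← T_add]; simp
  linear_combination (-q) * h1 - C (u : ℤ) * C (u : ℤ) * q * h2

theorem UnitEquiv.trans {p q r : LaurentPolynomial ℤ} (h : UnitEquiv p q) (h' : UnitEquiv q r) :
    UnitEquiv p r := by
  obtain ⟨u, k, rfl⟩ := h
  obtain ⟨v, l, rfl⟩ := h'
  refine ⟨u * v, k + l, ?_⟩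
  rw [Units.val_mul, map_mul, T_add]
  ring

theorem bracket_unitEquiv_of_step {D D' : LinkDiagram} (h : D.Step D') :
    UnitEquiv D.bracket D'.bracket := by
  rcases h with h | h | h | h
  · rw [bracket_of_iso h]; exact .refl _
  · obtain ⟨ε, h⟩ := bracket_of_reidemeisterOne h
    exact ⟨-1, 3 * ε, by rw [h]; simp⟩
  · rw [bracket_of_reidemeisterTwo h]; exact .refl _
  · rw [bracket_of_reidemeisterThree h]; exact .refl _

/-- Only the first move contributes a nontrivial unit, namely -A^(±3). -/
theorem bracket_unitEquiv {D D' : LinkDiagram} (h : D.toLink = D'.toLink) :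
    UnitEquiv D.bracket D'.bracket := by
  have := Quot.eqvGen_exact h
  clear h
  induction this with
  | rel _ _ h => exact bracket_unitEquiv_of_step h
  | refl _ => exact .refl _
  | symm _ _ _ ih => exact ih.symm
  | trans _ _ _ _ _ ih1 ih2 => exact ih1.trans ih2

theorem coeff_mul_T (p : LaurentPolynomial ℤ) (k j : ℤ) : (p * T k).coeff j = p.coeff (j - k) := by
  rw [T, AddMonoidAlgebra.coeff_mul_single_apply, mul_one, sub_eq_add_neg]

theorem coeff_C_mul (p : LaurentPolynomial ℤ) (a j : ℤ) : (C a * p).coeff j = a * p.coeff j := by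
  rw [← smul_eq_C_mul]; rfl

theorem coeff_unit_mul (p : LaurentPolynomial ℤ) (a k j : ℤ) :
    (C a * T k * p).coeff j = a * p.coeff (j - k) := by
  rw [mul_assoc, T_mul, coeff_C_mul, coeff_mul_T]

/-! ### Changing a marker -/

variable (D : LinkDiagram)

theorem sum_over_ends_eq_zero (χ : D.E → ZMod 2) : ∑ d, χ (D.arc d) = 0 :=
  sum_ends_eq_zero D.mate _ fun d => by
    rw [arc_oppEnd D.mate]; exact CharTwo.add_self_eq_zero _

variable {D}

theorem sum_joins {c : D.X} {i : ZMod 4} {h : D.E → ZMod 2} (H : D.Joins c i h) :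
    ∑ j, h (D.arc (c, j)) = 0 := by
  rw [sum_zmod4 _ i, H.1, H.2, CharTwo.add_self_eq_zero, CharTwo.add_self_eq_zero, add_zero]

/-- If all crossings but `c` are smoothed, the end `i` at `c` is joined with another one. -/
theorem exists_eqvGen_smoothStep (s : D.X → ℤˣ) (c : D.X) (i : ZMod 4) :
    ∃ j, j ≠ i ∧ Relation.EqvGen (D.SmoothStep {c}ᶜ s) (D.arc (c, i)) (D.arc (c, j)) := by
  classical
  by_contra! H
  set O := D.SmoothStep {c}ᶜ s
  let χ : D.E → ZMod 2 := fun e => if Relation.EqvGen O (D.arc (c, i)) e then 1 else 0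
  have hχ : Resp O χ := fun x y hxy => by
    have := resp_eqvGen O (D.arc (c, i)) x y hxy
    simp only [χ, this]
  -- Modulo two the ends in a class sum to zero globally and at every smoothed crossing, hence also
  -- at `c`; an end alone in its class at `c` would contribute 1.
  have h1 := D.sum_over_ends_eq_zero χ
  rw [Fintype.sum_prod_type, Finset.sum_eq_single c] at h1
  · rw [Finset.sum_eq_single i] at h1
    · simp only [χ, Relation.EqvGen.refl, if_true] at h1
      exact one_ne_zero h1
    · intro j _ hj
      simp only [χ, H j hj, if_false]
    · simp
  · intro b _ hb
    exact sum_joins (resp_smoothStep D |>.1 hχ b hb)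
  · simp

/-- Joining all four ends at `c` costs the state `s` at most one class and is at least as coarse as
`s'`. -/
theorem stateCircles_le_of_flip {s s' : D.X → ℤˣ} {c : D.X} (h : ∀ x, x ≠ c → s x = s' x) :
    D.stateCircles s ≤ D.stateCircles s' + 1 := by
  set i := marker (s c)
  refine (ncomp_le_link _ (D.arc (c, i)) (D.arc (c, i + 2))).trans (Nat.add_le_add_right ?_ 1)
  refine ncomp_anti fun g hg => ?_
  rw [resp_link, resp_stateStep_split D {c}] at hg
  rw [resp_stateStep_split D {c}, ← smoothStep_congr (R := {c}ᶜ) (s := s) fun x hx => h x hx]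
  refine ⟨hg.1.1, ?_⟩
  have h1 := hg.1.2 c rfl
  have h2 := hg.2
  intro x hx
  rw [Set.mem_singleton_iff.1 hx]
  change g (D.arc (_, i)) = g (D.arc (_, i + 1)) ∧ _ at h1
  have key : ∀ j, g (D.arc (c, j)) = g (D.arc (c, i)) := by
    intro j
    rcases zmod4_cases i j with rfl | rfl | rfl | rfl
    · rfl
    · exact h1.1.symm
    · exact h2.symm
    · exact h1.2.symm.trans h2.symm
  exact ⟨(key _).trans (key _).symm, (key _).trans (key _).symm⟩

/-- If the two new arcs lie on different circles, the outside must connect the end `i` with `i + 1`;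
the other smoothing then merges the two circles. -/
theorem stateCircles_flip_of_not_eqvGen {s s' : D.X → ℤˣ} {c : D.X}
    (h : ∀ x, x ≠ c → s x = s' x) (hc : s' c = -s c)
    (hs : ¬ Relation.EqvGen (D.StateStep s) (D.arc (c, marker (s c)))
      (D.arc (c, marker (s c) + 2))) :
    D.stateCircles s' + 1 = D.stateCircles s := by
  rw [D.stateCircles_eq s, ← ncomp_link_of_not_eqvGen hs, D.stateCircles_eq s']
  refine congrArg (· + 1) (ncomp_congr fun g => ?_)
  set i := marker (s c) with hi
  have hsi : s c = joiningMarker i := by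
    rcases Int.units_eq_one_or (s c) with h | h <;> rw [hi, h] <;> decide
  obtain ⟨a1, a2, a3, a4, a5, a6, b0, b1, b2, b3, b4, b5, b6, b7, b8⟩ := zmod4_arith i
  have hsc : ∀ g : D.E → Prop, Resp (D.StateStep s) g ↔
      Resp (D.SmoothStep {c}ᶜ s) g ∧ D.Joins c i g := fun g => by
    rw [resp_stateStep_split D {c}]
    simp [hi]
  obtain ⟨j, hj, hij⟩ := exists_eqvGen_smoothStep s c i
  have hij' : Relation.EqvGen (D.SmoothStep {c}ᶜ s) (D.arc (c, i)) (D.arc (c, i + 1)) := by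
    rcases zmod4_cases i j with rfl | rfl | rfl | rfl
    · exact absurd rfl hj
    · exact hij
    · refine absurd (eqvGen_mono_resp (fun g hg => ?_) hij) hs
      exact ((hsc g).1 hg).1
    · refine absurd (eqvGen_iff_resp.2 fun g hg => ?_) hs
      have := (hsc g).1 hg
      exact (this.1.eqvGen hij).trans this.2.2.symm
  rw [resp_link, hsc, resp_stateStep_split D {c}, ← smoothStep_congr (R := {c}ᶜ) (s := s) fun x hx => h x hx]
  simp only [Set.mem_singleton_iff, forall_eq, hc, hsi, joins_marker_neg_joiningMarker]
  simp only [Joins, b0, b1, b2]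
  constructor
  · rintro ⟨h1, h2, h3⟩
    have h4 := h1.eqvGen hij'
    exact ⟨⟨h1, h4, h2.symm.trans (h4.symm.trans h3.symm)⟩, h4.trans h2⟩
  · rintro ⟨⟨h1, h2, h3⟩, h4⟩
    exact ⟨h1, h2.symm.trans h4, h3.symm.trans h4.symm⟩

theorem stateCircles_le (s t : D.X → ℤˣ) :
    D.stateCircles s ≤ D.stateCircles t + (Finset.univ.filter fun c => s c ≠ t c).card := by
  induction hn : (Finset.univ.filter fun c => s c ≠ t c).card generalizing s with
  | zero =>
    rw [Finset.card_eq_zero, Finset.filter_eq_empty_iff] at hn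
    have : s = t := funext fun c => by simpa using hn (Finset.mem_univ c)
    rw [this]; simp
  | succ n ih =>
    obtain ⟨c, hc⟩ : (Finset.univ.filter fun c => s c ≠ t c).Nonempty :=
      Finset.card_pos.1 (by omega)
    have h1 := stateCircles_le_of_flip (D := D) (s := s) (s' := Function.update s c (t c)) (c := c)
      fun x hx => by rw [Function.update_of_ne hx]
    have h2 := ih (Function.update s c (t c)) (by
      have : (Finset.univ.filter fun x => Function.update s c (t c) x ≠ t x) =
          (Finset.univ.filter fun x => s x ≠ t x).erase c := by
        ext x
        by_cases hx : x = c
        · subst hx; simp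
        · simp [hx]
      rw [this, Finset.card_erase_of_mem hc, hn, Nat.add_sub_cancel])
    omega

/-! ### Adequate diagrams. -/

/-- The two new arcs at each crossing lie on different circles if all markers are `ε`. -/
def Adequate (D : LinkDiagram) (ε : ℤˣ) : Prop :=
  ∀ c, ¬ Relation.EqvGen (D.StateStep fun _ => ε) (D.arc (c, marker ε)) (D.arc (c, marker ε + 2))

/-- The first change away from the constant state loses a circle, and each later one gains at most
one; this saves 2 over `stateCircles_le`. -/
theorem Adequate.stateCircles_lt {ε : ℤˣ} (h : D.Adequate ε) {s : D.X → ℤˣ}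
    (hs : s ≠ fun _ => ε) :
    D.stateCircles s + 2 ≤
      D.stateCircles (fun _ => ε) + (Finset.univ.filter fun c => s c ≠ ε).card := by
  obtain ⟨c, hc⟩ := Function.ne_iff.1 hs
  have h1 := stateCircles_flip_of_not_eqvGen (D := D) (s := fun _ => ε)
    (s' := Function.update (fun _ => ε) c (-ε)) (c := c)
    (fun x hx => by rw [Function.update_of_ne hx]) (by simp) (h c)
  have h2 := stateCircles_le s (Function.update (fun _ => ε) c (-ε))
  have hc' : s c = -ε := by
    rcases Int.units_eq_one_or (s c) with h | h <;> rcases Int.units_eq_one_or ε with h' | h' <;>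
      simp_all
  have h3 : (Finset.univ.filter fun x => s x ≠ Function.update (fun _ => ε) c (-ε) x) =
      (Finset.univ.filter fun x => s x ≠ ε).erase c := by
    ext x
    by_cases hx : x = c
    · subst hx; simp [hc']
    · simp [hx]
  rw [h3] at h2
  have h4 := Finset.card_erase_add_one (s := Finset.univ.filter fun x => s x ≠ ε) (a := c)
    (by simpa using hc)
  omega

theorem sum_markers (ε : ℤˣ) (s : D.X → ℤˣ) :
    (ε : ℤ) * ∑ c, (s c : ℤ) = D.crossings - 2 * (Finset.univ.filter fun c => s c ≠ ε).card := by
  rw [Finset.card_filter, crossings, Finset.mul_sum]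
  have : (Fintype.card D.X : ℤ) = ∑ c : D.X, 1 := by simp
  rw [this]
  push_cast
  rw [Finset.mul_sum, ← Finset.sum_sub_distrib]
  refine Finset.sum_congr rfl fun c _ => ?_
  rcases Int.units_eq_one_or (s c) with h | h <;> rcases Int.units_eq_one_or ε with h' | h' <;>
    simp [h, h']

end LinkDiagram

/-! ### The span of a Laurent polynomial -/

section Span

variable {Γ : Type*} [LinearOrder Γ] [AddGroup Γ]

theorem polySpan_eq {p : AddMonoidAlgebra ℤ Γ} {M m : Γ}
    (hM : IsGreatest (p.coeff.support : Set Γ) M) (hm : IsLeast (p.coeff.support : Set Γ) m) :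
    polySpan p = M - m := by
  have h : p.coeff.support.Nonempty := ⟨M, hM.1⟩
  rw [polySpan, dif_pos h, (Finset.isGreatest_max' _ h).unique hM,
    (Finset.isLeast_min' _ h).unique hm]

theorem polySpan_eq_zero {p : AddMonoidAlgebra ℤ Γ} (h : ¬ p.coeff.support.Nonempty) :
    polySpan p = 0 := dif_neg h

theorem exists_isGreatest_isLeast {p : AddMonoidAlgebra ℤ Γ} (h : p.coeff.support.Nonempty) :
    ∃ M m, IsGreatest (p.coeff.support : Set Γ) M ∧ IsLeast (p.coeff.support : Set Γ) m :=
  ⟨_, _, Finset.isGreatest_max' _ h, Finset.isLeast_min' _ h⟩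

end Span

theorem polySpan_le {p : LaurentPolynomial ℤ} {a b : ℤ} (hab : a ≤ b)
    (h : ∀ j, p.coeff j ≠ 0 → a ≤ j ∧ j ≤ b) : polySpan p ≤ b - a := by
  by_cases hp : p.coeff.support.Nonempty
  · obtain ⟨M, m, hM, hm⟩ := exists_isGreatest_isLeast hp
    rw [polySpan_eq hM hm]
    have h1 := h M (by simpa using hM.1)
    have h2 := h m (by simpa using hm.1)
    omega
  · rw [polySpan_eq_zero hp]
    omega

namespace LinkDiagram

open LaurentPolynomial

theorem UnitEquiv.polySpan_eq {p q : LaurentPolynomial ℤ} (h : UnitEquiv p q) :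
    polySpan p = polySpan q := by
  obtain ⟨u, k, rfl⟩ := h
  have hs : ∀ j, j ∈ (C (u : ℤ) * T k * q).coeff.support ↔ j - k ∈ q.coeff.support := by
    intro j
    rw [Finsupp.mem_support_iff, Finsupp.mem_support_iff, coeff_unit_mul]
    simp
  by_cases hq : q.coeff.support.Nonempty
  · obtain ⟨M, m, hM, hm⟩ := exists_isGreatest_isLeast hq
    rw [_root_.polySpan_eq hM hm, _root_.polySpan_eq (M := M + k) (m := m + k)]
    · ring
    · refine ⟨by rw [Finset.mem_coe, hs]; simpa using hM.1, fun j hj => ?_⟩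
      have := hM.2 ((hs j).1 hj)
      linarith
    · refine ⟨by rw [Finset.mem_coe, hs]; simpa using hm.1, fun j hj => ?_⟩
      have := hm.2 ((hs j).1 hj)
      linarith
  · rw [polySpan_eq_zero hq, polySpan_eq_zero]
    rintro ⟨j, hj⟩
    exact hq ⟨_, (hs j).1 hj⟩

/-! ### Extreme coefficients of the bracket -/

/-- The sign `ε` selects the top or the bottom of δ^N, so that both ends of the bracket are treated
at once. -/
theorem coeff_loop_pow (ε : ℤˣ) (N : ℕ) :
    (∀ j : ℤ, 2 * (N : ℤ) < ε * j → ((-T 2 - T (-2) : LaurentPolynomial ℤ) ^ N).coeff j = 0) ∧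
      ((-T 2 - T (-2) : LaurentPolynomial ℤ) ^ N).coeff (ε * (2 * N)) = (-1) ^ N := by
  induction N with
  | zero =>
    refine ⟨fun j hj => ?_, ?_⟩
    · rw [pow_zero, ← T_zero, T_apply, if_neg]
      rintro rfl
      simp at hj
    · rw [pow_zero, ← T_zero, T_apply]; simp
  | succ N ih =>
    have key : ∀ j, ((-T 2 - T (-2) : LaurentPolynomial ℤ) ^ (N + 1)).coeff j =
        -((-T 2 - T (-2) : LaurentPolynomial ℤ) ^ N).coeff (j - 2) -
          ((-T 2 - T (-2) : LaurentPolynomial ℤ) ^ N).coeff (j + 2) := by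
      intro j
      rw [pow_succ, mul_sub, mul_neg, AddMonoidAlgebra.coeff_sub, AddMonoidAlgebra.coeff_neg,
        Finsupp.sub_apply, Finsupp.neg_apply, coeff_mul_T, coeff_mul_T, sub_neg_eq_add]
    rcases Int.units_eq_one_or ε with rfl | rfl
    · simp only [Units.val_one, one_mul] at ih ⊢
      push_cast
      refine ⟨fun j hj => ?_, ?_⟩
      · rw [key, ih.1 _ (by linarith), ih.1 _ (by linarith)]; simp
      · rw [key, ih.1 (2 * (N + 1) + 2) (by linarith),
          show 2 * ((N : ℤ) + 1) - 2 = 2 * N by ring, ih.2]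
        ring
    · simp only [Units.val_neg, Units.val_one, neg_mul, one_mul] at ih ⊢
      push_cast
      refine ⟨fun j hj => ?_, ?_⟩
      · rw [key, ih.1 _ (by linarith), ih.1 _ (by linarith)]; simp
      · rw [key, ih.1 (-(2 * (N + 1)) - 2) (by linarith),
          show -(2 * ((N : ℤ) + 1)) + 2 = -(2 * N) by ring, ih.2]
        ring

theorem coeff_weight (k j : ℤ) (N : ℕ) :
    (weight k N).coeff j = ((-T 2 - T (-2) : LaurentPolynomial ℤ) ^ (N - 1)).coeff (j - k) := by
  rw [weight, T_mul, coeff_mul_T]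

theorem coeff_bracket (D : LinkDiagram) (j : ℤ) :
    D.bracket.coeff j = ∑ s : D.X → ℤˣ, (weight (∑ c, (s c : ℤ)) (D.stateCircles s)).coeff j := by
  rw [bracket_eq, AddMonoidAlgebra.coeff_sum, Finset.sum_apply']

/-- The largest possible exponent of `A ^ ε` in the bracket. -/
noncomputable def extremeDegree (D : LinkDiagram) (ε : ℤˣ) : ℤ :=
  D.crossings + 2 * D.stateCircles (fun _ => ε) - 2

variable {D : LinkDiagram}

theorem unit_mul_self (ε : ℤˣ) : (ε : ℤ) * ε = 1 := by
  rw [← Units.val_mul, Int.units_mul_self, Units.val_one]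

/-- Each changed marker lowers `ε` times the marker sum by 2 and raises the degree of the power of δ
by at most 2. -/
theorem coeff_bracket_eq_zero {ε : ℤˣ} {j : ℤ} (hj : D.extremeDegree ε < ε * j) :
    D.bracket.coeff j = 0 := by
  rw [coeff_bracket]
  refine Finset.sum_eq_zero fun s _ => ?_
  rw [coeff_weight]
  refine (coeff_loop_pow ε _).1 _ ?_
  have h1 := sum_markers ε s
  have h2 := stateCircles_le s (fun _ => ε)
  have h3 := D.stateCircles_pos s
  rw [mul_sub, h1]
  unfold extremeDegree at hj
  push_cast [Nat.cast_sub h3]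
  omega

/-- Only the constant state reaches the extreme exponent, so nothing can cancel its leading
coefficient. -/
theorem Adequate.coeff_bracket {ε : ℤˣ} (h : D.Adequate ε) :
    D.bracket.coeff (ε * D.extremeDegree ε) = (-1) ^ (D.stateCircles (fun _ => ε) - 1) := by
  rw [LinkDiagram.coeff_bracket, Finset.sum_eq_single (fun _ => ε)]
  · rw [coeff_weight, ← (coeff_loop_pow ε _).2]
    congr 1
    have h1 := sum_markers (D := D) ε fun _ => ε
    have h3 := D.stateCircles_pos fun _ => ε
    have h4 : (Finset.univ.filter fun _ : D.X => ε ≠ ε).card = 0 := by simp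
    rw [h4] at h1
    have h5 : ∑ c : D.X, (ε : ℤ) = ε * D.crossings := by
      simp [crossings, mul_comm]
    rw [h5]
    unfold extremeDegree
    push_cast [Nat.cast_sub h3]
    ring
  · intro s _ hs
    rw [coeff_weight]
    refine (coeff_loop_pow ε _).1 _ ?_
    have h1 := sum_markers ε s
    have h2 := h.stateCircles_lt hs
    have h3 := D.stateCircles_pos s
    rw [mul_sub, h1, ← mul_assoc, unit_mul_self, one_mul]
    unfold extremeDegree
    push_cast [Nat.cast_sub h3]
    omega
  · simp

theorem polySpan_bracket_le (D : LinkDiagram) :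
    polySpan D.bracket ≤ D.extremeDegree 1 + D.extremeDegree (-1) := by
  have h1 := D.stateCircles_pos fun _ => 1
  have h2 := D.stateCircles_pos fun _ => -1
  rw [← sub_neg_eq_add]
  refine polySpan_le (by unfold extremeDegree; omega) fun j hj => ⟨?_, ?_⟩
  · by_contra! h
    exact hj (coeff_bracket_eq_zero (ε := -1) (by simp; linarith))
  · by_contra! h
    exact hj (coeff_bracket_eq_zero (ε := 1) (by simp; linarith))

theorem isGreatest_bracket (h : D.Adequate 1) :
    IsGreatest (D.bracket.coeff.support : Set ℤ) (D.extremeDegree 1) := by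
  refine ⟨?_, fun j hj => ?_⟩
  · have := h.coeff_bracket
    simp only [Units.val_one, one_mul] at this
    simp [this]
  · by_contra! h'
    exact (Finsupp.mem_support_iff.1 hj) (coeff_bracket_eq_zero (ε := 1) (by simp; linarith))

theorem isLeast_bracket (h : D.Adequate (-1)) :
    IsLeast (D.bracket.coeff.support : Set ℤ) (-D.extremeDegree (-1)) := by
  refine ⟨?_, fun j hj => ?_⟩
  · have := h.coeff_bracket
    simp only [Units.val_one, Units.val_neg, neg_mul, one_mul] at this
    simp [this]
  · by_contra! h'
    exact (Finsupp.mem_support_iff.1 hj) (coeff_bracket_eq_zero (ε := -1) (by simp; linarith))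

theorem polySpan_bracket_of_adequate (h : D.Adequate 1) (h' : D.Adequate (-1)) :
    polySpan D.bracket = D.extremeDegree 1 + D.extremeDegree (-1) := by
  rw [polySpan_eq (isGreatest_bracket h) (isLeast_bracket h'), sub_neg_eq_add]

/-! ### Connected components and divisibility of the bracket -/

/-- Two arcs meet at a crossing. -/
def ConnStep (D : LinkDiagram) (x y : D.E) : Prop :=
  ∃ c i j, x = D.arc (c, i) ∧ y = D.arc (c, j)

/-- The number of connected components of the diagram. -/
noncomputable def comps (D : LinkDiagram) : ℕ := ncomp D.ConnStep

theorem comps_pos (D : LinkDiagram) : 0 < D.comps :=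
  have := D.nonempty
  ncomp_pos _

theorem comps_eq_one (h : D.Connected) : D.comps = 1 := by
  refine le_antisymm ?_ D.comps_pos
  have : Subsingleton (Quot D.ConnStep) := by
    refine ⟨fun a b => ?_⟩
    induction a using Quot.ind with | _ x
    induction b using Quot.ind with | _ y
    exact Quot.eqvGen_sound (h x y)
  exact Finite.card_le_one_iff_subsingleton.2 this

theorem comps_le_stateCircles (s : D.X → ℤˣ) : D.comps ≤ D.stateCircles s :=
  ncomp_anti fun _ hg x y ⟨c, i, _, hx, hy⟩ => hg x y ⟨c, i, i + 1, hx, hy⟩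

/-- In a state with fewest circles no change of marker merges two circles, so all four ends at each
crossing lie on one circle. -/
theorem exists_stateCircles_eq_comps (D : LinkDiagram) :
    ∃ s : D.X → ℤˣ, D.stateCircles s = D.comps := by
  obtain ⟨s, -, hs⟩ := Finset.exists_min_image (Finset.univ : Finset (D.X → ℤˣ)) D.stateCircles
    ⟨fun _ => 1, Finset.mem_univ _⟩
  refine ⟨s, le_antisymm (ncomp_anti fun g hg => ?_) (comps_le_stateCircles s)⟩
  have key : ∀ c, Relation.EqvGen (D.StateStep s) (D.arc (c, marker (s c)))
      (D.arc (c, marker (s c) + 2)) := by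
    intro c
    by_contra h
    have := stateCircles_flip_of_not_eqvGen (s' := Function.update s c (-s c))
      (fun x hx => by rw [Function.update_of_ne hx]) (by simp) h
    have := hs (Function.update s c (-s c)) (Finset.mem_univ _)
    omega
  have all : ∀ c i, g (D.arc (c, i)) = g (D.arc (c, marker (s c))) := by
    intro c i
    have h1 := hg.eqvGen (key c)
    have h2 := (resp_stateStep D).1 hg c
    rcases zmod4_cases (marker (s c)) i with rfl | rfl | rfl | rfl
    · rfl
    · exact h2.1.symm
    · exact h1.symm
    · exact h2.2.symm.trans h1.symm
  rintro x y ⟨c, i, j, rfl, rfl⟩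
  rw [all, all c j]

theorem bracket_eq_pow_mul (D : LinkDiagram) :
    D.bracket = (-T 2 - T (-2)) ^ (D.comps - 1) *
      ∑ s : D.X → ℤˣ, T (∑ c, (s c : ℤ)) * (-T 2 - T (-2)) ^ (D.stateCircles s - D.comps) := by
  rw [bracket, Finset.mul_sum]
  refine Finset.sum_congr rfl fun s _ => ?_
  have h1 := comps_le_stateCircles s
  have h2 := D.comps_pos
  rw [show D.stateCircles s - 1 = D.comps - 1 + (D.stateCircles s - D.comps) by omega, pow_add]
  ring

theorem exists_eval_loop_eq_zero :
    ∃ φ : LaurentPolynomial ℤ →+* ℂ, φ (-T 2 - T (-2)) = 0 ∧ ∀ k, φ (T k) ≠ 0 := by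
  -- With z⁴ = -1, δ evaluates to -(z⁴ + 1)/z² = 0.
  obtain ⟨z, hz⟩ := IsAlgClosed.exists_pow_nat_eq (-1 : ℂ) (n := 4) (by norm_num)
  have hz0 : z ≠ 0 := by rintro rfl; norm_num at hz
  refine ⟨eval₂ (Int.castRingHom ℂ) (Units.mk0 z hz0), ?_, fun k => ?_⟩
  · rw [map_sub, map_neg, eval₂_T, eval₂_T]
    have : (z : ℂ) ^ 2 ≠ 0 := pow_ne_zero _ hz0
    simp only [zpow_neg, Units.val_inv_eq_inv_val, Units.val_zpow_eq_zpow_val, Units.val_mk0]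
    have h2 : z ^ (2 : ℤ) = z ^ 2 := by norm_cast
    rw [h2]
    field_simp
    linear_combination -hz
  · rw [eval₂_T]
    exact Units.ne_zero _

theorem loop_ne_zero : (-T 2 - T (-2) : LaurentPolynomial ℤ) ≠ 0 := by
  intro h
  have := (coeff_loop_pow 1 1).2
  rw [pow_one, h] at this
  simp at this

/-- Divide by δ^(k-1) and evaluate at a root of δ: only states with exactly k circles survive. They
all have the same marker sum, so their equal nonzero contributions add up to a nonzero number. -/
theorem not_pow_comps_dvd (h : D.stateCircles (fun _ => 1) + D.stateCircles (fun _ => -1) =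
    D.crossings + 2 * D.comps) : ¬ (-T 2 - T (-2)) ^ D.comps ∣ D.bracket := by
  rw [bracket_eq_pow_mul]
  intro hd
  have h0 := D.comps_pos
  rw [show D.comps = D.comps - 1 + 1 by omega, pow_succ, Nat.add_sub_cancel,
    ← show D.comps = D.comps - 1 + 1 by omega,
    mul_dvd_mul_iff_left (pow_ne_zero _ loop_ne_zero)] at hd
  obtain ⟨Q, hQ⟩ := hd
  obtain ⟨φ, hφ, hT⟩ := exists_eval_loop_eq_zero
  have h1 := congrArg φ hQ
  rw [map_mul, hφ, zero_mul, map_sum] at h1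
  have h2 : ∀ s : D.X → ℤˣ,
      φ (T (∑ c, (s c : ℤ)) * (-T 2 - T (-2)) ^ (D.stateCircles s - D.comps)) =
        if D.stateCircles s = D.comps then
          φ (T (D.crossings - 2 * D.stateCircles (fun _ => 1) + 2 * D.comps)) else 0 := by
    intro s
    rw [map_mul, map_pow, hφ]
    split_ifs with hs
    · rw [hs, Nat.sub_self, pow_zero, mul_one]
      congr 2
      -- Comparison with the two constant states bounds the numbers of - and of + markers of `s`
      -- from below; by `h` these bounds add up to n, so both are attained.
      have h3 := stateCircles_le (fun _ => 1) s
      have h4 := stateCircles_le (fun _ => -1) s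
      have h5 := sum_markers 1 s
      have h6 := sum_markers (-1) s
      have h7 : (Finset.univ.filter fun c => (1 : ℤˣ) ≠ s c) =
        Finset.univ.filter fun c => s c ≠ 1 := by ext; simp [eq_comm]
      have h8 : (Finset.univ.filter fun c => (-1 : ℤˣ) ≠ s c) =
        Finset.univ.filter fun c => s c ≠ -1 := by ext; simp [eq_comm]
      rw [h7] at h3
      rw [h8] at h4
      simp only [Units.val_one, one_mul, Units.val_neg, neg_mul] at h5 h6
      omega
    · have := comps_le_stateCircles s
      rw [zero_pow (by omega), mul_zero]
  rw [Finset.sum_congr rfl fun s _ => h2 s, ← Finset.sum_filter, Finset.sum_const,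
    nsmul_eq_mul, mul_eq_zero] at h1
  rcases h1 with h1 | h1
  · obtain ⟨s, hs⟩ := D.exists_stateCircles_eq_comps
    rw [Nat.cast_eq_zero, Finset.card_eq_zero, Finset.filter_eq_empty_iff] at h1
    exact h1 (Finset.mem_univ s) hs
  · exact hT _ h1

/-- The bracket of `D'` is divisible by δ to the power `D'.comps - 1`, and units do not affect
divisibility. -/
theorem comps_le_of_toLink_eq {D' : LinkDiagram} (hL : D'.toLink = D.toLink)
    (h : D.stateCircles (fun _ => 1) + D.stateCircles (fun _ => -1) =
      D.crossings + 2 * D.comps) : D'.comps ≤ D.comps := by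
  by_contra! hlt
  refine not_pow_comps_dvd h ?_
  obtain ⟨u, k, hu⟩ := bracket_unitEquiv hL.symm
  rw [hu, D'.bracket_eq_pow_mul]
  refine Dvd.dvd.mul_left (Dvd.dvd.mul_right (pow_dvd_pow _ ?_) _) _
  omega

end LinkDiagram

/-! ### Cycles of the underlying graph modulo two -/

section Cycles

variable {X E : Type} [Fintype X] [Fintype E] [DecidableEq E] (arc : X × ZMod 4 → E)

/-- The boundary map from arcs to crossings. -/
noncomputable def bdry : (E → ZMod 2) →ₗ[ZMod 2] (X → ZMod 2) :=
  (Matrix.of fun (c : X) (e : E) => ∑ i, if arc (c, i) = e then (1 : ZMod 2) else 0).mulVecLin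

/-- The cycles modulo two. -/
noncomputable def cycles : Submodule (ZMod 2) (E → ZMod 2) := LinearMap.ker (bdry arc)

/-- Two crossings are connected by an arc. -/
def CrossingStep (c c' : X) : Prop := ∃ i j, arc (c, i) = arc (c', j)

/-- Two arcs meet at a crossing. -/
def ArcStep (x y : E) : Prop := ∃ c i j, x = arc (c, i) ∧ y = arc (c, j)

/-- The face permutation as a relation. -/
def FaceRel (d d' : X × ZMod 4) : Prop := ∃ m, m ≠ d ∧ arc m = arc d ∧ d' = (m.1, m.2 + 1)

variable {arc}

theorem bdry_apply (h : E → ZMod 2) (c : X) : bdry arc h c = ∑ i, h (arc (c, i)) := by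
  simp only [bdry, Matrix.mulVecLin_apply, Matrix.mulVec, dotProduct, Matrix.of_apply,
    Finset.sum_mul]
  rw [Finset.sum_comm]
  simp

theorem mem_cycles {h : E → ZMod 2} : h ∈ cycles arc ↔ ∀ c, ∑ i, h (arc (c, i)) = 0 := by
  rw [cycles, LinearMap.mem_ker, funext_iff]
  simp only [bdry_apply, Pi.zero_apply]

theorem sum_fiber [DecidableEq X]
    (hm : ∀ d, ∃! d', d' ≠ d ∧ arc d' = arc d) {M : Type*} [AddCommMonoid M] (φ : X × ZMod 4 → M)
    (d : X × ZMod 4) :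
    (∑ d', if arc d' = arc d then φ d' else 0) = φ d + φ (oppEnd hm d) := by
  have : (Finset.univ.filter fun d' => arc d' = arc d) = {d, oppEnd hm d} := by
    ext d'
    simp [arc_eq_arc_iff hm]
  rw [← Finset.sum_filter, this, Finset.sum_pair (oppEnd_ne hm d).symm]

theorem zmod4_step {β : Type*} (f : ZMod 4 → β) (h : ∀ i, f i = f (i + 1)) (i : ZMod 4) :
    f i = f 0 := by
  rcases LinkDiagram.zmod4_cases 0 i with rfl | rfl | rfl | rfl
  · rfl
  · exact (h 0).symm
  · exact ((h 0).trans (h _)).symm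
  · exact ((h 0).trans ((h _).trans (h _))).symm

theorem zmod_two_add_eq_zero {a b : ZMod 2} : a + b = 0 ↔ a = b := by
  rw [← CharTwo.sub_eq_add, sub_eq_zero]

/-- The incidence matrix and its transpose have the same rank, and the kernel of the transpose
consists of the functions constant on components. -/
theorem finrank_cycles [DecidableEq X]
    (hm : ∀ d, ∃! d', d' ≠ d ∧ arc d' = arc d) :
    Module.finrank (ZMod 2) (cycles arc) + Fintype.card X =
      Fintype.card E + ncomp (CrossingStep arc) := by
  set M : Matrix X E (ZMod 2) :=
    Matrix.of fun (c : X) (e : E) => ∑ i, if arc (c, i) = e then (1 : ZMod 2) else 0 with hM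
  have h1 := LinearMap.finrank_range_add_finrank_ker (bdry arc)
  have h2 := LinearMap.finrank_range_add_finrank_ker M.transpose.mulVecLin
  have h3 : Module.finrank (ZMod 2) (LinearMap.range M.transpose.mulVecLin) =
      Module.finrank (ZMod 2) (LinearMap.range (bdry arc)) := M.rank_transpose
  have h4 : LinearMap.ker M.transpose.mulVecLin = inv (ZMod 2) (CrossingStep arc) := by
    ext u
    have key : ∀ e, M.transpose.mulVecLin u e = ∑ d, if arc d = e then u d.1 else 0 := by
      intro e
      simp only [hM, Matrix.mulVecLin_apply, Matrix.mulVec, dotProduct, Matrix.transpose_apply,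
        Matrix.of_apply, Fintype.sum_prod_type]
      refine Finset.sum_congr rfl fun c _ => ?_
      rw [Finset.sum_mul]
      exact Finset.sum_congr rfl fun i _ => by split_ifs <;> simp
    rw [LinearMap.mem_ker, mem_inv, funext_iff]
    simp only [key, Pi.zero_apply]
    constructor
    · rintro H c c' ⟨i, j, hij⟩
      have := H (arc (c', j))
      rw [sum_fiber hm (fun d => u d.1), zmod_two_add_eq_zero] at this
      rcases (arc_eq_arc_iff hm).1 hij with h | h
      · exact congrArg (fun d => u d.1) h
      · exact (congrArg (fun d => u d.1) h).trans this.symm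
    · intro H e
      by_cases he : ∃ d, arc d = e
      · obtain ⟨d, rfl⟩ := he
        rw [sum_fiber hm (fun d => u d.1), zmod_two_add_eq_zero]
        exact H _ _ ⟨d.2, (oppEnd hm d).2, (arc_oppEnd hm d).symm⟩
      · push Not at he
        exact Finset.sum_eq_zero fun d _ => if_neg (he d)
  rw [h3, h4, finrank_inv, Module.finrank_fintype_fun_eq_card] at h2
  rw [Module.finrank_fintype_fun_eq_card] at h1
  change _ + Module.finrank (ZMod 2) (cycles arc) = _ at h1
  omega

theorem card_arcs [DecidableEq X]
    (hm : ∀ d, ∃! d', d' ≠ d ∧ arc d' = arc d) :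
    Fintype.card E = 2 * Fintype.card X + Fintype.card {e : E // ∀ d, arc d ≠ e} := by
  classical
  have h1 : ∑ e : E, (∑ d, if arc d = e then 1 else 0) = 4 * Fintype.card X := by
    rw [Finset.sum_comm]
    simp only [Finset.sum_ite_eq, Finset.mem_univ, if_true, Finset.sum_const, Finset.card_univ,
      Fintype.card_prod, ZMod.card, smul_eq_mul, mul_one]
    ring
  have h2 : ∀ e : E, (∑ d, if arc d = e then 1 else 0) = if ∀ d, arc d ≠ e then 0 else 2 := by
    intro e
    split_ifs with he
    · exact Finset.sum_eq_zero fun d _ => if_neg (he d)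
    · push Not at he
      obtain ⟨d, rfl⟩ := he
      rw [sum_fiber hm fun _ => 1]
  simp only [h2] at h1
  rw [Finset.sum_ite, Finset.sum_const_zero, zero_add, Finset.sum_const, smul_eq_mul] at h1
  have h3 := Finset.card_filter_add_card_filter_not (s := (Finset.univ : Finset E))
    (fun e => ∀ d, arc d ≠ e)
  rw [Fintype.card_subtype]
  rw [Finset.card_univ] at h3
  omega

/-- Crossingless circles are components containing no crossing. -/
theorem ncomp_arcStep :
    ncomp (ArcStep arc) = ncomp (CrossingStep arc) + Fintype.card {e : E // ∀ d, arc d ≠ e} := by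
  classical
  let G : E → Quot (CrossingStep arc) ⊕ {e : E // ∀ d, arc d ≠ e} := fun e =>
    if h : ∃ d, arc d = e then .inl (Quot.mk _ h.choose.1)
    else .inr ⟨e, fun d hd => h ⟨d, hd⟩⟩
  have hG : ∀ c i, G (arc (c, i)) = .inl (Quot.mk _ c) := by
    intro c i
    have h : ∃ d, arc d = arc (c, i) := ⟨_, rfl⟩
    simp only [G, dif_pos h]
    exact congrArg _ (Quot.sound ⟨h.choose.2, i, h.choose_spec⟩)
  have hR : Resp (ArcStep arc) G := by
    rintro x y ⟨c, i, j, rfl, rfl⟩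
    rw [hG, hG]
  have e : Quot (ArcStep arc) ≃ Quot (CrossingStep arc) ⊕ {e : E // ∀ d, arc d ≠ e} :=
    { toFun := Quot.lift G hR
      invFun := Sum.elim (Quot.lift (fun c => Quot.mk _ (arc (c, 0))) fun c c' ⟨i, j, h⟩ => by
          refine (Quot.sound ⟨c, 0, i, rfl, rfl⟩ : Quot.mk (ArcStep arc) _ = Quot.mk _ _).trans ?_
          rw [h]
          exact Quot.sound ⟨c', j, 0, rfl, rfl⟩) fun e => Quot.mk _ e.1
      left_inv := by
        intro q
        induction q using Quot.ind with | _ x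
        by_cases h : ∃ d, arc d = x
        · obtain ⟨⟨c, i⟩, rfl⟩ := h
          change Sum.elim _ _ (G _) = _
          rw [hG]
          exact Quot.sound ⟨c, 0, i, rfl, rfl⟩
        · simp only [G, dif_neg h]
          rfl
      right_inv := by
        rintro (q | ⟨x, hx⟩)
        · induction q using Quot.ind with | _ c
          exact hG c 0
        · exact dif_neg fun ⟨d, hd⟩ => hx d hd }
  have : Fintype (Quot (CrossingStep arc)) := Fintype.ofFinite _
  rw [ncomp, Nat.card_congr e, ncomp, Nat.card_eq_fintype_card, Nat.card_eq_fintype_card,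
    Fintype.card_sum]

theorem finrank_cycles_eq [DecidableEq X]
    (hm : ∀ d, ∃! d', d' ≠ d ∧ arc d' = arc d) :
    Module.finrank (ZMod 2) (cycles arc) = Fintype.card X + ncomp (ArcStep arc) := by
  have h1 := finrank_cycles hm
  have h2 := card_arcs hm
  have h3 := ncomp_arcStep (arc := arc)
  omega

theorem resp_faceRel (hm : ∀ d, ∃! d', d' ≠ d ∧ arc d' = arc d)
    {β : Type*} {φ : X × ZMod 4 → β} :
    Resp (FaceRel arc) φ ↔ ∀ d, φ (oppEnd hm d) = φ (d.1, d.2 + 1) := by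
  constructor
  · intro H d
    exact H _ _ ⟨d, (oppEnd_ne hm d).symm, (arc_oppEnd hm d).symm, rfl⟩
  · rintro H d d' ⟨m, hmd, hm', rfl⟩
    rw [← H m, eq_oppEnd hm hmd hm', oppEnd_oppEnd]

/-- The faces determine a spherical surface if and only if every cycle is a sum of face
boundaries. -/
theorem planar_iff [DecidableEq X]
    (hm : ∀ d, ∃! d', d' ≠ d ∧ arc d' = arc d) :
    Nat.card (Quot (FaceRel arc)) = Fintype.card X + 2 * ncomp (CrossingStep arc) ↔
      ∀ z ∈ cycles arc, ∃ φ : X × ZMod 4 → ZMod 2, Resp (FaceRel arc) φ ∧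
        ∀ d, z (arc d) = φ d + φ (d.1, d.2 + 1) := by
  classical
  -- `B` takes a face function to its boundary. Crossingless circles meet no corner, so their values
  -- are added as free coordinates.
  let B : (inv (ZMod 2) (FaceRel arc) × ({e : E // ∀ d, arc d ≠ e} → ZMod 2)) →ₗ[ZMod 2] (E → ZMod 2) :=
    { toFun := fun p e => (∑ d, if arc d = e then p.1.1 d else 0) +
        if h : ∀ d, arc d ≠ e then p.2 ⟨e, h⟩ else 0
      map_add' := fun p q => by
        ext e
        simp only [Prod.fst_add, Prod.snd_add, Submodule.coe_add, Pi.add_apply]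
        rw [add_add_add_comm, ← Finset.sum_add_distrib]
        congr 1
        · exact Finset.sum_congr rfl fun d _ => by split_ifs <;> simp
        · split_ifs <;> simp
      map_smul' := fun a p => by
        ext e
        simp only [Prod.smul_fst, Prod.smul_snd, Submodule.coe_smul, Pi.smul_apply, smul_eq_mul,
          RingHom.id_apply, mul_add, Finset.mul_sum]
        congr 1
        · exact Finset.sum_congr rfl fun d _ => by split_ifs <;> simp
        · split_ifs <;> simp }
  have hB1 : ∀ p d, B p (arc d) = p.1.1 d + p.1.1 (d.1, d.2 + 1) := by
    intro p d
    change (∑ d', if arc d' = arc d then p.1.1 d' else 0) + dite _ _ _ = _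
    rw [dif_neg (fun h => h d rfl), add_zero, sum_fiber hm p.1.1, (resp_faceRel hm).1 p.1.2]
  have hB2 : ∀ p (e : {e : E // ∀ d, arc d ≠ e}), B p e.1 = p.2 e := by
    intro p e
    change (∑ d', if arc d' = e.1 then p.1.1 d' else 0) + dite _ _ _ = _
    rw [dif_pos e.2, Finset.sum_eq_zero fun d _ => if_neg (e.2 d), zero_add]
  have hBZ : LinearMap.range B ≤ cycles arc := by
    rintro _ ⟨p, rfl⟩
    rw [mem_cycles]
    intro c
    simp only [hB1]
    have h := Equiv.sum_comp (Equiv.addRight (1 : ZMod 4)) fun i => p.1.1 (c, i)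
    simp only [Equiv.coe_addRight] at h
    rw [Finset.sum_add_distrib, h, CharTwo.add_self_eq_zero]
  -- The kernel of `B` consists of the face functions constant on each component.
  let J : inv (ZMod 2) (CrossingStep arc) →ₗ[ZMod 2]
      (inv (ZMod 2) (FaceRel arc) × ({e : E // ∀ d, arc d ≠ e} → ZMod 2)) :=
    { toFun := fun u => (⟨fun d => u.1 d.1, (resp_faceRel hm).2 fun d => u.2 _ _
        ⟨(oppEnd hm d).2, d.2, arc_oppEnd hm d⟩⟩, 0)
      map_add' := fun u v => by ext <;> simp
      map_smul' := fun a u => by ext <;> simp }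
  have hJ : Function.Injective J := by
    intro u v h
    ext c
    exact congrArg (fun p => p.1.1 (c, 0)) h
  have hJB : LinearMap.range J = LinearMap.ker B := by
    ext p
    rw [LinearMap.mem_ker]
    constructor
    · rintro ⟨u, rfl⟩
      ext e
      by_cases he : ∀ d, arc d ≠ e
      · exact hB2 _ ⟨e, he⟩
      · push Not at he
        obtain ⟨d, rfl⟩ := he
        rw [hB1]
        exact CharTwo.add_self_eq_zero _
    · intro h
      have h1 : ∀ d, p.1.1 d = p.1.1 (d.1, d.2 + 1) := fun d =>
        zmod_two_add_eq_zero.1 ((hB1 p d).symm.trans (congrFun h _))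
      have h2 : ∀ c i, p.1.1 (c, i) = p.1.1 (c, 0) := by
        intro c i
        have t := zmod4_step (fun i => p.1.1 (c, i)) fun i => h1 (c, i)
        exact t i
      refine ⟨⟨fun c => p.1.1 (c, 0), ?_⟩, ?_⟩
      · rintro c c' ⟨i, j, hij⟩
        change p.1.1 (c, 0) = p.1.1 (c', 0)
        rw [← h2 c i, ← h2 c' j]
        rcases (arc_eq_arc_iff hm).1 hij with h | h
        · rw [h]
        · rw [h, (resp_faceRel hm).1 p.1.2, ← h1]
      · refine Prod.ext (Subtype.ext (funext fun d => (h2 d.1 d.2).symm)) (funext fun e => ?_)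
        exact ((hB2 p e).symm.trans (congrFun h _)).symm
  -- With F faces, V crossings, k components having crossings and m crossingless circles, the range
  -- of `B` has dimension F + m - k, while the cycles have dimension V + k + m.
  have r1 := LinearMap.finrank_range_add_finrank_ker B
  rw [← hJB, LinearMap.finrank_range_of_inj hJ, finrank_inv, Module.finrank_prod, finrank_inv,
    Module.finrank_fintype_fun_eq_card] at r1
  have r2 := finrank_cycles_eq hm
  rw [ncomp_arcStep] at r2
  have r3 : LinearMap.range B = cycles arc ↔ ∀ z ∈ cycles arc,
      ∃ φ : X × ZMod 4 → ZMod 2, Resp (FaceRel arc) φ ∧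
        ∀ d, z (arc d) = φ d + φ (d.1, d.2 + 1) := by
    constructor
    · intro h z hz
      rw [← h] at hz
      obtain ⟨p, rfl⟩ := hz
      exact ⟨p.1.1, p.1.2, hB1 p⟩
    · intro h
      refine le_antisymm hBZ fun z hz => ?_
      obtain ⟨φ, hφ, hz'⟩ := h z hz
      refine ⟨(⟨φ, hφ⟩, fun e => z e.1), ?_⟩
      ext e
      by_cases he : ∀ d, arc d ≠ e
      · exact hB2 _ ⟨e, he⟩
      · push Not at he
        obtain ⟨d, rfl⟩ := he
        rw [hB1, hz']
  rw [← r3]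
  change ncomp (FaceRel arc) = _ ↔ _
  constructor
  · intro h
    refine Submodule.eq_of_le_of_finrank_eq hBZ ?_
    omega
  · intro h
    rw [h] at r1
    omega

end Cycles

/-! ### The two constant states inside the cycle space. -/

namespace LinkDiagram

variable {D : LinkDiagram}

/-- A smoothing pairs the ends at each crossing, so equal values cancel modulo two. -/
theorem resp_const_le_cycles (ε : ℤˣ) : inv (ZMod 2) (D.StateStep fun _ => ε) ≤ cycles D.arc :=
  fun _ hh => mem_cycles.2 fun c => sum_joins ((resp_stateStep D).1 hh c)

theorem inv_inf_inv :
    inv (ZMod 2) (D.StateStep fun _ => 1) ⊓ inv (ZMod 2) (D.StateStep fun _ => -1) =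
      inv (ZMod 2) D.ConnStep := by
  ext h
  rw [Submodule.mem_inf, mem_inv, mem_inv, mem_inv, resp_stateStep, resp_stateStep]
  constructor
  · rintro ⟨h1, h2⟩ x y ⟨c, i, j, rfl, rfl⟩
    have a1 := (h1 c).1
    have a2 := (h2 c).1
    have a3 := (h1 c).2
    change h (D.arc (c, 0)) = h (D.arc (c, 1)) at a1
    change h (D.arc (c, 1)) = h (D.arc (c, 2)) at a2
    change h (D.arc (c, 2)) = h (D.arc (c, 3)) at a3
    have key : ∀ i, h (D.arc (c, i)) = h (D.arc (c, 0)) := by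
      intro i
      have t := zmod4_cases 0 i
      rw [zero_add, zero_add, zero_add] at t
      rcases t with rfl | rfl | rfl | rfl
      exacts [rfl, a1.symm, (a1.trans a2).symm, (a1.trans (a2.trans a3)).symm]
    rw [key, key j]
  · intro H
    exact ⟨fun c => ⟨H _ _ ⟨c, _, _, rfl, rfl⟩, H _ _ ⟨c, _, _, rfl, rfl⟩⟩,
      fun c => ⟨H _ _ ⟨c, _, _, rfl, rfl⟩, H _ _ ⟨c, _, _, rfl, rfl⟩⟩⟩

theorem finrank_sup_add_comps :
    Module.finrank (ZMod 2) ↥(inv (ZMod 2) (D.StateStep fun _ => 1) ⊔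
      inv (ZMod 2) (D.StateStep fun _ => -1)) + D.comps =
      D.stateCircles (fun _ => 1) + D.stateCircles (fun _ => -1) := by
  have h := Submodule.finrank_sup_add_finrank_inf_eq (inv (ZMod 2) (D.StateStep fun _ => 1))
    (inv (ZMod 2) (D.StateStep fun _ => -1))
  rwa [inv_inf_inv, finrank_inv, finrank_inv, finrank_inv] at h

theorem finrank_cycles_eq_crossings :
    Module.finrank (ZMod 2) (cycles D.arc) = D.crossings + D.comps :=
  finrank_cycles_eq D.mate

/-- The sum of the two subspaces lies in the cycle space. Planarity plays no role in this bound. -/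
theorem stateCircles_add_le (D : LinkDiagram) :
    D.stateCircles (fun _ => 1) + D.stateCircles (fun _ => -1) ≤ D.crossings + 2 * D.comps := by
  have h1 := D.finrank_sup_add_comps
  have h2 := D.finrank_cycles_eq_crossings
  have h3 := Submodule.finrank_mono (sup_le (D.resp_const_le_cycles 1) (D.resp_const_le_cycles (-1)))
  omega

theorem stateCircles_add_eq_iff :
    D.stateCircles (fun _ => 1) + D.stateCircles (fun _ => -1) = D.crossings + 2 * D.comps ↔
      inv (ZMod 2) (D.StateStep fun _ => 1) ⊔ inv (ZMod 2) (D.StateStep fun _ => -1) =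
        cycles D.arc := by
  have h1 := D.finrank_sup_add_comps
  have h2 := D.finrank_cycles_eq_crossings
  constructor
  · intro h
    exact Submodule.eq_of_le_of_finrank_eq
      (sup_le (D.resp_const_le_cycles 1) (D.resp_const_le_cycles (-1))) (by omega)
  · intro h
    rw [h] at h1
    omega

/-- In a planar diagram every cycle is a sum of face boundaries. -/
theorem exists_face_function {z : D.E → ZMod 2} (hz : z ∈ cycles D.arc) :
    ∃ φ : D.X × ZMod 4 → ZMod 2, Resp D.FaceStep φ ∧
      ∀ d, z (D.arc d) = φ d + φ (d.1, d.2 + 1) :=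
  (planar_iff D.mate).1 D.planar z hz

end LinkDiagram

namespace LinkDiagram

variable {D : LinkDiagram}

/-! ### Alternating diagrams -/

/-- `F` is transferred from ends to arcs; `z` prescribes the values on crossingless circles. -/
theorem exists_descent {X E β : Type*} {arc : X × ZMod 4 → E}
    (hm : ∀ d, ∃! d', d' ≠ d ∧ arc d' = arc d) (F : X × ZMod 4 → β)
    (hF : ∀ d, F (oppEnd hm d) = F d) (z : E → β) :
    ∃ f : E → β, (∀ d, f (arc d) = F d) ∧ ∀ e, (∀ d, arc d ≠ e) → f e = z e := by
  classical
  refine ⟨fun e => if h : ∃ d, arc d = e then F h.choose else z e, fun d => ?_, fun e he => ?_⟩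
  · have h : ∃ d', arc d' = arc d := ⟨d, rfl⟩
    simp only [dif_pos h]
    rcases (arc_eq_arc_iff hm).1 h.choose_spec with h' | h'
    · rw [h']
    · rw [h', hF]
  · exact dif_neg fun ⟨d, hd⟩ => he d hd

theorem Alternating.isOver_oppEnd (h : D.Alternating) (d : D.X × ZMod 4) :
    IsOver (oppEnd D.mate d).2 ↔ ¬ IsOver d.2 :=
  h _ _ (oppEnd_ne D.mate d) (arc_oppEnd D.mate d)

theorem resp_faceStep {β : Type*} {φ : D.X × ZMod 4 → β} :
    Resp D.FaceStep φ ↔ ∀ d, φ (oppEnd D.mate d) = φ (d.1, d.2 + 1) :=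
  resp_faceRel D.mate

theorem face_oppEnd_add_one {β : Type*} {φ : D.X × ZMod 4 → β} (h : Resp D.FaceStep φ)
    (d : D.X × ZMod 4) :
    φ ((oppEnd D.mate d).1, (oppEnd D.mate d).2 + 1) = φ d := by
  rw [← resp_faceStep.1 h, oppEnd_oppEnd]

-- In an alternating diagram each + circle with crossings follows the boundary of one face. Seen
-- from either end of an arc the chosen corner lies in the same face, precisely because the two
-- heights differ.
open Classical in
theorem Alternating.exists_plus (h : D.Alternating) {β : Type*} {φ : D.X × ZMod 4 → β}
    (hφ : Resp D.FaceStep φ) (z : D.E → β) :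
    ∃ f : D.E → β, (∀ d, f (D.arc d) = if IsOver d.2 then φ d else φ (d.1, d.2 + 1)) ∧
      (∀ e, (∀ d, D.arc d ≠ e) → f e = z e) ∧ Resp (D.StateStep fun _ => 1) f := by
  obtain ⟨f, h1, h2⟩ := exists_descent D.mate
    (fun d => if IsOver d.2 then φ d else φ (d.1, d.2 + 1)) (fun d => by
      by_cases hd : IsOver d.2
      · rw [if_pos hd, if_neg (by rw [h.isOver_oppEnd]; simpa using hd), face_oppEnd_add_one hφ]
      · rw [if_neg hd, if_pos (by rw [h.isOver_oppEnd]; exact hd), resp_faceStep.1 hφ]) z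
  refine ⟨f, h1, h2, (resp_stateStep D).2 fun c => ?_⟩
  have o : ¬ IsOver 0 ∧ IsOver 1 ∧ ¬ IsOver 2 ∧ IsOver 3 := by unfold IsOver; decide
  change f (D.arc (c, 0)) = f (D.arc (c, 1)) ∧ f (D.arc (c, 2)) = f (D.arc (c, 3))
  simp only [h1, o, if_true, if_false]
  exact ⟨rfl, rfl⟩

open Classical in
theorem Alternating.exists_minus (h : D.Alternating) {β : Type*} {φ : D.X × ZMod 4 → β}
    (hφ : Resp D.FaceStep φ) (z : D.E → β) :
    ∃ f : D.E → β, (∀ d, f (D.arc d) = if IsOver d.2 then φ (d.1, d.2 + 1) else φ d) ∧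
      (∀ e, (∀ d, D.arc d ≠ e) → f e = z e) ∧ Resp (D.StateStep fun _ => -1) f := by
  obtain ⟨f, h1, h2⟩ := exists_descent D.mate
    (fun d => if IsOver d.2 then φ (d.1, d.2 + 1) else φ d) (fun d => by
      by_cases hd : IsOver d.2
      · rw [if_pos hd, if_neg (by rw [h.isOver_oppEnd]; simpa using hd), resp_faceStep.1 hφ]
      · rw [if_neg hd, if_pos (by rw [h.isOver_oppEnd]; exact hd), face_oppEnd_add_one hφ]) z
  refine ⟨f, h1, h2, (resp_stateStep D).2 fun c => ?_⟩
  have o : ¬ IsOver 0 ∧ IsOver 1 ∧ ¬ IsOver 2 ∧ IsOver 3 := by unfold IsOver; decide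
  change f (D.arc (c, 1)) = f (D.arc (c, 2)) ∧ f (D.arc (c, 3)) = f (D.arc (c, 0))
  simp only [h1, o, if_true, if_false]
  exact ⟨rfl, rfl⟩

/-- Planarity writes a cycle as the difference of a face function across each arc. One side is
constant along + circles, the other along - circles, so the two subspaces span. -/
theorem Alternating.stateCircles_add (h : D.Alternating) :
    D.stateCircles (fun _ => 1) + D.stateCircles (fun _ => -1) = D.crossings + 2 * D.comps := by
  classical
  rw [stateCircles_add_eq_iff]
  refine le_antisymm (sup_le (D.resp_const_le_cycles 1) (D.resp_const_le_cycles (-1)))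
    fun z hz => ?_
  obtain ⟨φ, hφ, hz'⟩ := exists_face_function hz
  obtain ⟨f, f1, f2, f3⟩ := h.exists_plus hφ z
  obtain ⟨g, g1, g2, g3⟩ := h.exists_minus hφ 0
  rw [Submodule.mem_sup]
  refine ⟨f, f3, g, g3, funext fun e => ?_⟩
  by_cases he : ∀ d, D.arc d ≠ e
  · rw [Pi.add_apply, f2 e he, g2 e he]; simp
  · push Not at he
    obtain ⟨d, rfl⟩ := he
    rw [Pi.add_apply, f1, g1, hz']
    split_ifs
    exacts [rfl, add_comm _ _]

/-- If both arcs at `c` lay on one + circle, the face function of the corner 1 would put the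
opposite corner 3 in the same face, and `c` would be nugatory. -/
theorem Alternating.adequate_one (h : D.Alternating) (hr : D.Reduced) : D.Adequate 1 := by
  classical
  intro c hc
  obtain ⟨f, f1, -, f3⟩ := h.exists_plus (resp_eqvGen D.FaceStep (c, 1)) fun _ => True
  have h1 := f3.eqvGen hc
  have o : ¬ IsOver 0 ∧ ¬ IsOver 2 := by unfold IsOver; decide
  change f (D.arc (c, 0)) = f (D.arc (c, 2)) at h1
  rw [f1, f1, if_neg o.1, if_neg o.2] at h1
  refine hr c ⟨1, ?_⟩
  change Relation.EqvGen D.FaceStep (c, 1) (c, 2 + 1)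
  rw [← h1]
  exact .refl _

theorem Alternating.adequate_neg_one (h : D.Alternating) (hr : D.Reduced) :
    D.Adequate (-1) := by
  classical
  intro c hc
  obtain ⟨f, f1, -, f3⟩ := h.exists_minus (resp_eqvGen D.FaceStep (c, 2)) fun _ => True
  have h1 := f3.eqvGen hc
  have o : IsOver 1 ∧ IsOver 3 := by unfold IsOver; decide
  change f (D.arc (c, 1)) = f (D.arc (c, 3)) at h1
  rw [f1, f1, if_pos o.1, if_pos o.2] at h1
  refine hr c ⟨2, ?_⟩
  change Relation.EqvGen D.FaceStep (c, 2) (c, 3 + 1)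
  rw [← h1]
  exact .refl _

/-! ### Span and crossing number of reduced alternating diagrams. -/

theorem polySpan_bracket_of_reduced (h : D.Alternating) (hr : D.Reduced) :
    polySpan D.bracket = 4 * (D.crossings : ℤ) + 4 * D.comps - 4 := by
  rw [polySpan_bracket_of_adequate (h.adequate_one hr) (h.adequate_neg_one hr)]
  have := h.stateCircles_add
  unfold extremeDegree
  omega

theorem polySpan_bracket_le' (D : LinkDiagram) :
    polySpan D.bracket ≤ 4 * (D.crossings : ℤ) + 4 * D.comps - 4 := by
  have := D.polySpan_bracket_le
  have := D.stateCircles_add_le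
  unfold extremeDegree at *
  omega

/-- 4n + 4k - 4 = span ≤ 4n' + 4k' - 4, and k' ≤ k by the divisibility by δ. -/
theorem crossings_le_of_reduced {D' : LinkDiagram} (h : D.Alternating) (hr : D.Reduced)
    (hL : D'.toLink = D.toLink) : D.crossings ≤ D'.crossings := by
  have h1 := polySpan_bracket_of_reduced h hr
  have h2 := D'.polySpan_bracket_le'
  have h3 := comps_le_of_toLink_eq hL h.stateCircles_add
  rw [(bracket_unitEquiv hL).polySpan_eq] at h2
  omega

/-! ### Two-edge cuts in nonalternating diagrams -/

/-- The even corner at which the end `d` is smoothed with the marker `-1`. -/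
noncomputable def minusCorner (d : D.X × ZMod 4) : D.X × ZMod 4 :=
  open Classical in if IsOver d.2 then (d.1, d.2 + 1) else d

/-- The two corners lie on opposite sides of the arc if its ends have the same height, and in the
same face otherwise. -/
theorem minusCorner_add {φ : D.X × ZMod 4 → ZMod 2} (hφ : Resp D.FaceStep φ)
    {f : D.E → ZMod 2} (hf : ∀ d, f (D.arc d) = φ d + φ (d.1, d.2 + 1)) (d : D.X × ZMod 4) :
    φ (minusCorner d) + φ (minusCorner (oppEnd D.mate d)) =
      open Classical in if IsOver d.2 ↔ IsOver (oppEnd D.mate d).2 then f (D.arc d) else 0 := by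
  have h1 := resp_faceStep.1 hφ d
  have h2 := face_oppEnd_add_one hφ d
  rw [hf]
  unfold minusCorner
  by_cases ha : IsOver d.2 <;> by_cases hb : IsOver (oppEnd D.mate d).2 <;>
    simp only [ha, hb, if_true, if_false, iff_true, iff_false, not_true, h1, h2]
  · exact add_comm _ _
  · exact CharTwo.add_self_eq_zero _
  · exact CharTwo.add_self_eq_zero _

/-- The + circle through a nonalternating arc bounds a set of faces, and the - circle changes sides
exactly at the nonalternating arcs they share. A closed curve changes sides an even number of times,
so this arc cannot be the only common one. -/
theorem exists_common_arc {d₀ : D.X × ZMod 4}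
    (h₀ : IsOver d₀.2 ↔ IsOver (oppEnd D.mate d₀).2) :
    ∃ d₁, D.arc d₁ ≠ D.arc d₀ ∧
      Relation.EqvGen (D.StateStep fun _ => 1) (D.arc d₀) (D.arc d₁) ∧
      Relation.EqvGen (D.StateStep fun _ => -1) (D.arc d₀) (D.arc d₁) := by
  classical
  by_contra! H
  let f : D.E → ZMod 2 := fun e =>
    if Relation.EqvGen (D.StateStep fun _ => 1) (D.arc d₀) e then 1 else 0
  let g : D.E → ZMod 2 := fun e =>
    if Relation.EqvGen (D.StateStep fun _ => -1) (D.arc d₀) e then 1 else 0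
  have hf : Resp (D.StateStep fun _ => 1) f := fun x y hxy => by
    simp only [f, resp_eqvGen _ (D.arc d₀) x y hxy]
  have hg : Resp (D.StateStep fun _ => -1) g := fun x y hxy => by
    simp only [g, resp_eqvGen _ (D.arc d₀) x y hxy]
  obtain ⟨φ, hφ, hφf⟩ := exists_face_function (D.resp_const_le_cycles 1 hf)
  -- Summed by crossings: ends joined by the marker -1 have the same `g` and the same corner.
  have s1 : ∑ d, g (D.arc d) * φ (minusCorner d) = 0 := by
    rw [Fintype.sum_prod_type]
    refine Finset.sum_eq_zero fun c _ => ?_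
    have hc := (resp_stateStep D).1 hg c
    change g (D.arc (c, 1)) = g (D.arc (c, 2)) ∧ g (D.arc (c, 3)) = g (D.arc (c, 0)) at hc
    have o : ¬ IsOver 0 ∧ IsOver 1 ∧ ¬ IsOver 2 ∧ IsOver 3 := by unfold IsOver; decide
    rw [sum_zmod4 _ 1]
    change g (D.arc (c, 1)) * φ (minusCorner (c, 1)) + g (D.arc (c, 2)) * φ (minusCorner (c, 2)) +
      (g (D.arc (c, 3)) * φ (minusCorner (c, 3)) + g (D.arc (c, 0)) * φ (minusCorner (c, 0))) = 0
    unfold minusCorner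
    simp only [o, if_true, if_false, hc.1, hc.2]
    change g (D.arc (c, 2)) * φ (c, 2) + g (D.arc (c, 2)) * φ (c, 2) +
      (g (D.arc (c, 0)) * φ (c, 0) + g (D.arc (c, 0)) * φ (c, 0)) = 0
    rw [CharTwo.add_self_eq_zero, CharTwo.add_self_eq_zero, add_zero]
  -- Summed by arcs: only the arc at `d₀` would contribute, and the correction at `d₀` cancels it.
  have s2 : ∑ d, (g (D.arc d) * φ (minusCorner d) + if d = d₀ then 1 else 0) = 0 := by
    refine sum_ends_eq_zero D.mate _ fun d => ?_
    rw [arc_oppEnd D.mate, add_add_add_comm, ← mul_add, minusCorner_add hφ hφf]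
    by_cases hd : D.arc d = D.arc d₀
    · have h1 : f (D.arc d₀) = 1 := if_pos (.refl _)
      have h2 : g (D.arc d₀) = 1 := if_pos (.refl _)
      rw [hd, h1, h2]
      rcases (arc_eq_arc_iff D.mate).1 hd with rfl | rfl
      · rw [if_pos h₀, if_pos rfl, if_neg (oppEnd_ne D.mate d)]
        decide
      · rw [oppEnd_oppEnd, if_pos h₀.symm, if_pos rfl, if_neg (oppEnd_ne D.mate d₀)]
        decide
    · have h1 : d ≠ d₀ := fun h => hd (by rw [h])
      have h2 : oppEnd D.mate d ≠ d₀ := fun h => hd (by rw [← h, arc_oppEnd D.mate])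
      rw [if_neg h1, if_neg h2, add_zero, add_zero]
      by_cases hp : Relation.EqvGen (D.StateStep fun _ => 1) (D.arc d₀) (D.arc d)
      · have : g (D.arc d) = 0 := if_neg (H d hd hp)
        rw [this, zero_mul]
      · have : f (D.arc d) = 0 := if_neg hp
        rw [this, ite_self, mul_zero]
  rw [Finset.sum_add_distrib, s1, zero_add, Finset.sum_ite_eq' , if_pos (Finset.mem_univ _)] at s2
  exact one_ne_zero s2

/-- The arcs ending at `a` and `b` are the only ones between the crossings in `S` and the others;
`a` and `b` are their ends in `S`. -/
structure IsCut (D : LinkDiagram) (S : D.X → Prop) (a b : D.X × ZMod 4) : Prop where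
  left_mem : S a.1
  right_mem : S b.1
  left_opp : ¬ S (oppEnd D.mate a).1
  right_opp : ¬ S (oppEnd D.mate b).1
  arc_ne : D.arc a ≠ D.arc b
  closed : ∀ d, S d.1 → d ≠ a → d ≠ b → S (oppEnd D.mate d).1

theorem IsCut.swap {S : D.X → Prop} {a b : D.X × ZMod 4} (h : D.IsCut S a b) : D.IsCut S b a :=
  ⟨h.2, h.1, h.4, h.3, h.5.symm, fun d h1 h2 h3 => h.6 d h1 h3 h2⟩

theorem IsCut.compl {S : D.X → Prop} {a b : D.X × ZMod 4} (h : D.IsCut S a b) :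
    D.IsCut (fun c => ¬ S c) (oppEnd D.mate a) (oppEnd D.mate b) where
  left_mem := h.left_opp
  right_mem := h.right_opp
  left_opp := by rw [oppEnd_oppEnd]; simpa using h.left_mem
  right_opp := by rw [oppEnd_oppEnd]; simpa using h.right_mem
  arc_ne := by rw [arc_oppEnd D.mate, arc_oppEnd D.mate]; exact h.arc_ne
  closed := fun d hd h1 h2 h3 => by
    refine hd ?_
    have := h.closed _ h3 (fun e => h1 (by rw [← e, oppEnd_oppEnd]))
      fun e => h2 (by rw [← e, oppEnd_oppEnd])
    rwa [oppEnd_oppEnd] at this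

/-- The functional z ↦ z x + z y vanishes on the kernel of the boundary map, so it factors through
that map; `u` is the resulting potential on crossings. -/
theorem exists_cut_function {x y : D.E} (h : ∀ z ∈ cycles D.arc, z x = z y) :
    ∃ u : D.X → ZMod 2, ∀ d, u d.1 + u (oppEnd D.mate d).1 =
      (if D.arc d = x then 1 else 0) + if D.arc d = y then 1 else 0 := by
  let ψ : Module.Dual (ZMod 2) (D.E → ZMod 2) := (LinearMap.proj x : (D.E → ZMod 2) →ₗ[ZMod 2] ZMod 2) +
    (LinearMap.proj y : (D.E → ZMod 2) →ₗ[ZMod 2] ZMod 2)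
  have hψ : ψ ∈ LinearMap.range (bdry D.arc).dualMap := by
    rw [LinearMap.range_dualMap_eq_dualAnnihilator_ker, Submodule.mem_dualAnnihilator]
    intro z hz
    exact zmod_two_add_eq_zero.2 (h z hz)
  obtain ⟨ξ, hξ⟩ := hψ
  refine ⟨fun c => ξ (Pi.single c 1), fun d => ?_⟩
  have h1 := congrArg (fun η => η (Pi.single (D.arc d) 1)) hξ
  simp only [LinearMap.dualMap_apply, ψ, LinearMap.add_apply, LinearMap.proj_apply] at h1
  rw [← sum_fiber D.mate fun d => ξ (Pi.single d.1 1)]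
  rw [Pi.single_apply, Pi.single_apply] at h1
  simp only [eq_comm (a := x), eq_comm (a := y)] at h1
  rw [← h1, LinearMap.pi_apply_eq_sum_univ ξ, Fintype.sum_prod_type]
  refine Finset.sum_congr rfl fun c _ => ?_
  rw [bdry_apply, Finset.sum_smul]
  refine Finset.sum_congr rfl fun i _ => ?_
  rw [Pi.single_apply]
  have : (fun j => if c = j then (1 : ZMod 2) else 0) = Pi.single c 1 := by
    ext j; simp [Pi.single_apply, eq_comm]
  rw [this]
  split_ifs <;> simp

theorem exists_isCut (hD : ¬ D.Alternating)
    (h : D.stateCircles (fun _ => 1) + D.stateCircles (fun _ => -1) =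
      D.crossings + 2 * D.comps) :
    ∃ (S : D.X → Prop) (a b : D.X × ZMod 4), D.IsCut S a b ∧
      ∃ z ∈ cycles D.arc, z (D.arc a) = 1 ∧ z (D.arc b) = 1 := by
  classical
  obtain ⟨d₀, h₀⟩ : ∃ d₀ : D.X × ZMod 4, IsOver d₀.2 ↔ IsOver (oppEnd D.mate d₀).2 := by
    unfold Alternating at hD
    push Not at hD
    obtain ⟨d, d', hne, he, h⟩ := hD
    refine ⟨d, ?_⟩
    rw [← eq_oppEnd D.mate hne.symm he.symm]
    rcases h with h | h <;> simp [h]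
  obtain ⟨d₁, hd, h1, h2⟩ := exists_common_arc h₀
  rw [stateCircles_add_eq_iff] at h
  obtain ⟨u, hu⟩ := exists_cut_function (x := D.arc d₀) (y := D.arc d₁) fun z hz => by
    -- In the equality case a cycle is a + part plus a - part, and each part agrees on the two arcs
    -- because they share both circles.
    rw [← h, Submodule.mem_sup] at hz
    obtain ⟨p, hp, q, hq, rfl⟩ := hz
    rw [Pi.add_apply, Pi.add_apply, Resp.eqvGen hp h1, Resp.eqvGen hq h2]
  have two : ∀ t : ZMod 2, t = 0 ∨ t = 1 := by decide
  have pick : ∀ d, D.arc d = D.arc d₀ ∨ D.arc d = D.arc d₁ →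
      ∃ a, D.arc a = D.arc d ∧ u a.1 = 0 ∧ u (oppEnd D.mate a).1 = 1 := by
    intro d hd'
    have h3 : u d.1 + u (oppEnd D.mate d).1 = 1 := by
      rw [hu]
      rcases hd' with h | h
      · rw [h, if_pos rfl, if_neg hd.symm, add_zero]
      · rw [h, if_pos rfl, if_neg hd, zero_add]
    rcases two (u d.1) with h4 | h4
    · exact ⟨d, rfl, h4, by rwa [h4, zero_add] at h3⟩
    · refine ⟨oppEnd D.mate d, arc_oppEnd D.mate d, ?_, by rwa [oppEnd_oppEnd]⟩
      rw [h4] at h3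
      exact left_eq_add.1 h3.symm
  obtain ⟨a, ha, ha0, ha1⟩ := pick d₀ (.inl rfl)
  obtain ⟨b, hb, hb0, hb1⟩ := pick d₁ (.inr rfl)
  refine ⟨fun c => u c = 0, a, b, ⟨ha0, hb0, by simp [ha1], by simp [hb1], ?_, ?_⟩, ?_⟩
  · rw [ha, hb]; exact hd.symm
  · intro d hd0 hda hdb
    have h3 := hu d
    rw [hd0, zero_add] at h3
    rw [h3, ← ha, ← hb]
    have key : ∀ a, u a.1 = 0 → u (oppEnd D.mate a).1 = 1 → d ≠ a → D.arc d ≠ D.arc a := by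
      intro a ha0 ha1 hne he
      rw [eq_oppEnd D.mate hne he, ha1] at hd0
      exact one_ne_zero hd0
    rw [if_neg (key a ha0 ha1 hda), if_neg (key b hb0 hb1 hdb), add_zero]
  -- The common + circle is a cycle through both cut arcs; it will be needed for planarity of the
  -- halves.
  · refine ⟨fun e => if Relation.EqvGen (D.StateStep fun _ => 1) (D.arc d₀) e then 1 else 0,
      D.resp_const_le_cycles 1 fun x y hxy => ?_, ?_, ?_⟩
    · simp only [resp_eqvGen _ (D.arc d₀) x y hxy]
    · rw [ha]; exact if_pos (.refl _)
    · rw [hb]; exact if_pos h1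

end LinkDiagram

namespace LinkDiagram

variable {D : LinkDiagram} {S : D.X → Prop} {a b : D.X × ZMod 4}

/-! ### Cutting a diagram along two arcs -/

theorem IsCut.arc_eq_left (h : D.IsCut S a b) {d : D.X × ZMod 4} (hd : S d.1)
    (he : D.arc d = D.arc a) : d = a := by
  rcases (arc_eq_arc_iff D.mate).1 he with h' | h'
  · exact h'
  · exact absurd (h' ▸ hd) h.left_opp

theorem IsCut.arc_eq_right (h : D.IsCut S a b) {d : D.X × ZMod 4} (hd : S d.1)
    (he : D.arc d = D.arc b) : d = b := h.swap.arc_eq_left hd he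

open Classical in
/-- The terms at the two ends of the same arc of the part on `S` cancel. -/
theorem IsCut.sum_eq (h : D.IsCut S a b) {M : Type*} [AddCommGroup M] (f : D.X × ZMod 4 → M)
    (hf : ∀ d, f (oppEnd D.mate d) = -f d) : ∑ d, (if S d.1 then f d else 0) = f a + f b := by
  have ab : a ≠ b := fun e => h.arc_ne (by rw [e])
  have h2 : ∑ d, ((if S d.1 then f d else 0) -
      ((if d = a then f a else 0) + if d = b then f b else 0)) = 0 := by
    refine sum_ends_eq_zero D.mate _ fun d => ?_
    have key : ∀ d, S d.1 → (if S d.1 then f d else 0) -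
        ((if d = a then f a else 0) + if d = b then f b else 0) +
        ((if S (oppEnd D.mate d).1 then f (oppEnd D.mate d) else 0) -
        ((if oppEnd D.mate d = a then f a else 0) +
          if oppEnd D.mate d = b then f b else 0)) = 0 := by
      intro d hd
      have o1 : oppEnd D.mate d ≠ a := fun e => h.left_opp (by rw [← e, oppEnd_oppEnd]; exact hd)
      have o2 : oppEnd D.mate d ≠ b := fun e => h.right_opp (by rw [← e, oppEnd_oppEnd]; exact hd)
      rw [if_pos hd, if_neg o1, if_neg o2]
      by_cases hda : d = a
      · subst hda
        rw [if_neg h.left_opp, if_pos rfl, if_neg ab]; simp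
      · by_cases hdb : d = b
        · subst hdb
          rw [if_neg h.right_opp, if_pos rfl, if_neg hda]; simp
        · rw [if_pos (h.closed d hd hda hdb), if_neg hda, if_neg hdb, hf]; simp
    by_cases hd : S d.1
    · exact key d hd
    · by_cases hd' : S (oppEnd D.mate d).1
      · have := key _ hd'
        rw [oppEnd_oppEnd] at this
        rw [add_comm]; exact this
      · have n1 : d ≠ a := fun e => hd (e ▸ h.left_mem)
        have n2 : d ≠ b := fun e => hd (e ▸ h.right_mem)
        have n3 : oppEnd D.mate d ≠ a := fun e => hd' (e ▸ h.left_mem)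
        have n4 : oppEnd D.mate d ≠ b := fun e => hd' (e ▸ h.right_mem)
        rw [if_neg hd, if_neg hd', if_neg n1, if_neg n2, if_neg n3, if_neg n4]; simp
  rw [Finset.sum_sub_distrib, Finset.sum_add_distrib, Finset.sum_ite_eq', Finset.sum_ite_eq',
    if_pos (Finset.mem_univ _), if_pos (Finset.mem_univ _)] at h2
  exact sub_eq_zero.1 h2

/-- The two ends `a`, `b` of the cut lie on a common face. -/
theorem IsCut.sameFace (h : D.IsCut S a b)
    (ha : ¬ D.SameFace a (a.1, a.2 + 1)) : D.SameFace (a.1, a.2 + 1) b := by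
  classical
  by_contra hb
  -- The sum of `χ d - χ (oppEnd D.mate d)` over `S` vanishes at each crossing and reduces to the
  -- two cut arcs. Integer values are essential: modulo two the contribution at `oppEnd D.mate b`
  -- could cancel the one at `a`.
  let χ : D.X × ZMod 4 → ℤ := fun d => if D.SameFace (a.1, a.2 + 1) d then 1 else 0
  have hχ : Resp D.FaceStep χ := fun x y hxy => by
    have e : D.SameFace (a.1, a.2 + 1) x = D.SameFace (a.1, a.2 + 1) y :=
      resp_eqvGen D.FaceStep (a.1, a.2 + 1) x y hxy
    simp only [χ, e]
  have h1 : ∑ d, (if S d.1 then χ d - χ (oppEnd D.mate d) else 0) = 0 := by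
    rw [Fintype.sum_prod_type]
    refine Finset.sum_eq_zero fun c _ => ?_
    by_cases hc : S c
    · simp only [hc, if_true, resp_faceStep.1 hχ]
      have := Equiv.sum_comp (Equiv.addRight (1 : ZMod 4)) fun i => χ (c, i)
      simp only [Equiv.coe_addRight] at this
      rw [Finset.sum_sub_distrib, this, sub_self]
    · simp [hc]
  have h2 := h.sum_eq (fun d => χ d - χ (oppEnd D.mate d))
    fun d => by rw [oppEnd_oppEnd, neg_sub]
  have c1 : χ (oppEnd D.mate a) = 1 := by
    rw [resp_faceStep.1 hχ]; exact if_pos (.refl _)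
  have c2 : χ a = 0 := if_neg fun e => ha (e.symm _ _)
  have c3 : χ b = 0 := if_neg hb
  have c4 : 0 ≤ χ (oppEnd D.mate b) := by
    simp only [χ]; split_ifs <;> simp
  rw [h1, c1, c2, c3] at h2
  omega

/-- The arcs of the part of the diagram on `S`, the arcs at `a` and `b` being joined. -/
def IsCut.HalfArc (_ : D.IsCut S a b) : Type :=
  {x : D.E // (∃ d, S d.1 ∧ D.arc d = x) ∧ x ≠ D.arc b}

/-- The incidence map of the part of the diagram on `S`. -/
def IsCut.halfArc (h : D.IsCut S a b) (p : {c // S c} × ZMod 4) : h.HalfArc :=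
  if hp : D.arc (p.1.1, p.2) = D.arc b then ⟨D.arc a, ⟨a, h.left_mem, rfl⟩, h.arc_ne⟩
  else ⟨D.arc (p.1.1, p.2), ⟨(p.1.1, p.2), p.1.2, rfl⟩, hp⟩

/-- An end in the part of the diagram on `S`. -/
def IsCut.restrict (_ : D.IsCut S a b) (d : D.X × ZMod 4) (hd : S d.1) : {c // S c} × ZMod 4 :=
  (⟨d.1, hd⟩, d.2)

/-- The joined arc. -/
def IsCut.joint (h : D.IsCut S a b) : h.HalfArc := ⟨D.arc a, ⟨a, h.left_mem, rfl⟩, h.arc_ne⟩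

theorem IsCut.halfArc_left (h : D.IsCut S a b) (hd : S a.1) :
    h.halfArc (h.restrict a hd) = h.joint :=
  dif_neg h.arc_ne

theorem IsCut.halfArc_right (h : D.IsCut S a b) (hd : S b.1) :
    h.halfArc (h.restrict b hd) = h.joint :=
  dif_pos rfl

theorem IsCut.halfArc_val (h : D.IsCut S a b) {d : D.X × ZMod 4} (hd : S d.1) (hb : d ≠ b) :
    (h.halfArc (h.restrict d hd)).1 = D.arc d := by
  have : ¬ D.arc d = D.arc b := fun e => hb (h.arc_eq_right hd e)
  exact congrArg Subtype.val (dif_neg this)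

theorem IsCut.halfArc_eq_joint (h : D.IsCut S a b) {d : D.X × ZMod 4} (hd : S d.1)
    (he : h.halfArc (h.restrict d hd) = h.joint) : d = a ∨ d = b := by
  by_cases hb : d = b
  · exact .inr hb
  · refine .inl (h.arc_eq_left hd ?_)
    rw [← h.halfArc_val hd hb, he]
    rfl

theorem IsCut.halfArc_mate (h : D.IsCut S a b) (p : {c // S c} × ZMod 4) :
    ∃! p', p' ≠ p ∧ h.halfArc p' = h.halfArc p := by
  obtain ⟨⟨c, hc⟩, i⟩ := p
  have ab : a ≠ b := fun e => h.arc_ne (by rw [e])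
  by_cases hA : ((c, i) : D.X × ZMod 4) = a
  · subst hA
    refine ⟨h.restrict b h.right_mem, ⟨fun e => ab ?_, ?_⟩, ?_⟩
    · exact (congrArg (fun p : {c // S c} × ZMod 4 => (p.1.1, p.2)) e).symm
    · rw [h.halfArc_right]; exact (h.halfArc_left hc).symm
    · rintro ⟨⟨c', hc'⟩, j⟩ ⟨hne, he⟩
      rcases h.halfArc_eq_joint (d := (c', j)) hc' (he.trans (h.halfArc_left hc)) with h' | h'
      · obtain ⟨rfl, rfl⟩ := Prod.ext_iff.1 h'
        exact absurd rfl hne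
      · subst h'; rfl
  · by_cases hB : ((c, i) : D.X × ZMod 4) = b
    · subst hB
      refine ⟨h.restrict a h.left_mem, ⟨fun e => ab ?_, ?_⟩, ?_⟩
      · exact congrArg (fun p : {c // S c} × ZMod 4 => (p.1.1, p.2)) e
      · rw [h.halfArc_left]; exact (h.halfArc_right hc).symm
      · rintro ⟨⟨c', hc'⟩, j⟩ ⟨hne, he⟩
        rcases h.halfArc_eq_joint (d := (c', j)) hc' (he.trans (h.halfArc_right hc)) with h' | h'
        · subst h'; rfl
        · obtain ⟨rfl, rfl⟩ := Prod.ext_iff.1 h'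
          exact absurd rfl hne
    · have ho := h.closed (c, i) hc hA hB
      have hoB : oppEnd D.mate (c, i) ≠ b := fun e => h.right_opp (by
        rw [← e, oppEnd_oppEnd]; exact hc)
      refine ⟨h.restrict _ ho, ⟨fun e => oppEnd_ne D.mate (c, i) ?_, Subtype.ext ?_⟩, ?_⟩
      · exact congrArg (fun p : {c // S c} × ZMod 4 => (p.1.1, p.2)) e
      · rw [h.halfArc_val ho hoB, arc_oppEnd D.mate]
        exact (h.halfArc_val (d := (c, i)) hc hB).symm
      · rintro ⟨⟨c', hc'⟩, j⟩ ⟨hne, he⟩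
        have hv := congrArg Subtype.val he
        have hv1 := h.halfArc_val (d := (c, i)) hc hB
        have hB' : ((c', j) : D.X × ZMod 4) ≠ b := by
          rintro rfl
          have := h.halfArc_right hc'
          have h3 : (h.halfArc (⟨c', hc'⟩, j)) = h.joint := this
          rcases h.halfArc_eq_joint (d := (c, i)) hc (he.symm.trans h3) with h' | h'
          exacts [hA h', hB h']
        have hv2 := h.halfArc_val (d := (c', j)) hc' hB'
        have hv3 : D.arc (c', j) = D.arc (c, i) := hv2.symm.trans (hv.trans hv1)
        have := eq_oppEnd D.mate (d := (c, i)) (d' := (c', j)) (fun e => hne (by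
          obtain ⟨rfl, rfl⟩ := Prod.ext_iff.1 e; rfl)) hv3
        obtain ⟨h1, h2⟩ := Prod.ext_iff.1 this
        exact Prod.ext (Subtype.ext h1) h2

theorem IsCut.oppEnd_restrict (h : D.IsCut S a b) (d : D.X × ZMod 4) (hd : S d.1) :
    (d = a ∧ oppEnd h.halfArc_mate (h.restrict d hd) = h.restrict b h.right_mem) ∨
    (d = b ∧ oppEnd h.halfArc_mate (h.restrict d hd) = h.restrict a h.left_mem) ∨
    ∃ ho : S (oppEnd D.mate d).1,
      oppEnd h.halfArc_mate (h.restrict d hd) = h.restrict (oppEnd D.mate d) ho := by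
  have ab : a ≠ b := fun e => h.arc_ne (by rw [e])
  by_cases hA : d = a
  · subst hA
    refine .inl ⟨rfl, (eq_oppEnd h.halfArc_mate ?_ ?_).symm⟩
    · exact fun e => ab (congrArg (fun p : {c // S c} × ZMod 4 => (p.1.1, p.2)) e).symm
    · rw [h.halfArc_right, h.halfArc_left]
  · by_cases hB : d = b
    · subst hB
      refine .inr (.inl ⟨rfl, (eq_oppEnd h.halfArc_mate ?_ ?_).symm⟩)
      · exact fun e => ab (congrArg (fun p : {c // S c} × ZMod 4 => (p.1.1, p.2)) e)
      · rw [h.halfArc_right, h.halfArc_left]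
    · have ho := h.closed d hd hA hB
      have hoB : oppEnd D.mate d ≠ b := fun e => h.right_opp (by
        rw [← e, oppEnd_oppEnd]; exact hd)
      refine .inr (.inr ⟨ho, (eq_oppEnd h.halfArc_mate ?_ (Subtype.ext ?_)).symm⟩)
      · exact fun e => oppEnd_ne D.mate d
          (congrArg (fun p : {c // S c} × ZMod 4 => (p.1.1, p.2)) e)
      · rw [h.halfArc_val ho hoB, arc_oppEnd D.mate, h.halfArc_val hd hB]

/-- Functions on the arcs of the two parts that agree on the joined arcs come from a function on
the arcs of the diagram. -/
theorem IsCut.exists_extension (h : D.IsCut S a b) {β : Type*} (f : h.HalfArc → β)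
    (g : h.compl.HalfArc → β) (hfg : f h.joint = g h.compl.joint) (z : D.E → β) :
    ∃ k : D.E → β, (∀ d (hd : S d.1), k (D.arc d) = f (h.halfArc (h.restrict d hd))) ∧
      (∀ d (hd : ¬ S d.1), k (D.arc d) = g (h.compl.halfArc (h.compl.restrict d hd))) := by
  classical
  let F : D.X × ZMod 4 → β := fun d =>
    if hd : S d.1 then f (h.halfArc (h.restrict d hd))
    else g (h.compl.halfArc (h.compl.restrict d hd))
  have F1 : ∀ d (hd : S d.1), F d = f (h.halfArc (h.restrict d hd)) := fun d hd => dif_pos hd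
  have F2 : ∀ d (hd : ¬ S d.1), F d = g (h.compl.halfArc (h.compl.restrict d hd)) :=
    fun d hd => dif_neg hd
  have step : ∀ d, S d.1 → F (oppEnd D.mate d) = F d := by
    intro d hd
    by_cases hA : d = a
    · subst hA
      rw [F1 _ hd, F2 _ h.left_opp, h.halfArc_left, hfg, h.compl.halfArc_left]
    · by_cases hB : d = b
      · subst hB
        rw [F1 _ hd, F2 _ h.right_opp, h.halfArc_right, hfg, h.compl.halfArc_right]
      · have ho := h.closed d hd hA hB
        rw [F1 _ hd, F1 _ ho]
        have hoB : oppEnd D.mate d ≠ b := fun e => h.right_opp (by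
          rw [← e, oppEnd_oppEnd]; exact hd)
        congr 1
        refine Subtype.ext ?_
        rw [h.halfArc_val ho hoB, arc_oppEnd D.mate, h.halfArc_val hd hB]
  have hF : ∀ d, F (oppEnd D.mate d) = F d := by
    intro d
    by_cases hd : S d.1
    · exact step d hd
    · by_cases ho : S (oppEnd D.mate d).1
      · have := step _ ho
        rw [oppEnd_oppEnd] at this
        exact this.symm
      · rw [F2 _ hd, F2 _ ho]
        have n1 : ∀ d, ¬ S d.1 → ¬ S (oppEnd D.mate d).1 → d ≠ oppEnd D.mate b := by
          rintro _ - h2 rfl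
          rw [oppEnd_oppEnd] at h2
          exact h2 h.right_mem
        congr 1
        refine Subtype.ext ?_
        rw [h.compl.halfArc_val ho (n1 _ ho (by rwa [oppEnd_oppEnd])), arc_oppEnd D.mate,
          h.compl.halfArc_val hd (n1 _ hd ho)]
  obtain ⟨k, hk, -⟩ := exists_descent D.mate F hF z
  exact ⟨k, fun d hd => by rw [hk, F1], fun d hd => by rw [hk, F2]⟩

instance (h : D.IsCut S a b) : Finite h.HalfArc := Subtype.finite

/-- By `planar_iff` a cycle of the half must be a sum of face boundaries. It is continued to a cycle
of `D`, whose face function is then restricted to `S`. -/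
theorem IsCut.half_planar (h : D.IsCut S a b) [Fintype {c // S c}] {z : D.E → ZMod 2}
    (hz : z ∈ cycles D.arc) (ha : z (D.arc a) = 1) (hb : z (D.arc b) = 1) :
    Nat.card (Quot (FaceRel h.halfArc)) =
      Fintype.card {c // S c} + 2 * ncomp (CrossingStep h.halfArc) := by
  classical
  have : Fintype h.HalfArc := Fintype.ofFinite _
  rw [planar_iff h.halfArc_mate]
  intro w hw
  -- Outside `S` the continuation follows `z`, which is 1 on both cut arcs, scaled by the value of
  -- `w` on the joint.
  obtain ⟨k, k1, k2⟩ := h.exists_extension w (fun x => w h.joint * z x.1) (by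
    change _ = _ * z (D.arc (oppEnd D.mate a))
    rw [arc_oppEnd D.mate, ha, mul_one]) 0
  have kz : ∀ d, ¬ S d.1 → k (D.arc d) = w h.joint * z (D.arc d) := by
    intro d hd
    rw [k2 d hd]
    by_cases hdb : d = oppEnd D.mate b
    · subst hdb
      rw [h.compl.halfArc_right]
      change _ * z (D.arc (oppEnd D.mate a)) = _
      rw [arc_oppEnd D.mate, arc_oppEnd D.mate, ha, hb]
    · rw [h.compl.halfArc_val hd hdb]
  have hk : k ∈ cycles D.arc := by
    rw [mem_cycles] at hz hw ⊢
    intro c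
    by_cases hc : S c
    · rw [← hw ⟨c, hc⟩]
      exact Finset.sum_congr rfl fun i _ => k1 (c, i) hc
    · rw [Finset.sum_congr rfl fun i _ => kz (c, i) hc, ← Finset.mul_sum, hz, mul_zero]
  obtain ⟨φ, hφ, hk'⟩ := exists_face_function hk
  obtain ⟨φ₀, hφ₀, hz'⟩ := exists_face_function hz
  -- A cycle through an arc separates the faces on its two sides.
  have nf : ∀ d, z (D.arc d) = 1 → ¬ D.SameFace d (d.1, d.2 + 1) := by
    intro d hd hs
    have := hφ₀.eqvGen hs
    rw [hz', this, CharTwo.add_self_eq_zero] at hd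
    exact zero_ne_one hd
  -- The corners brought together at the joint already lie in common faces of `D`, so `φ` stays
  -- constant on the new faces.
  have f1 := hφ.eqvGen (h.sameFace (nf a ha))
  have f2 := hφ.eqvGen (h.swap.sameFace (nf b hb))
  refine ⟨fun p => φ (p.1.1, p.2), (resp_faceRel h.halfArc_mate).2 ?_, ?_⟩
  · rintro ⟨⟨c, hc⟩, i⟩
    rcases h.oppEnd_restrict (c, i) hc with ⟨h1, h2⟩ | ⟨h1, h2⟩ | ⟨h1, h2⟩
    · change φ ((oppEnd h.halfArc_mate (h.restrict (c, i) hc)).1.1, _) = _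
      rw [← h1] at f1
      exact (congrArg (fun p : {c // S c} × ZMod 4 => φ (p.1.1, p.2)) h2).trans f1.symm
    · rw [← h1] at f2
      exact (congrArg (fun p : {c // S c} × ZMod 4 => φ (p.1.1, p.2)) h2).trans f2.symm
    · exact (congrArg (fun p : {c // S c} × ZMod 4 => φ (p.1.1, p.2)) h2).trans
        (resp_faceStep.1 hφ (c, i))
  · rintro ⟨⟨c, hc⟩, i⟩
    exact (k1 (c, i) hc).symm.trans (hk' (c, i))

open Classical in
/-- The part of a diagram on one side of a cut. -/
noncomputable def IsCut.half (h : D.IsCut S a b) {z : D.E → ZMod 2}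
    (hz : z ∈ cycles D.arc ∧ z (D.arc a) = 1 ∧ z (D.arc b) = 1) : LinkDiagram :=
  letI : Fintype h.HalfArc := Fintype.ofFinite _
  { X := {c // S c}
    E := h.HalfArc
    arc := h.halfArc
    nonempty := ⟨h.joint⟩
    mate := h.halfArc_mate
    planar := h.half_planar hz.1 hz.2.1 hz.2.2 }

end LinkDiagram

namespace LinkDiagram

variable {D : LinkDiagram} {S : D.X → Prop} {a b : D.X × ZMod 4}

/-! ### The two sides of a cut as connected summands -/

theorem Connected.exists_arc (hD : D.Connected) [Nonempty D.X] (x : D.E) : ∃ d, D.arc d = x := by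
  obtain ⟨c⟩ := ‹Nonempty D.X›
  have hr : Resp D.ConnStep fun y => ∃ d, D.arc d = y := by
    rintro _ _ ⟨c, i, j, rfl, rfl⟩
    exact propext ⟨fun _ => ⟨_, rfl⟩, fun _ => ⟨_, rfl⟩⟩
  have := hr.eqvGen (hD (D.arc (c, 0)) x)
  exact this ▸ ⟨_, rfl⟩

theorem IsCut.exists_restrict (h : D.IsCut S a b) (x : h.HalfArc) :
    ∃ d, ∃ hd : S d.1, d ≠ b ∧ D.arc d = x.1 ∧ h.halfArc (h.restrict d hd) = x := by
  obtain ⟨x, ⟨d, hd, rfl⟩, hx⟩ := x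
  have hb : d ≠ b := fun e => hx (by rw [e])
  exact ⟨d, hd, hb, rfl, Subtype.ext (h.halfArc_val hd hb)⟩

theorem IsCut.half_connected (h : D.IsCut S a b) {z : D.E → ZMod 2}
    (hz : z ∈ cycles D.arc ∧ z (D.arc a) = 1 ∧ z (D.arc b) = 1) (hD : D.Connected) :
    (h.half hz).Connected := by
  intro x y
  refine eqvGen_iff_resp.2 fun (k : h.HalfArc → Prop) hk => ?_
  obtain ⟨K, K1, K2⟩ := h.exists_extension k (fun _ => k h.joint) rfl fun _ => True
  have hK : Resp D.ConnStep K := by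
    rintro _ _ ⟨c, i, j, rfl, rfl⟩
    by_cases hc : S c
    · rw [K1 (c, i) hc, K1 (c, j) hc]
      exact hk _ _ ⟨⟨c, hc⟩, i, j, rfl, rfl⟩
    · rw [K2 (c, i) hc, K2 (c, j) hc]
  obtain ⟨d, hd, -, -, rfl⟩ := h.exists_restrict x
  obtain ⟨d', hd', -, -, rfl⟩ := h.exists_restrict y
  rw [← K1, ← K1]
  exact hK.eqvGen (hD _ _)

/-- Modulo two the values cancel at the crossings of `S` and along its inner arcs; what remains are
the two cut arcs. -/
theorem IsCut.sum_states (h : D.IsCut S a b) {s : D.X → ℤˣ} {k : D.E → ZMod 2}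
    (hk : Resp (D.StateStep s) k) : k (D.arc a) = k (D.arc b) := by
  classical
  have h1 := h.sum_eq (fun d => k (D.arc d)) fun d => by rw [arc_oppEnd D.mate, CharTwo.neg_eq]
  rw [← zmod_two_add_eq_zero, ← h1, Fintype.sum_prod_type]
  refine Finset.sum_eq_zero fun c _ => ?_
  by_cases hc : S c
  · simp only [hc, if_true]
    exact sum_joins ((D.resp_stateStep).1 hk c)
  · simp [hc]

/-- The restriction of a function on arcs to one side of a cut. -/
theorem IsCut.restrict_apply (h : D.IsCut S a b) {β : Type*} {k : D.E → β}
    (hk : k (D.arc a) = k (D.arc b)) {d : D.X × ZMod 4} (hd : S d.1) :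
    k (h.halfArc (h.restrict d hd)).1 = k (D.arc d) := by
  by_cases hb : d = b
  · subst hb
    rw [h.halfArc_right]
    exact hk
  · rw [h.halfArc_val hd hb]

theorem IsCut.resp_half (h : D.IsCut S a b) {z : D.E → ZMod 2}
    (hz : z ∈ cycles D.arc ∧ z (D.arc a) = 1 ∧ z (D.arc b) = 1) {β : Type*} {s : D.X → ℤˣ}
    {f : h.HalfArc → β} {k : D.E → β}
    (H : ∀ d (hd : S d.1), k (D.arc d) = f (h.halfArc (h.restrict d hd))) :
    Resp ((h.half hz).StateStep fun c => s c.1) f ↔ ∀ c, S c → D.Joins c (marker (s c)) k := by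
  refine (resp_stateStep (h.half hz)).trans ?_
  constructor
  · intro h' c hc
    have := h' ⟨c, hc⟩
    refine ⟨?_, ?_⟩
    · rw [H (c, _) hc, H (c, _) hc]; exact this.1
    · rw [H (c, _) hc, H (c, _) hc]; exact this.2
  · rintro h' ⟨c, hc⟩
    have := h' c hc
    unfold Joins at this
    rw [H (c, _) hc, H (c, _) hc, H (c, _) hc, H (c, _) hc] at this
    exact this

/-- A function constant on the circles of `s` is a pair of such functions on the halves that agree
on the joints: one linear condition, nontrivial because constants exist. -/
theorem IsCut.stateCircles_add_one (h : D.IsCut S a b) {z z' : D.E → ZMod 2}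
    (hz : z ∈ cycles D.arc ∧ z (D.arc a) = 1 ∧ z (D.arc b) = 1)
    (hz' : z' ∈ cycles D.arc ∧ z' (D.arc (oppEnd D.mate a)) = 1 ∧
      z' (D.arc (oppEnd D.mate b)) = 1) (hD : D.Connected) (s : D.X → ℤˣ) :
    D.stateCircles s + 1 = (h.half hz).stateCircles (fun c => s c.1) +
      (h.compl.half hz').stateCircles (fun c => s c.1) := by
  have : Nonempty D.X := ⟨a.1⟩
  let V := inv (ZMod 2) (D.StateStep s)
  let V₁ := inv (ZMod 2) ((h.half hz).StateStep fun c => s c.1)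
  let V₂ := inv (ZMod 2) ((h.compl.half hz').StateStep fun c => s c.1)
  let Ψ : V₁ × V₂ →ₗ[ZMod 2] ZMod 2 :=
    { toFun := fun p => p.1.1 h.joint - p.2.1 h.compl.joint
      map_add' := fun p q => by
        change (p.1.1 _ + q.1.1 _) - (p.2.1 _ + q.2.1 _) = _
        ring
      map_smul' := fun r p => by
        change r * p.1.1 _ - r * p.2.1 _ = r * _
        ring }
  have hΨ : LinearMap.range Ψ = ⊤ := by
    rw [LinearMap.range_eq_top]
    intro r
    refine ⟨(⟨fun _ => r, fun _ _ _ => rfl⟩, 0), ?_⟩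
    change r - 0 = r
    rw [sub_zero]
  have hab : ∀ k : V, k.1 (D.arc a) = k.1 (D.arc b) := fun k => h.sum_states k.2
  have hab' : ∀ k : V, k.1 (D.arc (oppEnd D.mate a)) = k.1 (D.arc (oppEnd D.mate b)) := fun k => by
    rw [arc_oppEnd D.mate, arc_oppEnd D.mate, hab]
  have r1 : ∀ k : V, Resp ((h.half hz).StateStep fun c => s c.1) fun x : h.HalfArc => k.1 x.1 :=
    fun k => (h.resp_half hz (k := k.1) fun d hd => (h.restrict_apply (hab k) hd).symm).2
      fun c _ => (D.resp_stateStep).1 k.2 c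
  have r2 : ∀ k : V, Resp ((h.compl.half hz').StateStep fun c => s c.1)
      fun x : h.compl.HalfArc => k.1 x.1 :=
    fun k => (h.compl.resp_half hz' (k := k.1)
      fun d hd => (h.compl.restrict_apply (hab' k) hd).symm).2
      fun c _ => (D.resp_stateStep).1 k.2 c
  let Φ : V →ₗ[ZMod 2] LinearMap.ker Ψ :=
    { toFun := fun k => ⟨(⟨_, r1 k⟩, ⟨_, r2 k⟩), by
        change k.1 (D.arc a) - k.1 (D.arc (oppEnd D.mate a)) = 0
        rw [arc_oppEnd D.mate, sub_self]⟩
      map_add' := fun _ _ => rfl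
      map_smul' := fun _ _ => rfl }
  have hΦ : Function.Bijective Φ := by
    constructor
    · intro k l hkl
      have e1 : ∀ x : h.HalfArc, k.1 x.1 = l.1 x.1 :=
        fun x => congrFun (congrArg (fun p : LinearMap.ker Ψ => p.1.1.1) hkl) x
      have e2 : ∀ x : h.compl.HalfArc, k.1 x.1 = l.1 x.1 :=
        fun x => congrFun (congrArg (fun p : LinearMap.ker Ψ => p.1.2.1) hkl) x
      refine Subtype.ext (funext fun x => ?_)
      obtain ⟨d, rfl⟩ := hD.exists_arc x
      by_cases hd : S d.1
      · rw [← h.restrict_apply (hab k) hd, ← h.restrict_apply (hab l) hd, e1]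
      · rw [← h.compl.restrict_apply (hab' k) hd, ← h.compl.restrict_apply (hab' l) hd, e2]
    · rintro ⟨⟨f, g⟩, hfg⟩
      obtain ⟨k, k1, k2⟩ := h.exists_extension f.1 g.1 (sub_eq_zero.1 hfg) 0
      have hk : Resp (D.StateStep s) k := by
        rw [resp_stateStep]
        intro c
        by_cases hc : S c
        · exact (h.resp_half hz k1).1 f.2 c hc
        · exact (h.compl.resp_half hz' k2).1 g.2 c hc
      refine ⟨⟨k, hk⟩, Subtype.ext (Prod.ext (Subtype.ext (funext fun x => ?_))
        (Subtype.ext (funext fun x => ?_)))⟩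
      · obtain ⟨d, hd, -, hx, hx'⟩ := h.exists_restrict x
        change k x.1 = f.1 x
        rw [← hx, k1 d hd, hx']
      · obtain ⟨d, hd, -, hx, hx'⟩ := h.compl.exists_restrict x
        change k x.1 = g.1 x
        rw [← hx, k2 d hd, hx']
  have e := (LinearEquiv.ofBijective Φ hΦ).finrank_eq
  have e' := LinearMap.finrank_range_add_finrank_ker Ψ
  rw [hΨ, finrank_top, Module.finrank_self, ← e, Module.finrank_prod] at e'
  have f0 : Module.finrank (ZMod 2) V = D.stateCircles s := finrank_inv _ _
  have f1 : Module.finrank (ZMod 2) V₁ = (h.half hz).stateCircles (fun c => s c.1) :=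
    finrank_inv _ _
  have f2 : Module.finrank (ZMod 2) V₂ = (h.compl.half hz').stateCircles (fun c => s c.1) :=
    finrank_inv _ _
  rw [f0, f1, f2] at e'
  omega

theorem weight_mul {k k₁ k₂ : ℤ} {N N₁ N₂ : ℕ} (hk : k = k₁ + k₂) (hN : N + 1 = N₁ + N₂)
    (h₁ : 0 < N₁) (h₂ : 0 < N₂) : weight k N = weight k₁ N₁ * weight k₂ N₂ := by
  have : N - 1 = (N₁ - 1) + (N₂ - 1) := by omega
  rw [weight, weight, weight, this, pow_add, hk, LaurentPolynomial.T_add]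
  ring

/-- States are pairs of states and marker sums add. The relation |sD| - 1 = (|s₁D₁| - 1) + (|s₂D₂| -
1) makes the powers of δ multiply. -/
theorem IsCut.bracket_eq_mul (h : D.IsCut S a b) {z z' : D.E → ZMod 2}
    (hz : z ∈ cycles D.arc ∧ z (D.arc a) = 1 ∧ z (D.arc b) = 1)
    (hz' : z' ∈ cycles D.arc ∧ z' (D.arc (oppEnd D.mate a)) = 1 ∧
      z' (D.arc (oppEnd D.mate b)) = 1) (hD : D.Connected) :
    D.bracket = (h.half hz).bracket * (h.compl.half hz').bracket := by
  obtain ⟨glue, g1, g2, g3, g4⟩ := exists_sum_glue (ι := (h.half hz).X) (X := D.X)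
    (Y := (h.compl.half hz').X) (M := LaurentPolynomial ℤ) Subtype.val Subtype.val_injective
    (Equiv.subtypeEquivRight fun c =>
      not_congr ⟨fun hc => ⟨⟨c, hc⟩, rfl⟩, fun ⟨x, hx⟩ => hx ▸ x.2⟩)
  rw [bracket_eq, g4, bracket_eq, bracket_eq, Finset.sum_comm, Finset.sum_mul_sum]
  refine Finset.sum_congr rfl fun u _ => Finset.sum_congr rfl fun t _ => ?_
  have := h.stateCircles_add_one hz hz' hD (glue u t)
  rw [show (fun c : (h.half hz).X => glue u t c.1) = u from funext fun c => g1 u t c,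
    show (fun c : (h.compl.half hz').X => glue u t c.1) = t from funext fun c => g2 u t c] at this
  exact weight_mul (g3 u t) this (stateCircles_pos _ _) (stateCircles_pos _ _)

theorem IsCut.isConnectedSum (h : D.IsCut S a b) {z z' : D.E → ZMod 2}
    (hz : z ∈ cycles D.arc ∧ z (D.arc a) = 1 ∧ z (D.arc b) = 1)
    (hz' : z' ∈ cycles D.arc ∧ z' (D.arc (oppEnd D.mate a)) = 1 ∧
      z' (D.arc (oppEnd D.mate b)) = 1) (hD : D.Connected) :
    D.IsConnectedSum (h.half hz) (h.compl.half hz') := by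
  classical
  have : Nonempty D.X := ⟨a.1⟩
  have oa : D.arc (oppEnd D.mate a) = D.arc a := arc_oppEnd D.mate a
  have ob : D.arc (oppEnd D.mate b) = D.arc b := arc_oppEnd D.mate b
  have left : ∀ x : h.HalfArc, x ≠ h.joint → ∃ d, S d.1 ∧ d ≠ a ∧ d ≠ b ∧ D.arc d = x.1 := by
    intro x hx
    obtain ⟨d, hd, hb, e, -⟩ := h.exists_restrict x
    exact ⟨d, hd, fun ha => hx (Subtype.ext (by rw [← e, ha]; rfl)), hb, e⟩
  have hab : ∀ x : h.HalfArc, x ≠ h.joint → ¬ (x.1 = D.arc a ∨ x.1 = D.arc b) := by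
    rintro x hx (e | e)
    · exact hx (Subtype.ext e)
    · exact x.2.2 e
  have hab' : ∀ x : h.compl.HalfArc, x ≠ h.compl.joint → ¬ (x.1 = D.arc a ∨ x.1 = D.arc b) := by
    rintro x hx (e | e)
    · exact hx (Subtype.ext (e.trans oa.symm))
    · exact x.2.2 (e.trans ob.symm)
  have disj : ∀ x : h.HalfArc, x ≠ h.joint → ∀ y : h.compl.HalfArc, x.1 ≠ y.1 := by
    intro x hx y e
    obtain ⟨d, hd, ha, hb, hdx⟩ := left x hx
    obtain ⟨d', hd', -, hdy, -⟩ := h.compl.exists_restrict y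
    rcases (arc_eq_arc_iff D.mate).1 (hdy.trans (e.symm.trans hdx.symm)) with h' | h'
    · exact hd' (h' ▸ hd)
    · exact hd' (h' ▸ h.closed d hd ha hb)
  refine ⟨h.joint, h.compl.joint, Equiv.sumCompl S,
    Sum.elim (fun x : {x : h.HalfArc // x ≠ h.joint} => x.1.1)
      (fun x : {x : h.compl.HalfArc // x ≠ h.compl.joint} => x.1.1), D.arc a, D.arc b,
    ?_, ?_, ?_, ?_, ?_, ?_, ?_⟩
  · rintro (x | x) (y | y) hxy
    · exact congrArg Sum.inl (Subtype.ext (Subtype.ext hxy))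
    · exact absurd hxy (disj _ x.2 _)
    · exact absurd hxy.symm (disj _ y.2 _)
    · exact congrArg Sum.inr (Subtype.ext (Subtype.ext hxy))
  · intro x
    constructor
    · rintro ⟨x | x, rfl⟩
      · exact hab _ x.2
      · exact hab' _ x.2
    · intro hx
      obtain ⟨d, rfl⟩ := hD.exists_arc x
      by_cases hd : S d.1
      · exact ⟨.inl ⟨⟨D.arc d, ⟨d, hd, rfl⟩, fun e => hx (.inr e)⟩,
          fun e => hx (.inl (congrArg Subtype.val e))⟩, rfl⟩
      · exact ⟨.inr ⟨⟨D.arc d, ⟨d, hd, rfl⟩, fun e => hx (.inr (e.trans ob))⟩,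
          fun e => hx (.inl ((congrArg Subtype.val e).trans oa))⟩, rfl⟩
  · rintro ⟨c, hc⟩ i hi
    refine (h.halfArc_val (d := (c, i)) hc ?_).symm
    rintro rfl
    exact hi (h.halfArc_right hc)
  · rintro ⟨c, hc⟩ i hi
    refine (h.compl.halfArc_val (d := (c, i)) hc ?_).symm
    exact fun e => hi (dif_pos (congrArg D.arc e))
  · rintro ⟨c, hc⟩ i hi
    exact (h.halfArc_eq_joint (d := (c, i)) hc hi).imp (congrArg D.arc) (congrArg D.arc)
  · rintro ⟨c, hc⟩ i hi
    exact (h.compl.halfArc_eq_joint (d := (c, i)) hc hi).imp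
      (fun e => (congrArg D.arc e).trans oa) fun e => (congrArg D.arc e).trans ob
  · rintro - x (rfl | rfl)
    · exact ⟨⟨⟨a.1, h.left_mem⟩, a.2, rfl⟩, ⟨(oppEnd D.mate a).1, h.left_opp⟩, _, oa⟩
    · exact ⟨⟨⟨b.1, h.right_mem⟩, b.2, rfl⟩, ⟨(oppEnd D.mate b).1, h.right_opp⟩, _, ob⟩

theorem bracket_circle : circle.bracket = 1 := by
  have : IsEmpty circle.X := inferInstanceAs (IsEmpty Empty)
  have : Subsingleton circle.E := inferInstanceAs (Subsingleton Unit)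
  have : Nonempty circle.E := circle.nonempty
  have h1 : ∀ s, circle.stateCircles s = 1 := fun s => by
    refine le_antisymm ?_ (stateCircles_pos _ _)
    have : Subsingleton (Quot (circle.StateStep s)) := by
      refine ⟨fun x y => ?_⟩
      induction x using Quot.ind with | _ x
      induction y using Quot.ind with | _ y
      rw [Subsingleton.elim x y]
    exact Finite.card_le_one_iff_subsingleton.2 this
  rw [bracket, Fintype.sum_unique, h1]
  simp

/-! ### Spans of nonalternating diagrams. -/

theorem polySpan_mul_of_unknot {p q : LaurentPolynomial ℤ} {D' : LinkDiagram}
    (h : D'.toLink = Link.unknot) (hp : p = D'.bracket * q) : polySpan p = polySpan q := by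
  obtain ⟨u, k, e⟩ := bracket_unitEquiv (h : D'.toLink = circle.toLink)
  rw [bracket_circle, mul_one] at e
  exact UnitEquiv.polySpan_eq ⟨u, k, by rw [hp, e]⟩

theorem polySpan_bracket_le_of_connected (h : D.Connected) :
    polySpan D.bracket ≤ 4 * (D.crossings : ℤ) := by
  have := D.polySpan_bracket_le'
  rw [comps_eq_one h] at this
  push_cast at this
  linarith

/-- If the circle numbers fall short of n + 2, the general bound is strict. Otherwise a two-edge cut
exists, the unknotted factor does not affect the span, and the other half lacks at least one
crossing. -/
theorem polySpan_bracket_lt (hD : D.Connected) (hA : ¬ D.Alternating) (hP : D.toLink.IsPrime) :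
    polySpan D.bracket < 4 * (D.crossings : ℤ) := by
  by_cases h : D.stateCircles (fun _ => 1) + D.stateCircles (fun _ => -1) =
      D.crossings + 2 * D.comps
  · obtain ⟨S, a, b, h, z, hz, ha, hb⟩ := exists_isCut hA h
    have hz₁ : z ∈ cycles D.arc ∧ z (D.arc a) = 1 ∧ z (D.arc b) = 1 := ⟨hz, ha, hb⟩
    have hz₂ : z ∈ cycles D.arc ∧ z (D.arc (oppEnd D.mate a)) = 1 ∧
        z (D.arc (oppEnd D.mate b)) = 1 := by
      rwa [arc_oppEnd D.mate, arc_oppEnd D.mate]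
    have hm := h.bracket_eq_mul hz₁ hz₂ hD
    have l1 : (h.half hz₁).crossings < D.crossings :=
      @Fintype.card_subtype_lt D.X _ S (h.half hz₁).fintypeX _ h.left_opp
    have l2 : (h.compl.half hz₂).crossings < D.crossings :=
      @Fintype.card_subtype_lt D.X _ _ (h.compl.half hz₂).fintypeX _ (not_not.2 h.left_mem)
    rcases hP D _ _ rfl (h.isConnectedSum hz₁ hz₂ hD) with hu | hu
    · rw [polySpan_mul_of_unknot hu hm]
      have := polySpan_bracket_le_of_connected (h.compl.half_connected hz₂ hD)
      omega
    · rw [polySpan_mul_of_unknot hu (hm.trans (mul_comm _ _))]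
      have := polySpan_bracket_le_of_connected (h.half_connected hz₁ hD)
      omega
  · have h1 := D.polySpan_bracket_le
    have h2 := D.stateCircles_add_le
    rw [comps_eq_one hD] at h2 h
    unfold extremeDegree at h1
    omega

end LinkDiagram

namespace Link

open LinkDiagram

variable {L : Link} {V : AddMonoidAlgebra ℤ ℚ} {D : LinkDiagram}

/-! ### The Jones polynomial and the bracket -/

/-- The diagram defining `V` may differ from `D`: the writhe factor and the moves between them are
absorbed into one unit. -/
theorem IsJones.exists_shift (hV : L.IsJones V) (hD : D.toLink = L) :
    ∃ (u : ℤˣ) (k : ℤ), (∀ j : ℤ, V.coeff (-((j + k : ℤ) : ℚ) / 4) = u * D.bracket.coeff j) ∧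
      ∀ q, V.coeff q ≠ 0 → ∃ j : ℤ, q = -((j + k : ℤ) : ℚ) / 4 := by
  obtain ⟨D', o, rfl, rfl⟩ := hV
  have h0 : UnitEquiv (D'.normalizedBracket o) D'.bracket := ⟨_, _, rfl⟩
  obtain ⟨u, k, e⟩ := h0.trans (bracket_unitEquiv hD.symm)
  have hinj : Function.Injective fun k : ℤ => -(k : ℚ) / 4 := fun x y hxy => by
    have : (x : ℚ) = y := by
      simp only at hxy
      linarith
    exact_mod_cast this
  refine ⟨u, k, fun j => ?_, fun q hq => ?_⟩
  · rw [jones, AddMonoidAlgebra.coeff_mapDomain]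
    refine (Finsupp.mapDomain_apply hinj _ (j + k)).trans ?_
    rw [e, coeff_unit_mul, add_sub_cancel_right]
  · rw [jones, AddMonoidAlgebra.coeff_mapDomain] at hq
    by_contra! hne
    refine hq (Finsupp.mapDomain_of_notMem_range _ _ ?_)
    rintro ⟨j, rfl⟩
    refine hne (j - k) ?_
    simp

/-- The substitution A = t^(-1/4) reverses the order of exponents, so the greatest exponent of the
bracket gives the least one of `V`. -/
theorem IsJones.exists_extremes (hV : L.IsJones V) (hD : D.toLink = L) :
    ∃ (u : ℤˣ) (k : ℤ), (∀ j : ℤ, V.coeff (-((j + k : ℤ) : ℚ) / 4) = u * D.bracket.coeff j) ∧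
      (∀ M : ℤ, IsGreatest (D.bracket.coeff.support : Set ℤ) M →
        IsLeast (V.coeff.support : Set ℚ) (-((M + k : ℤ) : ℚ) / 4)) ∧
      (∀ m : ℤ, IsLeast (D.bracket.coeff.support : Set ℤ) m →
        IsGreatest (V.coeff.support : Set ℚ) (-((m + k : ℤ) : ℚ) / 4)) ∧
      (V.coeff.support.Nonempty → D.bracket.coeff.support.Nonempty) := by
  obtain ⟨u, k, h1, h2⟩ := hV.exists_shift hD
  have hmem : ∀ j : ℤ, -((j + k : ℤ) : ℚ) / 4 ∈ V.coeff.support ↔ j ∈ D.bracket.coeff.support := by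
    intro j
    rw [Finsupp.mem_support_iff, Finsupp.mem_support_iff, h1]
    simp
  refine ⟨u, k, h1, fun M hM => ⟨(hmem M).2 hM.1, fun q hq => ?_⟩,
    fun m hm => ⟨(hmem m).2 hm.1, fun q hq => ?_⟩, ?_⟩
  · obtain ⟨j, rfl⟩ := h2 q (Finsupp.mem_support_iff.1 hq)
    have : (j : ℚ) ≤ M := by exact_mod_cast hM.2 ((hmem j).1 hq)
    push_cast
    linarith
  · obtain ⟨j, rfl⟩ := h2 q (Finsupp.mem_support_iff.1 hq)
    have : (m : ℚ) ≤ j := by exact_mod_cast hm.2 ((hmem j).1 hq)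
    push_cast
    linarith
  · rintro ⟨q, hq⟩
    obtain ⟨j, rfl⟩ := h2 q (Finsupp.mem_support_iff.1 hq)
    exact ⟨j, (hmem j).1 hq⟩

theorem IsJones.four_mul_polySpan (hV : L.IsJones V) (hD : D.toLink = L) :
    4 * polySpan V = ((polySpan D.bracket : ℤ) : ℚ) := by
  obtain ⟨u, k, -, h1, h2, h3⟩ := hV.exists_extremes hD
  by_cases hb : D.bracket.coeff.support.Nonempty
  · obtain ⟨M, m, hM, hm⟩ := exists_isGreatest_isLeast hb
    rw [_root_.polySpan_eq hM hm, _root_.polySpan_eq (h2 m hm) (h1 M hM)]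
    push_cast
    ring
  · rw [polySpan_eq_zero hb, polySpan_eq_zero fun h => hb (h3 h)]
    simp

theorem IsJones.coeff_least (hV : L.IsJones V) (hD : D.toLink = L) (h : D.PlusAdequate) {m : ℚ}
    (hm : IsLeast (V.coeff.support : Set ℚ) m) : V.coeff m = 1 ∨ V.coeff m = -1 := by
  obtain ⟨u, k, h0, h1, -, -⟩ := hV.exists_extremes hD
  have hA : D.Adequate 1 := h
  have hc := hA.coeff_bracket
  rw [Units.val_one, one_mul] at hc
  rw [hm.unique (h1 _ (isGreatest_bracket hA)), h0, hc]
  rcases Int.units_eq_one_or u with rfl | rfl <;>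
    rcases neg_one_pow_eq_or ℤ (D.stateCircles (fun _ => 1) - 1) with e | e <;> simp [e]

theorem IsJones.coeff_greatest (hV : L.IsJones V) (hD : D.toLink = L) (h : D.MinusAdequate) {m : ℚ}
    (hm : IsGreatest (V.coeff.support : Set ℚ) m) : V.coeff m = 1 ∨ V.coeff m = -1 := by
  obtain ⟨u, k, h0, -, h1, -⟩ := hV.exists_extremes hD
  have hA : D.Adequate (-1) := h
  have hc := hA.coeff_bracket
  rw [Units.val_neg, Units.val_one, neg_one_mul] at hc
  rw [hm.unique (h1 _ (isLeast_bracket hA)), h0, hc]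
  rcases Int.units_eq_one_or u with rfl | rfl <;>
    rcases neg_one_pow_eq_or ℤ (D.stateCircles (fun _ => -1) - 1) with e | e <;> simp [e]

theorem crossings_eq_crossingNumber (hD : D.toLink = L) (h : D.Alternating) (hr : D.Reduced) :
    D.crossings = L.crossingNumber := by
  refine le_antisymm (le_csInf ⟨_, D, hD, rfl⟩ ?_) (Nat.sInf_le ⟨D, hD, rfl⟩)
  rintro _ ⟨D', hD', rfl⟩
  exact crossings_le_of_reduced h hr (hD'.trans hD.symm)

theorem polySpan_bracket_of_connected (hc : D.Connected) (h : D.Alternating) (hr : D.Reduced) :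
    polySpan D.bracket = 4 * (D.crossings : ℤ) := by
  rw [polySpan_bracket_of_reduced h hr, comps_eq_one hc]
  push_cast
  ring

end Link

theorem corollary3p11 (L : Link) :
    -- extreme coefficients of the Jones polynomial and adequate diagrams
    (∀ V, L.IsJones V → ∀ m : ℚ, IsLeast (V.coeff.support : Set ℚ) m →
      V.coeff m ≠ 1 → V.coeff m ≠ -1 →
        ∀ D : LinkDiagram, D.toLink = L → ¬ D.PlusAdequate) ∧
    (∀ V, L.IsJones V → ∀ m : ℚ, IsGreatest (V.coeff.support : Set ℚ) m →
      V.coeff m ≠ 1 → V.coeff m ≠ -1 →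
        ∀ D : LinkDiagram, D.toLink = L → ¬ D.MinusAdequate) ∧
    -- connected reduced alternating diagrams
    (∀ D : LinkDiagram, D.toLink = L → D.Connected → D.Alternating → D.Reduced →
      polySpan D.bracket = 4 * (D.crossings : ℤ) ∧
        ∀ V, L.IsJones V → 4 * polySpan V = 4 * (D.crossings : ℚ)) ∧
    -- nonalternating diagrams of prime nonsplit links
    (L.IsPrime → L.NonSplit → ∀ D : LinkDiagram, D.toLink = L → ¬ D.Alternating →
      ∀ V, L.IsJones V → polySpan V < (D.crossings : ℚ)) ∧
    -- the first Tait conjecture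
    (∀ D : LinkDiagram, D.toLink = L → D.Alternating → D.Reduced →
      D.crossings = L.crossingNumber) ∧
    (L.IsPrime → L.NonSplit →
      (∃ D : LinkDiagram, D.toLink = L ∧ D.Alternating ∧ D.Reduced) →
        ∀ D : LinkDiagram, D.toLink = L → ¬ D.Alternating → L.crossingNumber < D.crossings) := by
  refine ⟨?_, ?_, ?_, ?_, ?_, ?_⟩
  · intro V hV m hm h1 h2 D hD hA
    exact (hV.coeff_least hD hA hm).elim h1 h2
  · intro V hV m hm h1 h2 D hD hA
    exact (hV.coeff_greatest hD hA hm).elim h1 h2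
  · intro D hD hc hA hr
    have h := Link.polySpan_bracket_of_connected hc hA hr
    refine ⟨h, fun V hV => ?_⟩
    rw [hV.four_mul_polySpan hD, h]
    push_cast
    rfl
  · rintro hP hN D rfl hA V hV
    have h1 := LinkDiagram.polySpan_bracket_lt (hN D rfl) hA hP
    have h2 := hV.four_mul_polySpan rfl
    have h3 : ((polySpan D.bracket : ℤ) : ℚ) < 4 * (D.crossings : ℚ) := by exact_mod_cast h1
    linarith
  · intro D hD hA hr
    exact Link.crossings_eq_crossingNumber hD hA hr
  · rintro hP hN ⟨D₀, hD₀, hA₀, hr₀⟩ D rfl hA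
    -- The crossing number is attained by `D₀`, whose span 4n is also the span of `D`.
    rw [← Link.crossings_eq_crossingNumber hD₀ hA₀ hr₀]
    have h1 := LinkDiagram.polySpan_bracket_lt (hN D rfl) hA hP
    have h2 := Link.polySpan_bracket_of_connected (hN D₀ hD₀) hA₀ hr₀
    rw [(LinkDiagram.bracket_unitEquiv hD₀).polySpan_eq] at h2
    omega
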